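/- Let $K$ be a field. All algebras are finite-dimensional over $K$, all modules are finite-dimensional left modules, and $D=\mathrm{Hom}_K(-,K)$. For an algebra $\Lambda$ write $(X,Y)=\mathrm{Hom}_\Lambda(X,Y)$, and let $\mathrm{add}(M)$ be the class of direct summands of finite direct sums of copies of $M$. Two tuples $(\Lambda,M_1,\dots,M_t)$ and $(\Lambda',M_1',\dots,M_t')$ of an algebra and modules over it are equivalent if there is a $K$-linear Morita equivalence from $\Lambda$ to $\Lambda'$ that restricts to an equivalence $\mathrm{add}(M_i)\to\mathrm{add}(M_i')$ for each $i$; $[\Lambda,M_1,\dots,M_t]$ is the equivalence class. A set of classes described by a condition on $(\Lambda,M_1,\dots,M_t)$ consists of the classes that have a representative satisfying the condition. $M$ is regarded as a left $\mathrm{End}_\Lambda(M)$-module, and so are $(G,M)$ and $D(M,H)$. For a module $G$, a short exact sequence is $\mathbf F_G$-exact if $(G,-)$ is exact on it; for a module $H$, it is $\mathbf F^H$-exact if $(-,H)$ is exact on it. Let $\mathbf F$ be $\mathbf F_G$ or $\mathbf F^H$. A module $P$ is $\mathbf F$-projective if $(P,-)$ is exact on all $\mathbf F$-exact sequences. $\mathrm{cogen}^1_{\mathbf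 F}(M)$ is the class of modules $N$ for which there is an exact sequence $0\to N\to M_0\to M_1$ with $M_0,M_1\in\mathrm{add}(M)$ such that the monomorphisms $N\to M_0$ and $\mathrm{Im}(M_0\to M_1)\to M_1$ are the left-hand maps of $\mathbf F$-exact short exact sequences and $(M_1,M)\to(M_0,M)\to(N,M)\to0$ is exact. $M$ is $1$-$\mathbf F$-faithful if every $\mathbf F$-projective module lies in $\mathrm{cogen}^1_{\mathbf F}(M)$. $\tau^-$ is the inverse Auslander–Reiten translate. Let $\Omega_N^-X$ be the cokernel of a minimal left $\mathrm{add}(N)$-approximation of $X$, $\Omega_NX$ the kernel of a minimal right $\mathrm{add}(N)$-approximation of $X$, $\Omega_N^{-2}=\Omega_N^-\Omega_N^-$ and $\Omega_N^2=\Omega_N\Omega_N$. An exact sequence $0\to L\to N_0\to N_1\to R\to0$ is called a strong $\mathrm{add}(N)$-dualizing sequence with ends $L$ and $R$ if $N_0,N_1\in\mathrm{add}(N)$, the functors $(-,N)$, $D(N,-)$ and $D(L,-)$ are exact on it, $\mathrm{add}(R)=\mathrm{add}(N\oplus\Omega_N^{-2}L)$ and $\mathrm{add}(L)=\mathrm{add}(N\oplus\Omega_N^{2}R)$.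 (1) (Relative generator correspondence.) The assignment $[\Lambda,M,G]\mapsto[\mathrm{End}_\Lambda(M),M,(G,M)]$ is well defined on equivalence classes and restricts to an involution on the set of classes $[\Lambda,M,G]$ with $\Lambda\oplus M\in\mathrm{add}(G)$ and $M$ $1$-$\mathbf F_G$-faithful. (2) (Relative cogenerator correspondence.) The assignment $[\Lambda,M,H]\mapsto[\mathrm{End}_\Lambda(M),M,D(M,H)]$ is well defined on equivalence classes and restricts to an involution on the set of classes $[\Lambda,M,H]$ with $D\Lambda\oplus M\in\mathrm{add}(H)$ and $M$ $1$-$\mathbf F^H$-faithful. (3) (Relative Morita–Tachikawa correspondence.) The assignment $[\Lambda,M,G,H]\mapsto[\mathrm{End}_\Lambda(M),M,(G,M),D(M,H)]$ is well defined on equivalence classes and restricts to a bijection from the set of classes $[\Lambda,M,G,H]$ with $\Lambda\in\mathrm{add}(G)$, $D\Lambda\in\mathrm{add}(H)$, $G\cong\Lambda\oplus\tau^-H$, $M\in\mathrm{add}(G)\cap\mathrm{add}(H)$ and $M$ $1$-$\mathbf F_G$-faithful onto the set of classes $[\Gamma,N,L,R]$ such that $L$ and $R$ are the ends of a strong $\mathrm{add}(N)$-dualizing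 sequence, $\Gamma\in\mathrm{add}(L)$ and $D\Gamma\in\mathrm{add}(R)$. -/

import Mathlib

open CategoryTheory

universe u

noncomputable section

namespace RelFB

/-! ## Finite-dimensional algebras and modules over a field `K` -/

/-- A finite-dimensional associative unital algebra over the field `K`. -/
structure FDAlg (K : Type u) [Field K] : Type (u + 1) where
  carrier : Type u
  [ring : Ring carrier]
  [algebra : Algebra K carrier]
  [finite : FiniteDimensional K carrier]

instance (K : Type u) [Field K] : CoeSort (FDAlg K) (Type u) := ⟨FDAlg.carrier⟩

attribute [instance] FDAlg.ring FDAlg.algebra FDAlg.finite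

/-- A finite-dimensional left module over the `K`-algebra `Λ`. -/
structure FDMod (K : Type u) [Field K] (Λ : FDAlg K) : Type (u + 1) where
  carrier : Type u
  [addCommGroup : AddCommGroup carrier]
  [baseModule : Module K carrier]
  [module : Module Λ carrier]
  [tower : IsScalarTower K Λ carrier]
  [finite : FiniteDimensional K carrier]

instance (K : Type u) [Field K] (Λ : FDAlg K) : CoeSort (FDMod K Λ) (Type u) :=
  ⟨FDMod.carrier⟩

attribute [instance] FDMod.addCommGroup FDMod.baseModule FDMod.module FDMod.tower FDMod.finite

variable {K : Type u} [Field K] {Λ : FDAlg K}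

/-- The `K`-vector space of `Λ`-linear maps between finite-dimensional modules is
finite-dimensional. -/
instance homFinite (X Y : FDMod K Λ) : FiniteDimensional K (X →ₗ[Λ] Y) :=
  Module.Finite.of_injective
    (LinearMap.restrictScalarsₗ K Λ X Y K) (LinearMap.restrictScalars_injective K)

/-- `X ∈ add(M)`: `X` is a direct summand of a finite direct sum of copies of `M`. -/
def InAdd (Λ : Type u) [Ring Λ] (X M : Type u) [AddCommGroup X] [Module Λ X]
    [AddCommGroup M] [Module Λ M] : Prop :=
  ∃ (n : ℕ) (i : X →ₗ[Λ] (Fin n → M)) (p : (Fin n → M) →ₗ[Λ] X), p ∘ₗ i = LinearMap.id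

/-- Membership in `add(M)` is invariant under isomorphism. -/
theorem InAdd.of_equiv {Λ : Type u} [Ring Λ] {X Y M : Type u} [AddCommGroup X] [Module Λ X]
    [AddCommGroup Y] [Module Λ Y] [AddCommGroup M] [Module Λ M] (e : X ≃ₗ[Λ] Y)
    (h : InAdd Λ X M) : InAdd Λ Y M := by
  obtain ⟨n, i, p, hp⟩ := h
  refine ⟨n, i ∘ₗ e.symm.toLinearMap, e.toLinearMap ∘ₗ p, ?_⟩
  ext y
  have := LinearMap.congr_fun hp (e.symm y)
  simp only [LinearMap.comp_apply, LinearMap.id_apply] at this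
  simp [this]

/-! ## Tuples of an algebra and modules up to Morita equivalence -/

/-- A tuple `(Λ, M₀, …, M_{n-1})` of a finite-dimensional algebra and modules over it. -/
structure AlgTuple (K : Type u) [Field K] (n : ℕ) : Type (u + 1) where
  alg : FDAlg K
  mod : Fin n → FDMod K alg

/-- Two tuples are equivalent if there is a (`K`-linear) Morita equivalence of the algebras under
which, for each `i`, the subcategories `add(Mᵢ)` and `add(Mᵢ')` correspond. -/
def AlgTuple.Rel {n : ℕ} (s t : AlgTuple K n) : Prop :=
  ∃ e : MoritaEquivalence K s.alg t.alg, ∀ (i : Fin n) (X : ModuleCat.{u} s.alg),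
    InAdd s.alg X (s.mod i) ↔ InAdd t.alg (e.eqv.functor.obj X) (t.mod i)

theorem AlgTuple.rel_equivalence (K : Type u) [Field K] (n : ℕ) :
    Equivalence (AlgTuple.Rel (K := K) (n := n)) where
  refl s := ⟨MoritaEquivalence.refl K s.alg, fun _ _ => Iff.rfl⟩
  symm := by
    rintro s t ⟨e, he⟩
    refine ⟨e.symm, fun i Y => ?_⟩
    have h := he i (e.eqv.inverse.obj Y)
    have c : (e.eqv.functor.obj (e.eqv.inverse.obj Y)) ≅ Y := e.eqv.counitIso.app Y
    exact ⟨fun hY => h.2 (hY.of_equiv c.symm.toLinearEquiv),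
      fun hY => (h.1 hY).of_equiv c.toLinearEquiv⟩
  trans := by
    rintro s t r ⟨e, he⟩ ⟨e', he'⟩
    exact ⟨e.trans K e', fun i X => (he i X).trans (he' i _)⟩

instance AlgTuple.setoid (K : Type u) [Field K] (n : ℕ) : Setoid (AlgTuple K n) :=
  ⟨AlgTuple.Rel, AlgTuple.rel_equivalence K n⟩

/-- Equivalence classes `[Λ, M₀, …, M_{n-1}]` of tuples. -/
def TupleClass (K : Type u) [Field K] (n : ℕ) : Type (u + 1) :=
  Quotient (AlgTuple.setoid K n)

/-- The class `[Λ, M, G]` of a triple. -/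
def cls₃ (Λ : FDAlg K) (M G : FDMod K Λ) : TupleClass K 2 :=
  Quotient.mk (AlgTuple.setoid K 2) ⟨Λ, ![M, G]⟩

/-- The class `[Λ, M, G, H]` of a 4-tuple. -/
def cls₄ (Λ : FDAlg K) (M G H : FDMod K Λ) : TupleClass K 3 :=
  Quotient.mk (AlgTuple.setoid K 3) ⟨Λ, ![M, G, H]⟩

/-! ## The modules `Λ`, `DΛ`, `M` over `End(M)`, `(G, M)` and `D(M, H)` -/

/-- The left regular module `Λ`. -/
def regMod (Λ : FDAlg K) : FDMod K Λ where
  carrier := Λ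

/-- The injective cogenerator `DΛ = Hom_K(Λ, K)`, a left `Λ`-module via `(a • φ)(x) = φ(x a)`. -/
def dualReg (Λ : FDAlg K) : FDMod K Λ :=
  letI : Module Λ (Module.Dual K Λ) :=
    { smul := fun a φ => φ ∘ₗ LinearMap.mulRight K a
      one_smul := fun φ => LinearMap.ext fun x => congrArg φ (mul_one x)
      mul_smul := fun a b φ => LinearMap.ext fun x => congrArg φ (mul_assoc x a b).symm
      smul_zero := fun _ => rfl
      smul_add := fun _ _ _ => rfl
      add_smul := fun a b φ => LinearMap.ext fun x =>
        (congrArg φ (mul_add x a b)).trans (map_add φ _ _)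
      zero_smul := fun φ => LinearMap.ext fun x =>
        (congrArg φ (mul_zero x)).trans (map_zero φ) }
  letI : IsScalarTower K Λ (Module.Dual K Λ) :=
    ⟨fun k a φ => LinearMap.ext fun x =>
      (congrArg φ (mul_smul_comm k x a)).trans (map_smul φ k _)⟩
  { carrier := Module.Dual K Λ }

/-- The endomorphism algebra `End_Λ(M)`, with product `g f = g ∘ f`. -/
def endAlg (M : FDMod K Λ) : FDAlg K :=
  haveI := homFinite M M
  { carrier := Module.End Λ M
    finite := homFinite M M }

/-- `M` as a left `End_Λ(M)`-module. -/
def overEnd (M : FDMod K Λ) : FDMod K (endAlg M) where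
  carrier := M
  module := inferInstanceAs (Module (Module.End Λ M) M)
  tower := inferInstanceAs (IsScalarTower K (Module.End Λ M) M)

/-- `(G, M) = Hom_Λ(G, M)` as a left `End_Λ(M)`-module via `s • f = s ∘ f`. -/
def homMod (G M : FDMod K Λ) : FDMod K (endAlg M) where
  carrier := G →ₗ[Λ] M
  module := inferInstanceAs (Module (Module.End Λ M) (G →ₗ[Λ] M))
  tower := inferInstanceAs (IsScalarTower K (Module.End Λ M) (G →ₗ[Λ] M))

/-- Precomposition with an endomorphism, as a `K`-linear map. -/
def precomp (M H : FDMod K Λ) (s : M →ₗ[Λ] M) : (M →ₗ[Λ] H) →ₗ[K] (M →ₗ[Λ] H) where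
  toFun f := f ∘ₗ s
  map_add' _ _ := rfl
  map_smul' _ _ := rfl

/-- `D(M, H) = Hom_K(Hom_Λ(M, H), K)` as a left `End_Λ(M)`-module via `(s • φ)(f) = φ(f ∘ s)`. -/
def dualHomMod (M H : FDMod K Λ) : FDMod K (endAlg M) :=
  letI : Module (endAlg M) (Module.Dual K (M →ₗ[Λ] H)) :=
    { smul := fun s φ => φ ∘ₗ precomp M H s
      one_smul := fun _ => rfl
      mul_smul := fun _ _ _ => rfl
      smul_zero := fun _ => rfl
      smul_add := fun _ _ _ => rfl
      add_smul := fun s t φ => LinearMap.ext fun f =>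
        (congrArg φ (LinearMap.comp_add (f := s) (g := t) (h := f))).trans (map_add φ _ _)
      zero_smul := fun φ => LinearMap.ext fun f =>
        (congrArg φ (LinearMap.comp_zero f)).trans (map_zero φ) }
  letI : IsScalarTower K (endAlg M) (Module.Dual K (M →ₗ[Λ] H)) :=
    ⟨fun k s φ => LinearMap.ext fun f => by
      have h : precomp M H (k • (show M →ₗ[Λ] M from s)) f = k • precomp M H s f :=
        LinearMap.ext fun m => LinearMap.map_smul_of_tower f k _
      exact (congrArg φ h).trans (map_smul φ k _)⟩
  { carrier := Module.Dual K (M →ₗ[Λ] H) }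

/-! ## Relative homological algebra -/

/-- `0 → A → B → C → 0` is a short exact sequence. -/
def ShortExact {A B C : FDMod K Λ} (f : A →ₗ[Λ] B) (g : B →ₗ[Λ] C) : Prop :=
  Function.Injective f ∧ Function.Exact f g ∧ Function.Surjective g

/-- A class of short exact sequences of finite-dimensional `Λ`-modules. -/
def SESClass (K : Type u) [Field K] (Λ : FDAlg K) : Type (u + 1) :=
  ∀ ⦃A B C : FDMod K Λ⦄, (A →ₗ[Λ] B) → (B →ₗ[Λ] C) → Prop

/-- The `F_G`-exact sequences: the short exact sequences on which `Hom(G, -)` is exact. -/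
def lowerF (G : FDMod K Λ) : SESClass K Λ := fun _ B C f g =>
  ShortExact f g ∧ ∀ φ : G →ₗ[Λ] C, ∃ ψ : G →ₗ[Λ] B, g ∘ₗ ψ = φ

/-- The `F^H`-exact sequences: the short exact sequences on which `Hom(-, H)` is exact. -/
def upperF (H : FDMod K Λ) : SESClass K Λ := fun A B _ f g =>
  ShortExact f g ∧ ∀ φ : A →ₗ[Λ] H, ∃ ψ : B →ₗ[Λ] H, ψ ∘ₗ f = φ

/-- `P` is `F`-projective: `Hom(P, -)` is exact on all `F`-exact sequences. -/
def RelProjective (F : SESClass K Λ) (P : FDMod K Λ) : Prop :=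
  ∀ ⦃A B C : FDMod K Λ⦄ (f : A →ₗ[Λ] B) (g : B →ₗ[Λ] C), F f g →
    ∀ φ : P →ₗ[Λ] C, ∃ ψ : P →ₗ[Λ] B, g ∘ₗ ψ = φ

/-- `f : X → Y` is an `F`-monomorphism: it is the left-hand map of an `F`-exact sequence
`0 → X → Y → Coker f → 0`. -/
def RelMono (F : SESClass K Λ) {X Y : FDMod K Λ} (f : X →ₗ[Λ] Y) : Prop :=
  ∃ (C : FDMod K Λ) (π : Y →ₗ[Λ] C), F f π

/-- The image of a `Λ`-linear map, as a finite-dimensional module. -/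
def image {X Y : FDMod K Λ} (f : X →ₗ[Λ] Y) : FDMod K Λ where
  carrier := LinearMap.range f
  finite := Module.Finite.of_injective
    ((LinearMap.range f).subtype.restrictScalars K) Subtype.val_injective

/-- The inclusion of the image of a `Λ`-linear map into its target. -/
def imageIncl {X Y : FDMod K Λ} (f : X →ₗ[Λ] Y) : image f →ₗ[Λ] Y :=
  (LinearMap.range f).subtype

/-- `N ∈ cogen¹_F(M)`: there is an `F`-exact sequence `0 → N → M₀ → M₁` with `M₀, M₁ ∈ add(M)`
such that `Hom(M₁, M) → Hom(M₀, M) → Hom(N, M) → 0` is exact. -/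
def Cogen₁ (F : SESClass K Λ) (M N : FDMod K Λ) : Prop :=
  ∃ (M₀ M₁ : FDMod K Λ) (f : N →ₗ[Λ] M₀) (g : M₀ →ₗ[Λ] M₁),
    InAdd Λ M₀ M ∧ InAdd Λ M₁ M ∧
    Function.Injective f ∧ Function.Exact f g ∧
    RelMono F f ∧ RelMono F (imageIncl g) ∧
    Function.Exact (fun φ : M₁ →ₗ[Λ] M => φ ∘ₗ g) (fun φ : M₀ →ₗ[Λ] M => φ ∘ₗ f) ∧
    Function.Surjective (fun φ : M₀ →ₗ[Λ] M => φ ∘ₗ f)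

/-- `M` is `1`-`F`-faithful: every `F`-projective module lies in `cogen¹_F(M)`. -/
def OneFaithful (F : SESClass K Λ) (M : FDMod K Λ) : Prop :=
  ∀ P : FDMod K Λ, RelProjective F P → Cogen₁ F M P

/-! ## The inverse Auslander-Reiten translate -/

/-- `f : X → I` is an injective envelope. -/
def IsInjEnvelope {X I : FDMod K Λ} (f : X →ₗ[Λ] I) : Prop :=
  Module.Injective Λ I ∧ Function.Injective f ∧
    ∀ S : Submodule Λ I, S ⊓ LinearMap.range f = ⊥ → S = ⊥

/-- `H → I₀ → I₁` is a minimal injective copresentation of `H`: `H → I₀` and the inclusion of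
`Im d = I₀ / H` into `I₁` are injective envelopes. -/
def IsMinInjCopres {H I₀ I₁ : FDMod K Λ} (i : H →ₗ[Λ] I₀) (d : I₀ →ₗ[Λ] I₁) : Prop :=
  IsInjEnvelope i ∧ Function.Exact i d ∧ IsInjEnvelope (imageIncl d)

/-- Right multiplication by `a` on the bimodule `DΛ`: `(φ · a)(x) = φ(a x)`. -/
def dualRegRight (Λ : FDAlg K) (a : Λ) : dualReg Λ →ₗ[Λ] dualReg Λ where
  toFun φ := (show Module.Dual K Λ from φ) ∘ₗ LinearMap.mulLeft K a
  map_add' _ _ := rfl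
  map_smul' b φ := LinearMap.ext fun x =>
    congrArg (show Module.Dual K Λ from φ) (mul_assoc a x b)

/-- The inverse Nakayama functor on objects: `ν⁻ I = Hom_Λ(DΛ, I)`, a left `Λ`-module via
`(a • f)(φ) = f(φ · a)`. -/
def nuInv (I : FDMod K Λ) : FDMod K Λ :=
  letI : Module Λ (dualReg Λ →ₗ[Λ] I) :=
    { smul := fun a f => f ∘ₗ dualRegRight Λ a
      one_smul := fun f => LinearMap.ext fun φ => congrArg f <|
        LinearMap.ext fun x => congrArg (show Module.Dual K Λ from φ) (one_mul x)
      mul_smul := fun a b f => LinearMap.ext fun φ => congrArg f <|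
        LinearMap.ext fun x => congrArg (show Module.Dual K Λ from φ) (mul_assoc a b x)
      smul_zero := fun _ => rfl
      smul_add := fun _ _ _ => rfl
      add_smul := fun a b f => LinearMap.ext fun φ => by
        have h : dualRegRight Λ (a + b) φ = dualRegRight Λ a φ + dualRegRight Λ b φ :=
          LinearMap.ext fun x =>
            (congrArg (show Module.Dual K Λ from φ) (add_mul a b x)).trans
              (map_add (show Module.Dual K Λ from φ) _ _)
        exact (congrArg f h).trans (map_add f _ _)
      zero_smul := fun f => LinearMap.ext fun φ => by
        have h : dualRegRight Λ 0 φ = 0 :=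
          LinearMap.ext fun x =>
            (congrArg (show Module.Dual K Λ from φ) (zero_mul x)).trans
              (map_zero (show Module.Dual K Λ from φ))
        exact (congrArg f h).trans (map_zero f) }
  letI : IsScalarTower K Λ (dualReg Λ →ₗ[Λ] I) :=
    ⟨fun k a f => LinearMap.ext fun φ => by
      have h : dualRegRight Λ (k • a) φ = k • dualRegRight Λ a φ :=
        LinearMap.ext fun x =>
          (congrArg (show Module.Dual K Λ from φ) (smul_mul_assoc k a x)).trans
            (map_smul (show Module.Dual K Λ from φ) k _)
      exact (congrArg f h).trans (LinearMap.map_smul_of_tower f k _)⟩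
  { carrier := dualReg Λ →ₗ[Λ] I
    finite := homFinite _ _ }

/-- The inverse Nakayama functor on maps: `ν⁻ d = Hom_Λ(DΛ, d)`. -/
def nuInvMap {I J : FDMod K Λ} (d : I →ₗ[Λ] J) : nuInv I →ₗ[Λ] nuInv J where
  toFun f := d ∘ₗ (show dualReg Λ →ₗ[Λ] I from f)
  map_add' f g := LinearMap.comp_add (f := (show dualReg Λ →ₗ[Λ] I from f))
    (g := (show dualReg Λ →ₗ[Λ] I from g)) (h := d)
  map_smul' _ _ := rfl

/-- `T` is (isomorphic to) the inverse Auslander-Reiten translate `τ⁻ H`: the cokernel of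
`ν⁻ I₀ → ν⁻ I₁` for a minimal injective copresentation `0 → H → I₀ → I₁`. -/
def IsTauInv (H T : FDMod K Λ) : Prop :=
  ∃ (I₀ I₁ : FDMod K Λ) (i : H →ₗ[Λ] I₀) (d : I₀ →ₗ[Λ] I₁) (π : nuInv I₁ →ₗ[Λ] T),
    IsMinInjCopres i d ∧ Function.Exact (nuInvMap d) π ∧ Function.Surjective π

/-! ## Strong dualizing sequences -/

/-- `f : X → N₀` is a minimal left `add(N)`-approximation. -/
def IsMinLeftApprox (N : FDMod K Λ) {X N₀ : FDMod K Λ} (f : X →ₗ[Λ] N₀) : Prop :=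
  InAdd Λ N₀ N ∧ (∀ φ : X →ₗ[Λ] N, ∃ ψ : N₀ →ₗ[Λ] N, ψ ∘ₗ f = φ) ∧
    ∀ θ : N₀ →ₗ[Λ] N₀, θ ∘ₗ f = f → Function.Bijective θ

/-- `g : N₀ → X` is a minimal right `add(N)`-approximation. -/
def IsMinRightApprox (N : FDMod K Λ) {N₀ X : FDMod K Λ} (g : N₀ →ₗ[Λ] X) : Prop :=
  InAdd Λ N₀ N ∧ (∀ φ : N →ₗ[Λ] X, ∃ ψ : N →ₗ[Λ] N₀, g ∘ₗ ψ = φ) ∧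
    ∀ θ : N₀ →ₗ[Λ] N₀, g ∘ₗ θ = g → Function.Bijective θ

/-- `Y` is (isomorphic to) `Ω⁻_N X`, the cokernel of a minimal left `add(N)`-approximation
of `X`. -/
def IsCosyzygy (N X Y : FDMod K Λ) : Prop :=
  ∃ (N₀ : FDMod K Λ) (f : X →ₗ[Λ] N₀) (π : N₀ →ₗ[Λ] Y),
    IsMinLeftApprox N f ∧ Function.Exact f π ∧ Function.Surjective π

/-- `Y` is (isomorphic to) `Ω_N X`, the kernel of a minimal right `add(N)`-approximation
of `X`. -/
def IsSyzygy (N X Y : FDMod K Λ) : Prop :=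
  ∃ (N₀ : FDMod K Λ) (ι : Y →ₗ[Λ] N₀) (g : N₀ →ₗ[Λ] X),
    IsMinRightApprox N g ∧ Function.Exact ι g ∧ Function.Injective ι

/-- `Hom(X, -)` is exact on the sequence `0 → A → B → C → D → 0`. -/
def HomFromExact (X : FDMod K Λ) {A B C D : FDMod K Λ}
    (f : A →ₗ[Λ] B) (g : B →ₗ[Λ] C) (h : C →ₗ[Λ] D) : Prop :=
  Function.Injective (fun φ : X →ₗ[Λ] A => f ∘ₗ φ) ∧
  Function.Exact (fun φ : X →ₗ[Λ] A => f ∘ₗ φ) (fun φ : X →ₗ[Λ] B => g ∘ₗ φ) ∧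
  Function.Exact (fun φ : X →ₗ[Λ] B => g ∘ₗ φ) (fun φ : X →ₗ[Λ] C => h ∘ₗ φ) ∧
  Function.Surjective (fun φ : X →ₗ[Λ] C => h ∘ₗ φ)

/-- `Hom(-, X)` is exact on the sequence `0 → A → B → C → D → 0`. -/
def HomToExact (X : FDMod K Λ) {A B C D : FDMod K Λ}
    (f : A →ₗ[Λ] B) (g : B →ₗ[Λ] C) (h : C →ₗ[Λ] D) : Prop :=
  Function.Injective (fun φ : D →ₗ[Λ] X => φ ∘ₗ h) ∧
  Function.Exact (fun φ : D →ₗ[Λ] X => φ ∘ₗ h) (fun φ : C →ₗ[Λ] X => φ ∘ₗ g) ∧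
  Function.Exact (fun φ : C →ₗ[Λ] X => φ ∘ₗ g) (fun φ : B →ₗ[Λ] X => φ ∘ₗ f) ∧
  Function.Surjective (fun φ : B →ₗ[Λ] X => φ ∘ₗ f)

/-- `add(X) = add(A ⊕ B)`, as classes of finite-dimensional modules. -/
def AddEqSum (X A B : FDMod K Λ) : Prop :=
  ∀ Y : FDMod K Λ, InAdd Λ Y X ↔ InAdd Λ Y (A × B)

/-- `0 → L → N₀ → N₁ → R → 0` is an `add(N)`-dualizing sequence (a `k`-`add(N)`-dualizing sequence
with `k = 1`). Exactness of `D Hom(N, -)` is that of `Hom(N, -)`, since `D` is an exact duality. -/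
structure IsDualizingSeq (N : FDMod K Λ) {L N₀ N₁ R : FDMod K Λ}
    (f : L →ₗ[Λ] N₀) (g : N₀ →ₗ[Λ] N₁) (h : N₁ →ₗ[Λ] R) : Prop where
  injective : Function.Injective f
  exact_left : Function.Exact f g
  exact_right : Function.Exact g h
  surjective : Function.Surjective h
  mem_left : InAdd Λ N₀ N
  mem_right : InAdd Λ N₁ N
  hom_to : HomToExact N f g h
  hom_from : HomFromExact N f g h
  right_end : ∃ Y Z : FDMod K Λ, IsCosyzygy N L Y ∧ IsCosyzygy N Y Z ∧ AddEqSum R N Z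
  left_end : ∃ Y Z : FDMod K Λ, IsSyzygy N R Y ∧ IsSyzygy N Y Z ∧ AddEqSum L N Z

/-- `L` and `R` are the left and right end of a strong `add(N)`-dualizing sequence: an
`add(N)`-dualizing sequence on which moreover `D Hom(L, -)` is exact. -/
def AreStrongDualizingEnds (N L R : FDMod K Λ) : Prop :=
  ∃ (N₀ N₁ : FDMod K Λ) (f : L →ₗ[Λ] N₀) (g : N₀ →ₗ[Λ] N₁) (h : N₁ →ₗ[Λ] R),
    IsDualizingSeq N f g h ∧ HomFromExact L f g h

/-! ## The sets of classes of tuples in the correspondences -/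

/-- The classes `[Λ, M, G]` with `Λ ⊕ M ∈ add(G)` and `M` `1`-`F_G`-faithful. -/
def relGenTriples (K : Type u) [Field K] : Set (TupleClass K 2) :=
  {c | ∃ (Λ : FDAlg K) (M G : FDMod K Λ), c = cls₃ Λ M G ∧
    InAdd Λ (regMod Λ × M) G ∧ OneFaithful (lowerF G) M}

/-- The classes `[Λ, M, H]` with `DΛ ⊕ M ∈ add(H)` and `M` `1`-`F^H`-faithful. -/
def relCogenTriples (K : Type u) [Field K] : Set (TupleClass K 2) :=
  {c | ∃ (Λ : FDAlg K) (M H : FDMod K Λ), c = cls₃ Λ M H ∧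
    InAdd Λ (dualReg Λ × M) H ∧ OneFaithful (upperF H) M}

/-- The classes `[Λ, M, G, H]` with `Λ ∈ add(G)`, `DΛ ∈ add(H)`, `G = Λ ⊕ τ⁻ H`,
`M ∈ add(G) ∩ add(H)` and `M` `1`-`F_G`-faithful. -/
def relGenCogenTuples (K : Type u) [Field K] : Set (TupleClass K 3) :=
  {c | ∃ (Λ : FDAlg K) (M G H : FDMod K Λ), c = cls₄ Λ M G H ∧
    InAdd Λ (regMod Λ) G ∧ InAdd Λ (dualReg Λ) H ∧
    (∃ T : FDMod K Λ, IsTauInv H T ∧ Nonempty (G ≃ₗ[Λ] (regMod Λ × T))) ∧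
    InAdd Λ M G ∧ InAdd Λ M H ∧ OneFaithful (lowerF G) M}

/-- The classes `[Γ, N, L, R]` where `L`, `R` are the ends of a strong `add(N)`-dualizing sequence,
`Γ ∈ add(L)` and `DΓ ∈ add(R)`. -/
def strongDualizingTuples (K : Type u) [Field K] : Set (TupleClass K 3) :=
  {c | ∃ (Γ : FDAlg K) (N L R : FDMod K Γ), c = cls₄ Γ N L R ∧
    AreStrongDualizingEnds N L R ∧ InAdd Γ (regMod Γ) L ∧ InAdd Γ (dualReg Γ) R}

end RelFB

end

/-! All three correspondences rest on the condition `Star M X H`: composition `(M, H) ⊗ (X, M) → (X,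
H)`, with the tensor product over `End(M)`, is bijective. When `DΛ ∈ add(H)`, it says exactly that
`X` lies in `cogen¹(M)` relative to `F^H` (`Star.cogen₁`, `Cogen₁.star`). For `G = Λ ⊕ τ⁻H` the
Auslander–Reiten formula, recorded as `ARSeq G H`, yields `F_G = F^H` (`ARSeq.lowerF_eq`). Since the
`F_G`-projectives form `add(G)`, `1`-faithfulness of `M` then reduces to `Star M G H`.

Put `Γ = End(M)`. The data over `Λ` are encoded in an exact sequence `0 → X → A → B → H → 0` with
`A, B ∈ add(M)` (`BiexactSeq`). The functors `(-, M)` and `D(M, -)` turn it into a projective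
presentation of `(X, M)` and an injective copresentation of `D(M, H)` over `Γ`. The Nakayama functor
sends `(A, M)` to `D(M, A)`, so the two match and `ARSeq` holds again over `Γ` (`BiexactSeq.arSeq`).
Moreover `Hom_Γ((X, M), M) = X` and `Hom_Γ(M, D(M, H)) = DH`. Under these identifications `Star`
over `Γ` is dual to the isomorphism from `(A, B)`, modulo maps factoring as `ν₁ μ + μ ν₂`, to `(X,
H)` (`BiexactSeq.star`). Hence `M` is `1`-faithful over `Γ` as well (`BiexactSeq.oneFaithful`).

The sequences arise as follows. In (1) one takes the copresentation of `G` given by faithfulness. In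
(2) one takes an `add(M)`-presentation of `H`, which exists by `Star M G H` with `G = Λ ⊕ τ⁻H`. In
(3) a strong dualizing sequence is itself biexact; conversely, applying `(-, M)` to the projective
presentation in `ARSeq G H` produces one over `Γ` (`ARSeq.areStrongDualizingEnds`).

Applying an assignment twice gives back the class because `Λ ≅ End_Γ(M)`, `G ≅ ((G, M), M)` and `H ≅
D(M, D(M, H))` in the reflexive and coreflexive situation. For well-definedness, modules `U`, `V`
with the same additive closure have endomorphism algebras that are Morita equivalent through `((V,
U), -)` (`transferEquiv`). -/

noncomputable section

namespace RelFB

variable {K : Type u} [Field K] {Λ : FDAlg K}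

/-! ## The additive closure of a module -/

section InAdd

variable {R : Type u} [Ring R] {X Y Z M N : Type u} [AddCommGroup X] [Module R X]
  [AddCommGroup Y] [Module R Y] [AddCommGroup Z] [Module R Z] [AddCommGroup M] [Module R M]
  [AddCommGroup N] [Module R N]

/-- The decomposition `∑ aᵢ bᵢ = id` is the working form of membership in `add(M)`: a property of
`M` is applied to each component and the results are reassembled. -/
theorem InAdd.of_sum {n : ℕ} (a : Fin n → M →ₗ[R] X) (b : Fin n → X →ₗ[R] M)
    (h : ∀ x, ∑ i, a i (b i x) = x) : InAdd R X M := by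
  refine ⟨n, LinearMap.pi b, ∑ i, a i ∘ₗ LinearMap.proj i, ?_⟩
  ext x
  simpa [LinearMap.sum_apply] using h x

theorem InAdd.exists_sum (h : InAdd R X M) :
    ∃ (n : ℕ) (a : Fin n → M →ₗ[R] X) (b : Fin n → X →ₗ[R] M), ∀ x, ∑ i, a i (b i x) = x := by
  obtain ⟨n, i, p, hp⟩ := h
  refine ⟨n, fun j => p ∘ₗ LinearMap.single R (fun _ => M) j, fun j => LinearMap.proj j ∘ₗ i,
    fun x => ?_⟩
  have := LinearMap.congr_fun hp x
  simp only [LinearMap.comp_apply, LinearMap.id_apply] at this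
  conv_rhs => rw [← this]
  simp only [LinearMap.comp_apply, ← map_sum]
  congr 1
  ext j
  simp [Finset.sum_apply, Pi.single_apply]

/-- A version of `InAdd.of_sum` for an arbitrary finite index type. -/
theorem InAdd.of_fintype {ι : Type*} [Fintype ι] (a : ι → M →ₗ[R] X) (b : ι → X →ₗ[R] M)
    (h : ∀ x, ∑ i, a i (b i x) = x) : InAdd R X M := by
  let e := Fintype.equivFin ι
  refine InAdd.of_sum (fun i => a (e.symm i)) (fun i => b (e.symm i)) fun x => ?_
  conv_rhs => rw [← h x]
  exact Equiv.sum_comp e.symm fun i => a i (b i x)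

theorem InAdd.refl : InAdd R M M :=
  InAdd.of_sum (n := 1) (fun _ => LinearMap.id) (fun _ => LinearMap.id) (by simp)

theorem InAdd.trans (h₁ : InAdd R X Y) (h₂ : InAdd R Y Z) : InAdd R X Z := by
  obtain ⟨n, a, b, h⟩ := h₁.exists_sum
  obtain ⟨m, c, d, h'⟩ := h₂.exists_sum
  refine InAdd.of_fintype (ι := Fin n × Fin m) (fun i => a i.1 ∘ₗ c i.2)
    (fun i => d i.2 ∘ₗ b i.1) fun x => ?_
  rw [Fintype.sum_prod_type]
  simp only [LinearMap.comp_apply, ← map_sum, h', h]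

/-- A direct summand lies in the additive closure. -/
theorem InAdd.of_retract (i : X →ₗ[R] M) (p : M →ₗ[R] X) (h : ∀ x, p (i x) = x) : InAdd R X M :=
  InAdd.of_sum (n := 1) (fun _ => p) (fun _ => i) (by simpa using h)

theorem InAdd.of_linearEquiv (e : X ≃ₗ[R] M) : InAdd R X M :=
  InAdd.of_retract e.toLinearMap e.symm.toLinearMap (by simp)

theorem InAdd.prod (h₁ : InAdd R X M) (h₂ : InAdd R Y M) : InAdd R (X × Y) M := by
  obtain ⟨n, a, b, h⟩ := h₁.exists_sum
  obtain ⟨m, c, d, h'⟩ := h₂.exists_sum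
  refine InAdd.of_fintype (ι := Fin n ⊕ Fin m)
    (Sum.elim (fun i => LinearMap.inl R X Y ∘ₗ a i) (fun i => LinearMap.inr R X Y ∘ₗ c i))
    (Sum.elim (fun i => b i ∘ₗ LinearMap.fst R X Y) (fun i => d i ∘ₗ LinearMap.snd R X Y))
    fun x => ?_
  simp only [Fintype.sum_sum_type, Sum.elim_inl, Sum.elim_inr, LinearMap.comp_apply,
    ← map_sum, LinearMap.fst_apply, LinearMap.snd_apply, h, h']
  simp

theorem InAdd.left_of_prod : InAdd R X (X × Y) :=
  InAdd.of_retract (LinearMap.inl R X Y) (LinearMap.fst R X Y) (by simp)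

theorem InAdd.right_of_prod : InAdd R Y (X × Y) :=
  InAdd.of_retract (LinearMap.inr R X Y) (LinearMap.snd R X Y) (by simp)

theorem InAdd.pow (n : ℕ) : InAdd R (Fin n → M) M :=
  ⟨n, LinearMap.id, LinearMap.id, rfl⟩

end InAdd

/-! ## Constructions of finite-dimensional modules -/

/-- Bundle a finite-dimensional module. -/
abbrev FDMod.of (Λ : FDAlg K) (V : Type u) [AddCommGroup V] [Module K V] [Module Λ V]
    [IsScalarTower K Λ V] [FiniteDimensional K V] : FDMod K Λ where
  carrier := V

/-- The kernel of a linear map. -/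
abbrev kerMod {X Y : FDMod K Λ} (f : X →ₗ[Λ] Y) : FDMod K Λ where
  carrier := LinearMap.ker f
  finite := Module.Finite.of_injective
    ((LinearMap.ker f).subtype.restrictScalars K) Subtype.val_injective

/-- The cokernel of a linear map. -/
abbrev cokerMod {X Y : FDMod K Λ} (f : X →ₗ[Λ] Y) : FDMod K Λ where
  carrier := Y ⧸ LinearMap.range f
  finite := Module.Finite.quotient K _

/-- The product of two modules. -/
abbrev prodMod (X Y : FDMod K Λ) : FDMod K Λ := FDMod.of Λ (X × Y)

/-- The finite direct power of a module. -/
abbrev powMod (n : ℕ) (M : FDMod K Λ) : FDMod K Λ := FDMod.of Λ (Fin n → M)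

theorem InAdd.finiteDimensional {X : Type u} [AddCommGroup X] [Module K X] [Module Λ X]
    [IsScalarTower K Λ X] {M : FDMod K Λ} (h : InAdd Λ X M) : FiniteDimensional K X := by
  obtain ⟨n, i, p, hp⟩ := h
  exact Module.Finite.of_surjective (p.restrictScalars K)
    fun x => ⟨i x, LinearMap.congr_fun hp x⟩

/-! ### Lifting and descent along exact pairs, and separation by functionals. -/

section Lifting

variable {A B C X : FDMod K Λ}

/-- A map killed by the second map of an exact pair factors through the first, if that is
injective. -/
theorem exists_lift_of_exact {f : A →ₗ[Λ] B} {g : B →ₗ[Λ] C} (hf : Function.Injective f)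
    (hfg : Function.Exact f g) (u : X →ₗ[Λ] B) (hu : ∀ x, g (u x) = 0) :
    ∃ v : X →ₗ[Λ] A, ∀ x, f (v x) = u x := by
  choose v hv using fun x => (hfg (u x)).1 (hu x)
  refine ⟨{ toFun := v, map_add' := fun x y => hf ?_, map_smul' := fun r x => hf ?_ }, hv⟩
  · simp [hv]
  · simp [hv]

/-- A map killing the first map of an exact pair descends along the second, if that is
surjective. -/
theorem exists_desc_of_exact {f : A →ₗ[Λ] B} {g : B →ₗ[Λ] C} (hg : Function.Surjective g)
    (hfg : Function.Exact f g) (u : B →ₗ[Λ] X) (hu : ∀ a, u (f a) = 0) :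
    ∃ v : C →ₗ[Λ] X, ∀ b, v (g b) = u b := by
  choose s hs using hg
  have key : ∀ b b', g b = g b' → u b = u b' := fun b b' h => by
    obtain ⟨a, ha⟩ := (hfg (b - b')).1 (by simp [h])
    have := hu a
    rw [ha, map_sub, sub_eq_zero] at this
    exact this
  refine ⟨{ toFun := fun c => u (s c), map_add' := fun x y => ?_, map_smul' := fun r x => ?_ },
    fun b => key _ _ (hs _)⟩
  · rw [← map_add]; exact key _ _ (by simp [hs])
  · rw [RingHom.id_apply, ← map_smul]; exact key _ _ (by simp [hs])

/-- The map `Λ → X` with `1 ↦ x`. -/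
def regMap (x : X) : regMod Λ →ₗ[Λ] X := LinearMap.toSpanSingleton Λ X x

/-- The unit, as an element of the regular module. -/
def regOne (Λ : FDAlg K) : regMod Λ := (1 : Λ)

@[simp] theorem regMap_one (x : X) : regMap x (regOne Λ) = x := one_smul Λ x

theorem regMod_eq_smul_one (r : regMod Λ) : r = (show Λ from r) • regOne Λ :=
  (mul_one (show Λ from r)).symm

theorem regMod_hom_ext {f g : regMod Λ →ₗ[Λ] X} (h : f (regOne Λ) = g (regOne Λ)) : f = g :=
  LinearMap.ext fun r => by rw [regMod_eq_smul_one r, map_smul, map_smul, h]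

theorem regMap_map_one (f : regMod Λ →ₗ[Λ] X) : regMap (f (regOne Λ)) = f :=
  regMod_hom_ext (regMap_one _)

/-- Modules in `add Λ` have the lifting property. -/
theorem InAdd.exists_lift {P : FDMod K Λ} (hP : InAdd Λ P (regMod Λ)) {g : B →ₗ[Λ] C}
    (hg : Function.Surjective g) (u : P →ₗ[Λ] C) : ∃ v : P →ₗ[Λ] B, ∀ x, g (v x) = u x := by
  obtain ⟨n, a, b, h⟩ := hP.exists_sum
  choose s hs using hg
  refine ⟨∑ i, regMap (s (u (a i (regOne Λ)))) ∘ₗ b i, fun x => ?_⟩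
  conv_rhs => rw [← h x]
  simp only [LinearMap.sum_apply, map_sum]
  refine Finset.sum_congr rfl fun i _ => ?_
  have : g ∘ₗ regMap (s (u (a i (regOne Λ)))) = u ∘ₗ a i := regMod_hom_ext (by simp [hs])
  exact LinearMap.congr_fun this (b i x)

end Lifting

/-- A vector outside a subspace is separated from it by a functional. -/
theorem exists_dual_ne_zero {V : Type*} [AddCommGroup V] [Module K V] (p : Submodule K V) {v : V}
    (hv : v ∉ p) : ∃ ξ : Module.Dual K V, ξ v ≠ 0 ∧ ∀ w ∈ p, ξ w = 0 := by
  obtain ⟨ξ, h, hp⟩ := Submodule.exists_le_ker_of_notMem hv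
  exact ⟨ξ, h, fun w hw => hp hw⟩

/-- Functionals descend along a surjection if they vanish on its kernel. -/
theorem exists_dual_desc {V W : Type*} [AddCommGroup V] [Module K V] [AddCommGroup W] [Module K W]
    (f : V →ₗ[K] W) (hf : Function.Surjective f) (ξ : Module.Dual K V)
    (h : ∀ v, f v = 0 → ξ v = 0) : ∃ η : Module.Dual K W, ∀ v, η (f v) = ξ v := by
  obtain ⟨s, hs⟩ := f.exists_rightInverse_of_surjective (LinearMap.range_eq_top.2 hf)
  refine ⟨ξ ∘ₗ s, fun v => ?_⟩
  have := h (s (f v) - v) (by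
    have := LinearMap.congr_fun hs (f v)
    simp only [LinearMap.comp_apply, LinearMap.id_apply] at this
    simp [this])
  rw [map_sub, sub_eq_zero] at this
  exact this

/-- Functionals extend along an injection. -/
theorem exists_dual_extend {V W : Type*} [AddCommGroup V] [Module K V] [AddCommGroup W]
    [Module K W] (f : V →ₗ[K] W) (hf : Function.Injective f) (ξ : Module.Dual K V) :
    ∃ η : Module.Dual K W, ∀ v, η (f v) = ξ v := by
  obtain ⟨s, hs⟩ := f.exists_leftInverse_of_injective (LinearMap.ker_eq_bot.2 hf)
  exact ⟨ξ ∘ₗ s, fun v => congrArg ξ (LinearMap.congr_fun hs v)⟩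

/-! ### Composition as a bilinear map, and `add(M)`-approximations. -/

section Compositions

variable {W X Y Z : FDMod K Λ}

/-- Composition of linear maps as a `K`-bilinear map. -/
def compHom (X Y Z : FDMod K Λ) :
    (X →ₗ[Λ] Y) →ₗ[K] (Y →ₗ[Λ] Z) →ₗ[K] (X →ₗ[Λ] Z) :=
  LinearMap.mk₂ K (fun f g => g ∘ₗ f) (fun _ _ _ => LinearMap.comp_add _ _ _)
    (fun c f g => LinearMap.ext fun x => LinearMap.map_smul_of_tower g c (f x))
    (fun _ _ _ => LinearMap.add_comp _ _ _) (fun _ _ _ => rfl)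

/-- Postcomposition as a `K`-linear map. -/
def postHom (X : FDMod K Λ) (g : Y →ₗ[Λ] Z) : (X →ₗ[Λ] Y) →ₗ[K] (X →ₗ[Λ] Z) :=
  (compHom X Y Z).flip g

@[simp] theorem postHom_apply (f : X →ₗ[Λ] Y) (g : Y →ₗ[Λ] Z) : postHom X g f = g ∘ₗ f := rfl

/-- Precomposition as a `K`-linear map. -/
def preHom (f : X →ₗ[Λ] Y) (Z : FDMod K Λ) : (Y →ₗ[Λ] Z) →ₗ[K] (X →ₗ[Λ] Z) := compHom X Y Z f

@[simp] theorem preHom_apply (f : X →ₗ[Λ] Y) (g : Y →ₗ[Λ] Z) : preHom f Z g = g ∘ₗ f := rfl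

theorem sum_comp' {ι : Type*} [Fintype ι] (g : ι → Y →ₗ[Λ] Z) (f : X →ₗ[Λ] Y) :
    (∑ i, g i) ∘ₗ f = ∑ i, g i ∘ₗ f :=
  map_sum (preHom f Z) g Finset.univ

theorem comp_sum' {ι : Type*} [Fintype ι] (f : ι → X →ₗ[Λ] Y) (g : Y →ₗ[Λ] Z) :
    g ∘ₗ (∑ i, f i) = ∑ i, g ∘ₗ f i :=
  map_sum (postHom X g) f Finset.univ

/-- The dual basis identity in the two forms needed for Hom functors: one for maps out of `X`, one
for maps into `X`. -/
theorem InAdd.exists_comp (h : InAdd Λ X Y) :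
    ∃ (n : ℕ) (a : Fin n → Y →ₗ[Λ] X) (b : Fin n → X →ₗ[Λ] Y),
      (∀ {Z : FDMod K Λ} (f : X →ₗ[Λ] Z), ∑ i, (f ∘ₗ a i) ∘ₗ b i = f) ∧
      (∀ {Z : FDMod K Λ} (f : Z →ₗ[Λ] X), ∑ i, a i ∘ₗ b i ∘ₗ f = f) := by
  obtain ⟨n, a, b, hab⟩ := h.exists_sum
  refine ⟨n, a, b, fun f => LinearMap.ext fun x => ?_, fun f => LinearMap.ext fun x => ?_⟩
  · simp only [LinearMap.sum_apply, LinearMap.comp_apply, ← map_sum, hab]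
  · simp only [LinearMap.sum_apply, LinearMap.comp_apply, hab]

/-- Left approximations exist. -/
theorem exists_leftApprox (M X : FDMod K Λ) :
    ∃ (n : ℕ) (f : X →ₗ[Λ] powMod n M), ∀ φ : X →ₗ[Λ] M, ∃ ψ : powMod n M →ₗ[Λ] M, ψ ∘ₗ f = φ := by
  let b := Module.finBasis K (X →ₗ[Λ] M)
  refine ⟨_, LinearMap.pi fun i => b i, fun φ => ⟨∑ i, b.repr φ i • LinearMap.proj i,
    LinearMap.ext fun x => ?_⟩⟩
  refine Eq.trans ?_ (LinearMap.congr_fun (b.sum_repr φ) x)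
  rw [LinearMap.sum_apply]
  simp

/-- Right approximations exist. -/
theorem exists_rightApprox (M X : FDMod K Λ) :
    ∃ (n : ℕ) (f : powMod n M →ₗ[Λ] X), ∀ φ : M →ₗ[Λ] X, ∃ ψ : M →ₗ[Λ] powMod n M, f ∘ₗ ψ = φ := by
  let b := Module.finBasis K (M →ₗ[Λ] X)
  refine ⟨_, ∑ i, b i ∘ₗ LinearMap.proj i,
    fun φ => ⟨LinearMap.pi fun i => b.repr φ i • LinearMap.id, LinearMap.ext fun x => ?_⟩⟩
  refine Eq.trans ?_ (LinearMap.congr_fun (b.sum_repr φ) x)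
  rw [LinearMap.sum_apply]
  simp [LinearMap.map_smul_of_tower]

/-- Extension property of a left approximation for all modules in the additive closure. -/
theorem InAdd.extend {M N : FDMod K Λ} (hN : InAdd Λ N M) (f : X →ₗ[Λ] Y)
    (hf : ∀ φ : X →ₗ[Λ] M, ∃ ψ : Y →ₗ[Λ] M, ψ ∘ₗ f = φ) (φ : X →ₗ[Λ] N) :
    ∃ ψ : Y →ₗ[Λ] N, ψ ∘ₗ f = φ := by
  obtain ⟨n, a, b, -, h⟩ := hN.exists_comp
  choose e he using hf
  refine ⟨∑ i, a i ∘ₗ e (b i ∘ₗ φ), ?_⟩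
  conv_rhs => rw [← h φ]
  rw [sum_comp']
  simp only [LinearMap.comp_assoc, he]

/-- Lifting property of a right approximation for all modules in the additive closure. -/
theorem InAdd.lift {M N : FDMod K Λ} (hN : InAdd Λ N M) (f : X →ₗ[Λ] Y)
    (hf : ∀ φ : M →ₗ[Λ] Y, ∃ ψ : M →ₗ[Λ] X, f ∘ₗ ψ = φ) (φ : N →ₗ[Λ] Y) :
    ∃ ψ : N →ₗ[Λ] X, f ∘ₗ ψ = φ := by
  obtain ⟨n, a, b, h, -⟩ := hN.exists_comp
  choose e he using hf
  refine ⟨∑ i, e (φ ∘ₗ a i) ∘ₗ b i, ?_⟩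
  conv_rhs => rw [← h φ]
  rw [comp_sum']
  simp only [← LinearMap.comp_assoc, he]

end Compositions

/-! ## The regular module and its dual -/

section Dual

variable {X : FDMod K Λ}

/-- The map `X → DΛ` corresponding to a functional on `X`. -/
def dualMap (ξ : Module.Dual K X) : X →ₗ[Λ] dualReg Λ where
  toFun x := ξ ∘ₗ (LinearMap.toSpanSingleton Λ X x).restrictScalars K
  map_add' x y := LinearMap.ext fun a => by
    show ξ (a • (x + y)) = ξ (a • x) + ξ (a • y)
    rw [smul_add, map_add]
  map_smul' b x := LinearMap.ext fun a => by
    show ξ (a • b • x) = ξ ((a * b) • x)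
    rw [mul_smul]

theorem dualMap_apply (ξ : Module.Dual K X) (x : X) (a : Λ) :
    (show Module.Dual K Λ from dualMap ξ x) a = ξ (a • x) := rfl

/-- The functional corresponding to a map `X → DΛ`. -/
def evalOne (f : X →ₗ[Λ] dualReg Λ) : Module.Dual K X where
  toFun x := (show Module.Dual K Λ from f x) 1
  map_add' x y := by rw [map_add]; rfl
  map_smul' c x := by rw [LinearMap.map_smul_of_tower]; rfl

theorem evalOne_apply (f : X →ₗ[Λ] dualReg Λ) (x : X) :
    evalOne f x = (show Module.Dual K Λ from f x) 1 := rfl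

theorem dualMap_evalOne (f : X →ₗ[Λ] dualReg Λ) : dualMap (evalOne f) = f :=
  LinearMap.ext fun x => LinearMap.ext fun a => by
    show (show Module.Dual K Λ from f (a • x)) 1 = (show Module.Dual K Λ from f x) a
    rw [map_smul]
    show (show Module.Dual K Λ from f x) (1 * a) = _
    rw [one_mul]

/-- If `DΛ ∈ add(H)`, then maps to `H` separate points from submodules. -/
theorem exists_hom_ne_zero {H : FDMod K Λ} (hH : InAdd Λ (dualReg Λ) H) (p : Submodule Λ X) {x : X}
    (hx : x ∉ p) : ∃ k : X →ₗ[Λ] H, k x ≠ 0 ∧ ∀ y ∈ p, k y = 0 := by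
  obtain ⟨ξ, h, hp⟩ := exists_dual_ne_zero (p.restrictScalars K) hx
  obtain ⟨n, a, b, hab⟩ := hH.exists_sum
  have h0 : ∃ i, b i (dualMap ξ x) ≠ 0 := by
    by_contra! hall
    have := hab (dualMap ξ x)
    simp only [hall, map_zero, Finset.sum_const_zero] at this
    apply h
    have h1 := dualMap_apply ξ x 1
    rw [← this, one_smul] at h1
    exact h1.symm
  obtain ⟨i, hi⟩ := h0
  refine ⟨b i ∘ₗ dualMap ξ, hi, fun y hy => ?_⟩
  have : dualMap ξ y = 0 := LinearMap.ext fun a => hp _ (p.smul_mem a hy)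
  rw [LinearMap.comp_apply, this, map_zero]

end Dual

/-- If `Λ ∈ add(G)`, then every element of `X` lies in the span of the images of maps `G → Λ → X`. -/
theorem exists_sum_of_generator {G : FDMod K Λ} (hG : InAdd Λ (regMod Λ) G) (X : FDMod K Λ) :
    ∃ (n : ℕ) (a : Fin n → G →ₗ[Λ] regMod Λ) (g : Fin n → G),
      ∀ x : X, ∑ i, regMap x (a i (g i)) = x := by
  obtain ⟨n, a, b, h⟩ := hG.exists_sum
  refine ⟨n, a, fun i => b i (regOne Λ), fun x => ?_⟩
  rw [← map_sum, h, regMap_one]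

/-- Every element of `Y` is a sum of values of maps `G → Λ → Y`, and each of these maps lifts
through `p`. -/
theorem surjective_of_generator {G X Y : FDMod K Λ} (hG : InAdd Λ (regMod Λ) G) (p : X →ₗ[Λ] Y)
    (hp : ∀ φ : G →ₗ[Λ] Y, ∃ ψ : G →ₗ[Λ] X, p ∘ₗ ψ = φ) : Function.Surjective p := fun y => by
  obtain ⟨n, a, g, h⟩ := exists_sum_of_generator hG Y
  choose e he using hp
  refine ⟨∑ i, e (regMap y ∘ₗ a i) (g i), ?_⟩
  conv_rhs => rw [← h y]
  rw [map_sum]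
  exact Finset.sum_congr rfl fun i _ => LinearMap.congr_fun (he (regMap y ∘ₗ a i)) (g i)

/-! ## Relative projectives -/

theorem InAdd.relProjective {G P : FDMod K Λ} (h : InAdd Λ P G) : RelProjective (lowerF G) P :=
  fun _ _ _ _ g hfg φ => h.lift g hfg.2 φ

/-- A right `add(G)`-approximation of `P` is onto because `G` generates, hence it is the right-hand
map of an `F_G`-exact sequence; relative projectivity splits it. -/
theorem RelProjective.inAdd {G P : FDMod K Λ} (hG : InAdd Λ (regMod Λ) G)
    (h : RelProjective (lowerF G) P) : InAdd Λ P G := by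
  obtain ⟨n, f, hf⟩ := exists_rightApprox G P
  have hs := surjective_of_generator hG f hf
  obtain ⟨ψ, hψ⟩ := h (A := kerMod f) (LinearMap.ker f).subtype f
    ⟨⟨Subtype.val_injective, fun y => by simp, hs⟩, hf⟩ LinearMap.id
  exact ⟨n, ψ, f, hψ⟩

/-! ## The Auslander–Reiten sequence of functors -/

/-- There are a projective presentation `P₀ → P₁ → G → 0` and, for all `X`, a natural exact sequence
`Hom(P₁, X) → Hom(P₀, X) → D Hom(X, H) → 0`; the latter map is given by a functional `τ` on
`Hom(P₀, H)`. -/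
def ARSeq (G H : FDMod K Λ) : Prop :=
  ∃ (P₀ P₁ : FDMod K Λ) (d : P₀ →ₗ[Λ] P₁) (π : P₁ →ₗ[Λ] G) (τ : Module.Dual K (P₀ →ₗ[Λ] H)),
    InAdd Λ P₀ (regMod Λ) ∧ InAdd Λ P₁ (regMod Λ) ∧ Function.Exact d π ∧ Function.Surjective π ∧
    (∀ (X : FDMod K Λ) (u : P₀ →ₗ[Λ] X),
      (∀ h : X →ₗ[Λ] H, τ (h ∘ₗ u) = 0) ↔ ∃ r : P₁ →ₗ[Λ] X, r ∘ₗ d = u) ∧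
    (∀ (X : FDMod K Λ) (ξ : Module.Dual K (X →ₗ[Λ] H)),
      ∃ u : P₀ →ₗ[Λ] X, ∀ h : X →ₗ[Λ] H, ξ h = τ (h ∘ₗ u))

/-- If `φ` did not extend, some functional `ζ` on `(A, H)` would vanish on all restrictions from `B`
but not at `φ`. It is represented by `q : P₀ → A`, and the vanishing says that `f q` factors as `f'
d`. The map `G → C` induced by `f'` lifts to `B` by `F_G`-exactness; subtracting the lift moves the
factorization into `A`, so `q` factors through `d` and `ζ = 0`. -/
theorem ARSeq.upperF_of_lowerF {G H A B C : FDMod K Λ} (h : ARSeq G H) {f : A →ₗ[Λ] B}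
    {g : B →ₗ[Λ] C} (hfg : lowerF G f g) : upperF H f g := by
  obtain ⟨P₀, P₁, d, π, τ, hP₀, hP₁, hd, hπ, h₁, h₂⟩ := h
  obtain ⟨⟨hf, he, hg⟩, hG⟩ := hfg
  refine ⟨⟨hf, he, hg⟩, fun φ => ?_⟩
  by_contra hφ
  obtain ⟨ζ, hζ, hζ0⟩ := exists_dual_ne_zero (LinearMap.range (preHom f H)) (v := φ) hφ
  obtain ⟨q, hq⟩ := h₂ A ζ
  obtain ⟨f', hf'⟩ := (h₁ B (f ∘ₗ q)).1 fun k => by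
    rw [← LinearMap.comp_assoc, ← hq]
    exact hζ0 _ ⟨k, rfl⟩
  obtain ⟨w, hw⟩ := exists_desc_of_exact hπ hd (g ∘ₗ f') fun x => by
    rw [LinearMap.comp_apply]
    have := LinearMap.congr_fun hf' x
    simp only [LinearMap.comp_apply] at this
    rw [this]
    exact he.apply_apply_eq_zero _
  obtain ⟨w', hw'⟩ := hG w
  obtain ⟨r, hr⟩ := exists_lift_of_exact hf he (f' - w' ∘ₗ π) fun x => by
    have := LinearMap.congr_fun hw' (π x)
    simp only [LinearMap.comp_apply] at this
    simp [this, hw]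
  have hrd : r ∘ₗ d = q := LinearMap.ext fun x => hf <| by
    have := LinearMap.congr_fun hf' x
    simp only [LinearMap.comp_apply] at this
    simp [hr, this, hd.apply_apply_eq_zero]
  exact hζ (by rw [hq]; exact (h₁ A q).2 ⟨r, hrd⟩ φ)

/-- Projectivity of `P₁` lifts `φ π` to `f' : P₁ → B`, and `f' d` lands in `A` as a map `q`.
Extending maps `A → H` to `B` shows that `τ` kills `h q` for all `h`, so `q = r d`; then `f' - f r`
descends to the required lift on `G`. -/
theorem ARSeq.lowerF_of_upperF {G H A B C : FDMod K Λ} (h : ARSeq G H) {f : A →ₗ[Λ] B}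
    {g : B →ₗ[Λ] C} (hfg : upperF H f g) : lowerF G f g := by
  obtain ⟨P₀, P₁, d, π, τ, hP₀, hP₁, hd, hπ, h₁, h₂⟩ := h
  obtain ⟨⟨hf, he, hg⟩, hH⟩ := hfg
  refine ⟨⟨hf, he, hg⟩, fun φ => ?_⟩
  obtain ⟨f', hf'⟩ := hP₁.exists_lift hg (φ ∘ₗ π)
  obtain ⟨q, hq⟩ := exists_lift_of_exact hf he (f' ∘ₗ d) fun x => by
    simp [hf', hd.apply_apply_eq_zero]
  obtain ⟨r, hr⟩ := (h₁ A q).1 fun k => by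
    obtain ⟨k', rfl⟩ := hH k
    have : (k' ∘ₗ f) ∘ₗ q = k' ∘ₗ f' ∘ₗ d := LinearMap.ext fun x => by simp [hq]
    rw [this]
    exact (h₁ B (f' ∘ₗ d)).2 ⟨f', rfl⟩ k'
  obtain ⟨ψ, hψ⟩ := exists_desc_of_exact hπ hd (f' - f ∘ₗ r) fun x => by
    have := LinearMap.congr_fun hr x
    simp only [LinearMap.comp_apply] at this
    simp [this, hq]
  refine ⟨ψ, LinearMap.ext fun x => ?_⟩
  obtain ⟨y, rfl⟩ := hπ x
  simp [hψ, hf', he.apply_apply_eq_zero]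

theorem ARSeq.lowerF_eq {G H : FDMod K Λ} (h : ARSeq G H) : lowerF G = upperF H := by
  funext A B C f g
  exact propext ⟨h.upperF_of_lowerF, h.lowerF_of_upperF⟩

/-! ## The balanced form condition -/

/-- Every `End(M)`-balanced form on `Hom(X, M) × Hom(M, H)` is given by a unique functional on
`Hom(X, H)` through composition; in other words, `Hom(M, H) ⊗ Hom(X, M) → Hom(X, H)` is bijective,
the tensor product being that over `End(M)`. -/
def Star (M X H : FDMod K Λ) : Prop :=
  (∀ ξ : Module.Dual K (X →ₗ[Λ] H),
    (∀ (y : X →ₗ[Λ] M) (h : M →ₗ[Λ] H), ξ (h ∘ₗ y) = 0) → ξ = 0) ∧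
  ∀ β : (X →ₗ[Λ] M) →ₗ[K] Module.Dual K (M →ₗ[Λ] H),
    (∀ (s : M →ₗ[Λ] M) (y : X →ₗ[Λ] M) (h : M →ₗ[Λ] H), β (s ∘ₗ y) h = β y (h ∘ₗ s)) →
      ∃ ξ : Module.Dual K (X →ₗ[Λ] H), ∀ y h, β y h = ξ (h ∘ₗ y)

theorem Star.of_inAdd {M X Y H : FDMod K Λ} (hX : InAdd Λ X Y) (h : Star M Y H) : Star M X H := by
  obtain ⟨n, a, b, hab, -⟩ := hX.exists_comp
  refine ⟨fun ξ hξ => ?_, fun β hβ => ?_⟩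
  · have hz : ∀ i, ξ ∘ₗ preHom (b i) H = 0 := fun i => h.1 _ fun y k => hξ (y ∘ₗ b i) k
    ext f
    rw [← hab f, map_sum]
    exact Finset.sum_eq_zero fun i _ => LinearMap.congr_fun (hz i) (f ∘ₗ a i)
  · choose e he using fun i => h.2 (β ∘ₗ preHom (b i) M) fun s y k => hβ s (y ∘ₗ b i) k
    refine ⟨∑ i, e i ∘ₗ preHom (a i) H, fun y k => ?_⟩
    conv_lhs => rw [← hab y]
    simp only [map_sum, LinearMap.sum_apply]
    exact Finset.sum_congr rfl fun i _ => he i (y ∘ₗ a i) k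

/-- A functional on `(X, H)` that vanishes on the maps extending along `f` kills all composites
through `M`, so the uniqueness half of `Star` makes it zero. -/
theorem Star.exists_extend {M X H Y : FDMod K Λ} (h : Star M X H) (f : X →ₗ[Λ] Y)
    (hf : ∀ φ : X →ₗ[Λ] M, ∃ ψ : Y →ₗ[Λ] M, ψ ∘ₗ f = φ) (φ : X →ₗ[Λ] H) :
    ∃ ψ : Y →ₗ[Λ] H, ψ ∘ₗ f = φ := by
  by_contra hφ
  obtain ⟨ζ, hζ, hζ0⟩ := exists_dual_ne_zero (LinearMap.range (preHom f H)) (v := φ) hφ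
  refine hζ (LinearMap.congr_fun (h.1 ζ fun y k => ?_) φ)
  obtain ⟨y', rfl⟩ := hf y
  exact hζ0 _ ⟨k ∘ₗ y', rfl⟩

theorem Star.exists_lift {M X H Y : FDMod K Λ} (h : Star M X H) (f : Y →ₗ[Λ] H)
    (hf : ∀ φ : M →ₗ[Λ] H, ∃ ψ : M →ₗ[Λ] Y, f ∘ₗ ψ = φ) (φ : X →ₗ[Λ] H) :
    ∃ ψ : X →ₗ[Λ] Y, f ∘ₗ ψ = φ := by
  by_contra hφ
  obtain ⟨ζ, hζ, hζ0⟩ := exists_dual_ne_zero (LinearMap.range (postHom X f)) (v := φ) hφ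
  refine hζ (LinearMap.congr_fun (h.1 ζ fun y k => ?_) φ)
  obtain ⟨k', rfl⟩ := hf k
  exact hζ0 _ ⟨k' ∘ₗ y, rfl⟩

theorem exists_section {V W : Type*} [AddCommGroup V] [Module K V] [AddCommGroup W] [Module K W]
    (f : V →ₗ[K] W) (hf : Function.Surjective f) : ∃ s : W →ₗ[K] V, ∀ w, f (s w) = w := by
  obtain ⟨s, hs⟩ := f.exists_rightInverse_of_surjective (LinearMap.range_eq_top.2 hf)
  exact ⟨s, LinearMap.congr_fun hs⟩

/-- Exactness on the right of `Hom(M₁, H) → Hom(M₀, H) → Hom(X, H)`. -/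
theorem Star.exists_extend_of_comp_eq_zero {M X H M₀ M₁ : FDMod K Λ} (h : Star M X H)
    (hM₀ : InAdd Λ M₀ M) (f : X →ₗ[Λ] M₀) (g : M₀ →ₗ[Λ] M₁)
    (hf : ∀ φ : X →ₗ[Λ] M, ∃ ψ : M₀ →ₗ[Λ] M, ψ ∘ₗ f = φ)
    (hg : ∀ φ : M₀ →ₗ[Λ] M, φ ∘ₗ f = 0 → ∃ ψ : M₁ →ₗ[Λ] M, ψ ∘ₗ g = φ)
    (φ : M₀ →ₗ[Λ] H) (hφ : φ ∘ₗ f = 0) : ∃ ψ : M₁ →ₗ[Λ] H, ψ ∘ₗ g = φ := by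
  by_contra hne
  obtain ⟨ζ, hζ, hζ0⟩ := exists_dual_ne_zero (LinearMap.range (preHom g H)) (v := φ) hne
  -- The form `(y, k) ↦ ζ (k ∘ s y)` uses a `K`-linear choice `s y` of an extension of `y` to `M₀`.
  -- By `hwd` the choice is invisible to `ζ`, which makes the form balanced. The functional `ξ`
  -- representing it satisfies `ζ φ = ξ (φ f) = 0`.
  obtain ⟨s, hs⟩ := exists_section (preHom f M) hf
  have hwd : ∀ (y₀ y₁ : M₀ →ₗ[Λ] M) (k : M →ₗ[Λ] H), y₀ ∘ₗ f = y₁ ∘ₗ f →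
      ζ (k ∘ₗ y₀) = ζ (k ∘ₗ y₁) := fun y₀ y₁ k hy => by
    obtain ⟨w, hw⟩ := hg (y₀ - y₁) (by rw [LinearMap.sub_comp, hy, sub_self])
    have := hζ0 (k ∘ₗ (y₀ - y₁)) ⟨k ∘ₗ w, by rw [← hw]; rfl⟩
    rwa [LinearMap.comp_sub, map_sub, sub_eq_zero] at this
  obtain ⟨ξ, hξ⟩ := h.2 ((compHom M₀ M H).compr₂ ζ ∘ₗ s) fun t y k => by
    show ζ (k ∘ₗ s (t ∘ₗ y)) = ζ ((k ∘ₗ t) ∘ₗ s y)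
    rw [LinearMap.comp_assoc]
    refine hwd _ _ _ ?_
    have h1 := hs (t ∘ₗ y)
    have h2 := hs y
    rw [preHom_apply] at h1 h2
    rw [h1, LinearMap.comp_assoc, h2]
  obtain ⟨n, a, b, hab, -⟩ := hM₀.exists_comp
  apply hζ
  have key : ∀ i, ζ ((φ ∘ₗ a i) ∘ₗ b i) = ξ ((φ ∘ₗ a i) ∘ₗ b i ∘ₗ f) := fun i => by
    rw [← hξ]
    exact hwd _ _ _ (hs (b i ∘ₗ f)).symm
  calc ζ φ = ∑ i, ζ ((φ ∘ₗ a i) ∘ₗ b i) := by rw [← map_sum, hab]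
    _ = ξ ((∑ i, (φ ∘ₗ a i) ∘ₗ b i) ∘ₗ f) := by
        rw [sum_comp', map_sum]
        exact Finset.sum_congr rfl fun i _ => key i
    _ = 0 := by rw [hab, hφ, map_zero]

/-- Exactness on the right of `Hom(X, A) → Hom(X, B) → Hom(X, H)`. -/
theorem Star.exists_lift_of_comp_eq_zero {M X H A B : FDMod K Λ} (h : Star M X H)
    (hB : InAdd Λ B M) (μ : A →ₗ[Λ] B) (p : B →ₗ[Λ] H)
    (hp : ∀ φ : M →ₗ[Λ] H, ∃ ψ : M →ₗ[Λ] B, p ∘ₗ ψ = φ)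
    (hμ : ∀ φ : M →ₗ[Λ] B, p ∘ₗ φ = 0 → ∃ ψ : M →ₗ[Λ] A, μ ∘ₗ ψ = φ)
    (φ : X →ₗ[Λ] B) (hφ : p ∘ₗ φ = 0) : ∃ ψ : X →ₗ[Λ] A, μ ∘ₗ ψ = φ := by
  by_contra hne
  obtain ⟨ζ, hζ, hζ0⟩ := exists_dual_ne_zero (LinearMap.range (postHom X μ)) (v := φ) hne
  -- Here `s` chooses lifts through `p` of maps `M → H`; the balanced form is `(y, k) ↦ ζ (s k ∘
  -- y)`.
  obtain ⟨s, hs⟩ := exists_section (postHom M p) hp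
  have hwd : ∀ (k₀ k₁ : M →ₗ[Λ] B) (y : X →ₗ[Λ] M), p ∘ₗ k₀ = p ∘ₗ k₁ →
      ζ (k₀ ∘ₗ y) = ζ (k₁ ∘ₗ y) := fun k₀ k₁ y hy => by
    obtain ⟨w, hw⟩ := hμ (k₀ - k₁) (by rw [LinearMap.comp_sub, hy, sub_self])
    have := hζ0 ((k₀ - k₁) ∘ₗ y) ⟨w ∘ₗ y, by rw [← hw]; rfl⟩
    rwa [LinearMap.sub_comp, map_sub, sub_eq_zero] at this
  obtain ⟨ξ, hξ⟩ := h.2 (((compHom X M B).compr₂ ζ).compl₂ s) fun t y k => by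
    show ζ (s k ∘ₗ t ∘ₗ y) = ζ (s (k ∘ₗ t) ∘ₗ y)
    rw [← LinearMap.comp_assoc]
    refine hwd _ _ _ ?_
    have h1 := hs (k ∘ₗ t)
    have h2 := hs k
    rw [postHom_apply] at h1 h2
    rw [h1, ← LinearMap.comp_assoc, h2]
  obtain ⟨n, a, b, -, hab⟩ := hB.exists_comp
  apply hζ
  have key : ∀ i, ζ (a i ∘ₗ b i ∘ₗ φ) = ξ (p ∘ₗ a i ∘ₗ b i ∘ₗ φ) := fun i => by
    rw [← LinearMap.comp_assoc (b i ∘ₗ φ) (a i) p, ← hξ]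
    exact hwd _ _ _ (hs (p ∘ₗ a i)).symm
  calc ζ φ = ∑ i, ζ (a i ∘ₗ b i ∘ₗ φ) := by rw [← map_sum, hab]
    _ = ξ (p ∘ₗ ∑ i, a i ∘ₗ b i ∘ₗ φ) := by
        rw [comp_sum', map_sum]
        exact Finset.sum_congr rfl fun i _ => key i
    _ = 0 := by rw [hab, hφ, map_zero]

/-- Left approximations of `X`, and then of the cokernel, give the candidate `X → Mⁿ → Mᵐ`. By
`Star`, `(-, H)` is exact on it. Since `H` cogenerates, this already forces the exactness of the
sequence itself: a failure would be detected by a map to `H` that cannot extend. -/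
theorem Star.cogen₁ {M X H : FDMod K Λ} (hH : InAdd Λ (dualReg Λ) H) (h : Star M X H) :
    Cogen₁ (upperF H) M X := by
  obtain ⟨n, f, hf⟩ := exists_leftApprox M X
  obtain ⟨m, c, hc⟩ := exists_leftApprox M (cokerMod f)
  set q : powMod n M →ₗ[Λ] cokerMod f := (LinearMap.range f).mkQ with hq
  have hqs : Function.Surjective q := Submodule.mkQ_surjective _
  have hfq : Function.Exact f q := LinearMap.exact_iff.2 (Submodule.ker_mkQ _)
  set g := c ∘ₗ q with hgdef
  have hgf : ∀ x, g (f x) = 0 := fun x => by simp [hgdef, hfq.apply_apply_eq_zero]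
  have hg : ∀ φ : powMod n M →ₗ[Λ] M, φ ∘ₗ f = 0 → ∃ ψ : powMod m M →ₗ[Λ] M, ψ ∘ₗ g = φ :=
    fun φ hφ => by
      obtain ⟨v, hv⟩ := exists_desc_of_exact hqs hfq φ (LinearMap.congr_fun hφ)
      obtain ⟨ψ, rfl⟩ := hc v
      exact ⟨ψ, LinearMap.ext hv⟩
  have hinj : Function.Injective f := by
    rw [injective_iff_map_eq_zero]
    intro x hx
    by_contra hne
    obtain ⟨k, hk, -⟩ := exists_hom_ne_zero hH (⊥ : Submodule Λ X) (x := x) (by simpa using hne)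
    obtain ⟨k', rfl⟩ := h.exists_extend f hf k
    exact hk (by simp [hx])
  have hext := h.exists_extend_of_comp_eq_zero (InAdd.pow n) f g hf hg
  have hex : Function.Exact f g := fun y => by
    refine ⟨fun hy => ?_, ?_⟩
    · by_contra hne
      obtain ⟨k, hk, hk0⟩ := exists_hom_ne_zero hH (LinearMap.range f) (x := y) hne
      obtain ⟨k', rfl⟩ := hext k (LinearMap.ext fun x => hk0 _ ⟨x, rfl⟩)
      exact hk (by simp [hy])
    · rintro ⟨x, rfl⟩
      exact hgf x
  refine ⟨powMod n M, powMod m M, f, g, InAdd.pow n, InAdd.pow m, hinj, hex,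
    ⟨cokerMod f, q, ⟨hinj, hfq, hqs⟩, h.exists_extend f hf⟩,
    ⟨cokerMod (imageIncl g), (LinearMap.range (imageIncl g)).mkQ,
      ⟨Subtype.val_injective, LinearMap.exact_iff.2 (Submodule.ker_mkQ _),
        Submodule.mkQ_surjective _⟩, fun φ => ?_⟩, fun φ => ⟨hg φ, ?_⟩, hf⟩
  -- A map from `Im g` to `H` is a map `Mⁿ → H` killing `X`, so `hext` extends it to `Mᵐ`.
  · obtain ⟨ψ, hψ⟩ := hext (φ ∘ₗ g.rangeRestrict) (LinearMap.ext fun x => by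
      have : g.rangeRestrict (f x) = 0 := Subtype.ext (hgf x)
      show φ (g.rangeRestrict (f x)) = 0
      rw [this]
      exact map_zero φ)
    refine ⟨ψ, LinearMap.ext ?_⟩
    rintro ⟨_, y, rfl⟩
    exact LinearMap.congr_fun hψ y
  · rintro ⟨ψ, rfl⟩
    exact LinearMap.ext fun x => by simp [hgf]

/-- Every map `X → H` extends to `M₀ ∈ add(M)`, so it is a sum of composites through `M`; this gives
uniqueness. For existence, a balanced form defines `ξ₀` on `(M₀, H)` by a dual basis of `M₀`. Maps
killing `X` come from `M₁ ∈ add(M)`, where balancedness makes `ξ₀` vanish, so `ξ₀` descends to `(X,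
H)`. -/
theorem Cogen₁.star {M X H : FDMod K Λ} (h : Cogen₁ (upperF H) M X) : Star M X H := by
  obtain ⟨M₀, M₁, f, g, hM₀, hM₁, hf, hfg, ⟨C, π, -, hπ⟩, ⟨C', π', -, hπ'⟩, hex, hsurj⟩ := h
  obtain ⟨n, a, b, hab, -⟩ := hM₀.exists_comp
  obtain ⟨m, c, e, hce, -⟩ := hM₁.exists_comp
  refine ⟨fun ξ hξ => ?_, fun β hβ => ?_⟩
  · ext k
    obtain ⟨k, rfl⟩ := hπ k
    rw [← hab k, sum_comp', map_sum]
    exact Finset.sum_eq_zero fun i _ => hξ (b i ∘ₗ f) (k ∘ₗ a i)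
  · let ξ₀ : Module.Dual K (M₀ →ₗ[Λ] H) := ∑ i, β (b i ∘ₗ f) ∘ₗ preHom (a i) H
    have hξ₀ : ∀ k, ξ₀ k = ∑ i, β (b i ∘ₗ f) (k ∘ₗ a i) := fun k => by
      simp [ξ₀, LinearMap.sum_apply]
    have hcomp : ∀ (y : M₀ →ₗ[Λ] M) (k : M →ₗ[Λ] H), ξ₀ (k ∘ₗ y) = β (y ∘ₗ f) k := fun y k => by
      rw [hξ₀]
      conv_rhs => rw [← hab y, sum_comp', map_sum, LinearMap.sum_apply]
      exact Finset.sum_congr rfl fun i _ => (hβ (y ∘ₗ a i) (b i ∘ₗ f) k).symm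
    obtain ⟨ξ, hξ⟩ := exists_dual_desc (preHom f H) hπ ξ₀ fun k hk => by
      obtain ⟨v, hv⟩ := exists_desc_of_exact (C := image g) g.surjective_rangeRestrict
        (f := f) (fun y => Subtype.ext_iff.trans (hfg y)) k (LinearMap.congr_fun hk)
      obtain ⟨w, hw⟩ := hπ' v
      have hk' : k = w ∘ₗ g := LinearMap.ext fun y => by
        rw [← hv y, ← hw]; rfl
      rw [hk', ← hce w, sum_comp', map_sum]
      refine Finset.sum_eq_zero fun i _ => ?_
      rw [LinearMap.comp_assoc, hcomp]
      have : (e i ∘ₗ g) ∘ₗ f = 0 := LinearMap.ext fun x => by simp [hfg.apply_apply_eq_zero]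
      rw [this, map_zero, LinearMap.zero_apply]
    refine ⟨ξ, fun y k => ?_⟩
    obtain ⟨y, rfl⟩ := hsurj y
    exact (hcomp y k).symm.trans (hξ (k ∘ₗ y)).symm

/-- A right-hand exact sequence `A → B → H → 0` of modules in `add(M)` over `H`. -/
theorem Star.exists_presentation {M G H : FDMod K Λ} (hG : InAdd Λ (regMod Λ) G)
    (h : Star M G H) : ∃ (A B : FDMod K Λ) (μ : A →ₗ[Λ] B) (p : B →ₗ[Λ] H),
      InAdd Λ A M ∧ InAdd Λ B M ∧ Function.Exact μ p ∧ Function.Surjective p ∧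
      (∀ φ : M →ₗ[Λ] H, ∃ ψ : M →ₗ[Λ] B, p ∘ₗ ψ = φ) ∧
      (∀ φ : M →ₗ[Λ] B, p ∘ₗ φ = 0 → ∃ ψ : M →ₗ[Λ] A, μ ∘ₗ ψ = φ) ∧
      (∀ φ : G →ₗ[Λ] H, ∃ ψ : G →ₗ[Λ] B, p ∘ₗ ψ = φ) ∧
      (∀ φ : G →ₗ[Λ] B, p ∘ₗ φ = 0 → ∃ ψ : G →ₗ[Λ] A, μ ∘ₗ ψ = φ) := by
  obtain ⟨n, p, hp⟩ := exists_rightApprox M H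
  obtain ⟨m, c, hc⟩ := exists_rightApprox M (kerMod p)
  set μ : powMod m M →ₗ[Λ] powMod n M := (LinearMap.ker p).subtype ∘ₗ c with hμdef
  have hpμ : ∀ x, p (μ x) = 0 := fun x => (c x).2
  have hμ : ∀ φ : M →ₗ[Λ] powMod n M, p ∘ₗ φ = 0 → ∃ ψ : M →ₗ[Λ] powMod m M, μ ∘ₗ ψ = φ :=
    fun φ hφ => by
      obtain ⟨ψ, hψ⟩ := hc (φ.codRestrict (LinearMap.ker p) (LinearMap.congr_fun hφ))
      exact ⟨ψ, by rw [hμdef, LinearMap.comp_assoc, hψ]; rfl⟩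
  have hGp := h.exists_lift p hp
  have hGμ := h.exists_lift_of_comp_eq_zero (InAdd.pow n) μ p hp hμ
  refine ⟨powMod m M, powMod n M, μ, p, InAdd.pow m, InAdd.pow n, fun y => ⟨fun hy => ?_, ?_⟩,
    surjective_of_generator hG p hGp, hp, hμ, hGp, hGμ⟩
  -- Exactness at the middle is tested on maps from the generator `G`: `y` is a sum of values of
  -- maps `G → Λ → Mⁿ` killed by `p`.
  · obtain ⟨l, a, g, hx⟩ := exists_sum_of_generator hG (powMod n M)
    rw [← hx y]
    refine Submodule.sum_mem (LinearMap.range μ) fun i _ => ?_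
    obtain ⟨ψ, hψ⟩ := hGμ (regMap y ∘ₗ a i) (LinearMap.ext fun z => by
      show p ((show Λ from a i z) • y) = 0
      rw [map_smul, hy, smul_zero])
    exact ⟨ψ (g i), LinearMap.congr_fun hψ (g i)⟩
  · rintro ⟨x, rfl⟩
    exact hpμ x

/-! ## Nakayama pairs -/

section Nakayama

variable {X Y P J P₀ P₁ I₀ I₁ : FDMod K Λ}

theorem eq_zero_of_dual {V : Type*} [AddCommGroup V] [Module K V] {v : V}
    (h : ∀ ξ : Module.Dual K V, ξ v = 0) : v = 0 :=
  (Module.forall_dual_apply_eq_zero_iff K v).1 h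

theorem eq_of_dual {V : Type*} [AddCommGroup V] [Module K V] {v w : V}
    (h : ∀ ξ : Module.Dual K V, ξ v = ξ w) : v = w :=
  sub_eq_zero.1 (eq_zero_of_dual (K := K) fun ξ => by rw [map_sub, h, sub_self])

/-- Evaluation at an element as a `K`-linear map. -/
def evalAt (x : X) (Y : FDMod K Λ) : (X →ₗ[Λ] Y) →ₗ[K] Y where
  toFun f := f x
  map_add' _ _ := rfl
  map_smul' _ _ := rfl

/-- `dualMap` as a `K`-linear map. -/
def dualMapₗ (X : FDMod K Λ) : Module.Dual K X →ₗ[K] (X →ₗ[Λ] dualReg Λ) where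
  toFun := dualMap
  map_add' _ _ := rfl
  map_smul' _ _ := rfl

/-- Coordinates exhibiting `P` as a projective module and `J` as its image under the Nakayama
functor: `Φ : P ≅ Hom(DΛ, J)`, with `pᵢ`, `cᵢ` dual bases of `P`, and `bᵢ` the corresponding
maps `J → DΛ`. -/
structure NakData (P J : FDMod K Λ) where
  n : ℕ
  p : Fin n → P
  c : Fin n → P →ₗ[Λ] regMod Λ
  b : Fin n → J →ₗ[Λ] dualReg Λ
  Φ : P →ₗ[Λ] nuInv J
  sum_Φ : ∀ j, ∑ i, (show dualReg Λ →ₗ[Λ] J from Φ (p i)) (b i j) = j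
  sum_c : ∀ α, ∑ i, (show Λ from c i α) • p i = α
  b_Φ : ∀ i α (ψ : dualReg Λ),
    (show Module.Dual K Λ from b i ((show dualReg Λ →ₗ[Λ] J from Φ α) ψ)) 1 =
      (show Module.Dual K Λ from ψ) (show Λ from c i α)

namespace NakData

/-- The map `DΛ → J` corresponding to an element of `P`. -/
def toHom (D : NakData P J) (α : P) : dualReg Λ →ₗ[Λ] J := D.Φ α

/-- The trace functional on `Hom(P, J)`. -/
def tr (D : NakData P J) : Module.Dual K (P →ₗ[Λ] J) :=
  ∑ i, evalOne (D.b i) ∘ₗ evalAt (D.p i) J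

theorem tr_apply (D : NakData P J) (φ : P →ₗ[Λ] J) :
    D.tr φ = ∑ i, (show Module.Dual K Λ from D.b i (φ (D.p i))) 1 := by
  rw [tr, LinearMap.sum_apply]
  rfl

theorem inAdd (D : NakData P J) : InAdd Λ P (regMod Λ) :=
  InAdd.of_sum (fun i => regMap (D.p i)) D.c D.sum_c

theorem toHom_smul (D : NakData P J) (r : Λ) (α : P) (ψ : dualReg Λ) :
    D.toHom (r • α) ψ = D.toHom α (dualRegRight Λ r ψ) :=
  LinearMap.congr_fun (D.Φ.map_smul r α) ψ

/-- The values `ζ (f α)` are recovered from the trace pairing between `(P, X)` and `(X, J)`, which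
is therefore nondegenerate in `f`. This pairing realizes the Nakayama duality `D Hom(P, X) ≅ Hom(X,
J)`. -/
theorem tr_toHom (D : NakData P J) (f : P →ₗ[Λ] X) (α : P) (ζ : Module.Dual K X) :
    D.tr ((D.toHom α ∘ₗ dualMap ζ) ∘ₗ f) = ζ (f α) := by
  rw [tr_apply]
  conv_rhs => rw [← D.sum_c α, map_sum, map_sum]
  refine Finset.sum_congr rfl fun i _ => ?_
  rw [map_smul]
  exact D.b_Φ i α (dualMap ζ (f (D.p i)))

theorem eq_zero (D : NakData P J) (f : P →ₗ[Λ] X) (h : ∀ w : X →ₗ[Λ] J, D.tr (w ∘ₗ f) = 0) :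
    f = 0 :=
  LinearMap.ext fun α => eq_zero_of_dual fun ζ => by rw [← D.tr_toHom f α ζ, h]

theorem exists_eq_tr (D : NakData P J) (ξ : Module.Dual K (X →ₗ[Λ] J)) :
    ∃ f : P →ₗ[Λ] X, ∀ w, ξ w = D.tr (w ∘ₗ f) := by
  -- Since `ζ (f α)` must be the trace against `toHom α ∘ dualMap ζ`, the value `f α` is forced to
  -- be the element of `X ≅ DDX` given by `ζ ↦ ξ (toHom α ∘ dualMap ζ)`.
  let F : P → X := fun α =>
    (Module.evalEquiv K X).symm (ξ ∘ₗ postHom X (D.toHom α) ∘ₗ dualMapₗ X)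
  have hF : ∀ α (ζ : Module.Dual K X), ζ (F α) = ξ (D.toHom α ∘ₗ dualMap ζ) := fun α ζ =>
    Module.apply_evalEquiv_symm_apply K X ζ _
  let f : P →ₗ[Λ] X :=
    { toFun := F
      map_add' := fun α α' => eq_of_dual (K := K) (v := F (α + α')) (w := F α + F α') fun ζ => by
        rw [map_add, hF, hF, hF, ← map_add]
        exact congrArg ξ <| LinearMap.ext fun x => LinearMap.congr_fun (D.Φ.map_add α α') _
      map_smul' := fun r α => eq_of_dual (K := K) (v := F (r • α)) (w := r • F α) fun ζ => by
        have h2 := hF α (ζ ∘ₗ DistribSMul.toLinearMap K X r)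
        refine (hF _ ζ).trans (Eq.trans ?_ h2.symm)
        refine congrArg ξ <| LinearMap.ext fun x => (D.toHom_smul r α _).trans ?_
        refine congrArg (D.toHom α) (LinearMap.ext fun a => ?_)
        show ζ ((r * a) • x) = ζ (r • a • x)
        rw [mul_smul] }
  refine ⟨f, fun w => ?_⟩
  have h1 : ∀ i, (show Module.Dual K Λ from D.b i (w (f (D.p i)))) 1 =
      ξ (D.toHom (D.p i) ∘ₗ D.b i ∘ₗ w) := fun i => by
    refine (hF (D.p i) (evalOne (D.b i ∘ₗ w))).trans ?_
    rw [dualMap_evalOne]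
  rw [tr_apply]
  simp only [LinearMap.comp_apply, h1]
  rw [← map_sum]
  congr 1
  refine LinearMap.ext fun x => ?_
  rw [LinearMap.sum_apply]
  exact (D.sum_Φ (w x)).symm

/-- The trace pairing embeds `(P, X)` into the dual of `(X, J)`. Extending `ζ` along this embedding
gives an element of the double dual of `(X, J)`, hence a map. -/
theorem exists_eq_tr' (D : NakData P J) (ζ : Module.Dual K (P →ₗ[Λ] X)) :
    ∃ w : X →ₗ[Λ] J, ∀ f, ζ f = D.tr (w ∘ₗ f) := by
  let T : (P →ₗ[Λ] X) →ₗ[K] Module.Dual K (X →ₗ[Λ] J) := (compHom P X J).compr₂ D.tr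
  have hT : Function.Injective T := by
    rw [injective_iff_map_eq_zero]
    exact fun f hf => D.eq_zero f (LinearMap.congr_fun hf)
  obtain ⟨η, hη⟩ := exists_dual_extend T hT ζ
  refine ⟨(Module.evalEquiv K (X →ₗ[Λ] J)).symm η, fun f => ?_⟩
  rw [← hη f]
  exact (Module.apply_evalEquiv_symm_apply K (X →ₗ[Λ] J) (T f) η).symm

/-- Naturality of the Nakayama duality, in the manner of cyclic invariance of a trace: both sides
are expanded in the two dual bases and the sums are exchanged. -/
theorem tr_comp (D₀ : NakData P₀ I₀) (D₁ : NakData P₁ I₁) (δ : P₀ →ₗ[Λ] P₁) (d : I₀ →ₗ[Λ] I₁)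
    (h : ∀ α ψ, D₁.toHom (δ α) ψ = d (D₀.toHom α ψ)) (φ : P₁ →ₗ[Λ] I₀) :
    D₁.tr (d ∘ₗ φ) = D₀.tr (φ ∘ₗ δ) := by
  have h1 : ∀ i, (show Module.Dual K Λ from D₁.b i (d (φ (D₁.p i)))) 1 = ∑ j,
      (show Module.Dual K Λ from D₀.b j (φ ((show Λ from D₁.c i (δ (D₀.p j))) • D₁.p i))) 1 :=
    fun i => by
      have h2 : d (φ (D₁.p i)) =
          ∑ j, D₁.toHom (δ (D₀.p j)) (D₀.b j (φ (D₁.p i))) := by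
        conv_lhs => rw [← D₀.sum_Φ (φ (D₁.p i)), map_sum]
        exact Finset.sum_congr rfl fun j _ => (h _ _).symm
      have h3 : evalOne (D₁.b i) (d (φ (D₁.p i))) =
          ∑ j, evalOne (D₁.b i) (D₁.toHom (δ (D₀.p j)) (D₀.b j (φ (D₁.p i)))) := by
        rw [h2, map_sum]
      refine h3.trans (Finset.sum_congr rfl fun j _ => (D₁.b_Φ i _ _).trans ?_)
      rw [map_smul, map_smul]
      exact congrArg (show Module.Dual K Λ from D₀.b j (φ (D₁.p i))) (one_mul _).symm
  rw [tr_apply, tr_apply]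
  simp only [LinearMap.comp_apply, h1]
  rw [Finset.sum_comm]
  refine Finset.sum_congr rfl fun j _ => ?_
  have h4 : ∑ i, evalOne (D₀.b j ∘ₗ φ) ((show Λ from D₁.c i (δ (D₀.p j))) • D₁.p i) =
      evalOne (D₀.b j ∘ₗ φ) (δ (D₀.p j)) := by
    rw [← map_sum, D₁.sum_c]
  exact h4

end NakData

/-- By the trace duality, `(P₁, X) → (P₀, X)` is the dual of `(X, I₀) → (X, I₁)`, whose kernel is
`(X, H)`; so its cokernel is `D(X, H)`. The functional `τ` is the trace of the composite with `i`.
-/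
theorem ARSeq.of_copresentation {G H : FDMod K Λ} (D₀ : NakData P₀ I₀) (D₁ : NakData P₁ I₁)
    (δ : P₀ →ₗ[Λ] P₁) (π : P₁ →ₗ[Λ] G) (i : H →ₗ[Λ] I₀) (d : I₀ →ₗ[Λ] I₁)
    (h : ∀ α ψ, D₁.toHom (δ α) ψ = d (D₀.toHom α ψ)) (hδ : Function.Exact δ π)
    (hπ : Function.Surjective π) (hi : Function.Injective i) (hid : Function.Exact i d) :
    ARSeq G H := by
  refine ⟨P₀, P₁, δ, π, D₀.tr ∘ₗ postHom P₀ i, D₀.inAdd, D₁.inAdd, hδ, hπ, fun X u => ⟨fun hu => ?_,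
    ?_⟩, fun X ξ => ?_⟩
  · by_contra hne
    obtain ⟨ζ, hζ, hζ0⟩ := exists_dual_ne_zero (LinearMap.range (preHom δ X)) (v := u) hne
    obtain ⟨w, hw⟩ := D₀.exists_eq_tr' ζ
    have hdw : d ∘ₗ w = 0 := eq_zero_of_dual fun ξ => by
      obtain ⟨r, hr⟩ := D₁.exists_eq_tr ξ
      rw [hr, LinearMap.comp_assoc, NakData.tr_comp D₀ D₁ δ d h, LinearMap.comp_assoc, ← hw]
      exact hζ0 _ ⟨r, rfl⟩
    obtain ⟨v, hv⟩ := exists_lift_of_exact hi hid w (LinearMap.congr_fun hdw)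
    have : w = i ∘ₗ v := LinearMap.ext fun x => (hv x).symm
    exact hζ (by rw [hw, this]; exact hu v)
  · rintro ⟨r, rfl⟩ k
    show D₀.tr (i ∘ₗ k ∘ₗ r ∘ₗ δ) = 0
    rw [← LinearMap.comp_assoc, ← LinearMap.comp_assoc, ← NakData.tr_comp D₀ D₁ δ d h]
    have : d ∘ₗ (i ∘ₗ k) ∘ₗ r = 0 := LinearMap.ext fun x => hid.apply_apply_eq_zero _
    rw [this, map_zero]
  · obtain ⟨η, hη⟩ := exists_dual_extend (postHom X i)
      ((injective_iff_map_eq_zero _).2 fun f hf => LinearMap.ext fun x =>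
        hi ((LinearMap.congr_fun hf x).trans (map_zero i).symm)) ξ
    obtain ⟨u, hu⟩ := D₀.exists_eq_tr η
    exact ⟨u, fun k => (hη k).symm.trans (hu _)⟩

end Nakayama

/-! ## The inverse Auslander–Reiten translate -/

section TauInv

/-- The element of `Λ` representing an endomorphism of `DΛ` after composition with a map. -/
def nuCoord {J : FDMod K Λ} (b : J →ₗ[Λ] dualReg Λ) : nuInv J →ₗ[Λ] regMod Λ :=
  let F : nuInv J → Λ := fun α =>
    (Module.evalEquiv K Λ).symm (evalOne (b ∘ₗ (show dualReg Λ →ₗ[Λ] J from α)))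
  have hF : ∀ α (ψ : Module.Dual K Λ), ψ (F α) =
      evalOne b ((show dualReg Λ →ₗ[Λ] J from α) (show dualReg Λ from ψ)) :=
    fun _ ψ => Module.apply_evalEquiv_symm_apply K Λ ψ _
  { toFun := F
    map_add' := fun α α' => eq_of_dual (K := K) (v := F (α + α')) (w := F α + F α') fun ψ =>
      ((hF (α + α') ψ).trans (map_add (evalOne b) _ _)).trans <|
        (congrArg₂ (· + ·) (hF α ψ) (hF α' ψ)).symm.trans (map_add ψ _ _).symm
    map_smul' := fun r α => eq_of_dual (K := K) (v := F (r • α)) (w := r * F α) fun ψ =>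
      (hF _ ψ).trans (hF α (ψ ∘ₗ LinearMap.mulLeft K r)).symm }

theorem nuCoord_apply {J : FDMod K Λ} (b : J →ₗ[Λ] dualReg Λ) (α : dualReg Λ →ₗ[Λ] J)
    (ψ : dualReg Λ) : (show Module.Dual K Λ from b (α ψ)) 1 =
      (show Module.Dual K Λ from ψ) (show Λ from nuCoord b α) :=
  (Module.apply_evalEquiv_symm_apply K Λ (show Module.Dual K Λ from ψ) (evalOne (b ∘ₗ α))).symm

/-- Endomorphisms of `DΛ` are right multiplications by elements of `Λ`; the coordinate is the
element belonging to `b α`. -/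
theorem dualRegRight_nuCoord {J : FDMod K Λ} (b : J →ₗ[Λ] dualReg Λ) (α : dualReg Λ →ₗ[Λ] J)
    (ψ : dualReg Λ) : dualRegRight Λ (show Λ from nuCoord b α) ψ = b (α ψ) :=
  LinearMap.ext fun x => by
    have h := nuCoord_apply b α (x • ψ)
    rw [map_smul, map_smul] at h
    refine h.symm.trans ?_
    exact congrArg (show Module.Dual K Λ from b (α ψ)) (one_mul x)

/-- The maps `aᵢ : DΛ → J` of a decomposition `∑ aᵢ bᵢ = id` are themselves elements of `ν⁻J`, and
they form a dual basis together with the coordinates of the `bᵢ`. -/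
theorem nonempty_nakData {J : FDMod K Λ} (hJ : InAdd Λ J (dualReg Λ)) :
    ∃ D : NakData (nuInv J) J, ∀ α, D.toHom α = α := by
  obtain ⟨n, a, b, h⟩ := hJ.exists_sum
  refine ⟨{ n := n, p := a, c := fun i => nuCoord (b i), b := b, Φ := LinearMap.id, sum_Φ := h,
            sum_c := fun α => ?_, b_Φ := fun i α ψ => nuCoord_apply (b i) α ψ }, fun _ => rfl⟩
  let α' : dualReg Λ →ₗ[Λ] J := α
  let ev : ∀ ψ, nuInv J →+ J := fun ψ =>
    { toFun := fun f => (show dualReg Λ →ₗ[Λ] J from f) ψ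
      map_zero' := rfl
      map_add' := fun _ _ => rfl }
  refine LinearMap.ext fun ψ => ?_
  have key : ev ψ (∑ i, (show Λ from nuCoord (b i) α) • (show nuInv J from a i)) = α' ψ := by
    rw [map_sum]
    refine Eq.trans (Finset.sum_congr rfl fun i _ => ?_) (h (α' ψ))
    exact congrArg (a i) (dualRegRight_nuCoord (b i) α ψ)
  exact key

theorem exists_embedding_dualReg (X : FDMod K Λ) :
    ∃ (n : ℕ) (f : X →ₗ[Λ] powMod n (dualReg Λ)), Function.Injective f ∧
      ∀ φ : X →ₗ[Λ] dualReg Λ, ∃ ψ : powMod n (dualReg Λ) →ₗ[Λ] dualReg Λ, ψ ∘ₗ f = φ := by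
  obtain ⟨n, f, hf⟩ := exists_leftApprox (dualReg Λ) X
  refine ⟨n, f, (injective_iff_map_eq_zero _).2 fun x hx => ?_, hf⟩
  by_contra hne
  obtain ⟨k, hk, -⟩ := exists_hom_ne_zero (InAdd.refl (M := dualReg Λ)) (⊥ : Submodule Λ X)
    (x := x) (by simpa using hne)
  obtain ⟨k', rfl⟩ := hf k
  exact hk (by simp [hx])

theorem inAdd_dualReg_of_injective {J : FDMod K Λ} (hJ : Module.Injective Λ J) :
    InAdd Λ J (dualReg Λ) := by
  obtain ⟨n, f, hf, -⟩ := exists_embedding_dualReg J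
  obtain ⟨g, hg⟩ := hJ.out f hf LinearMap.id
  exact ⟨n, f, g, LinearMap.ext hg⟩

theorem IsTauInv.arSeq {H T : FDMod K Λ} (h : IsTauInv H T) : ARSeq T H := by
  obtain ⟨I₀, I₁, i, d, π, ⟨hi, hid, hd⟩, hπ, hs⟩ := h
  obtain ⟨D₀, h₀⟩ := nonempty_nakData (inAdd_dualReg_of_injective hi.1)
  obtain ⟨D₁, h₁⟩ := nonempty_nakData (inAdd_dualReg_of_injective hd.1)
  refine ARSeq.of_copresentation D₀ D₁ (nuInvMap d) π i d (fun α ψ => ?_) hπ hs hi.2.1 hid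
  rw [h₀, h₁]
  rfl

/-- Enlarging `P₁` by a summand `Λ` that `d` does not meet leaves the set of maps factoring through
`d` unchanged. It turns the cokernel into a generator. -/
theorem ARSeq.prod_regMod {H T : FDMod K Λ} (h : ARSeq T H) :
    ARSeq (prodMod (regMod Λ) T) H := by
  obtain ⟨P₀, P₁, d, π, τ, hP₀, hP₁, hd, hπ, h₁, h₂⟩ := h
  refine ⟨P₀, prodMod (regMod Λ) P₁, LinearMap.inr Λ _ _ ∘ₗ d, LinearMap.id.prodMap π, τ, hP₀,
    InAdd.prod InAdd.refl hP₁, fun x => ⟨fun hx => ?_, ?_⟩, fun x => ?_, fun X u => ?_, h₂⟩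
  · obtain ⟨x₁, x₂⟩ := x
    obtain ⟨rfl, hx₂⟩ := Prod.ext_iff.1 hx
    obtain ⟨y, hy⟩ := (hd x₂).1 hx₂
    exact ⟨y, Prod.ext rfl hy⟩
  · rintro ⟨y, rfl⟩
    exact Prod.ext rfl (hd.apply_apply_eq_zero y)
  · obtain ⟨y, hy⟩ := hπ x.2
    exact ⟨(x.1, y), Prod.ext rfl hy⟩
  · rw [h₁]
    constructor
    · rintro ⟨r, rfl⟩
      exact ⟨r ∘ₗ LinearMap.snd Λ _ _, rfl⟩
    · rintro ⟨r, rfl⟩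
      exact ⟨r ∘ₗ LinearMap.inr Λ _ _, rfl⟩

theorem ARSeq.of_equiv {G G' H : FDMod K Λ} (h : ARSeq G H) (e : G ≃ₗ[Λ] G') : ARSeq G' H := by
  obtain ⟨P₀, P₁, d, π, τ, hP₀, hP₁, hd, hπ, h'⟩ := h
  refine ⟨P₀, P₁, d, e.toLinearMap ∘ₗ π, τ, hP₀, hP₁, fun x => ?_, e.surjective.comp hπ, h'⟩
  rw [← hd x]
  exact e.map_eq_zero_iff

end TauInv

/-! ## Minimal approximations -/

section Minimal

variable {X Y N N₀ : FDMod K Λ}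

/-- Minimal left approximations exist. -/
theorem exists_minLeftApprox (N X : FDMod K Λ) :
    ∃ (N₀ : FDMod K Λ) (f : X →ₗ[Λ] N₀), IsMinLeftApprox N f := by
  classical
  let Q : ℕ → Prop := fun k => ∃ (N₀ : FDMod K Λ) (f : X →ₗ[Λ] N₀), Module.finrank K N₀ = k ∧
    InAdd Λ N₀ N ∧ ∀ φ : X →ₗ[Λ] N, ∃ ψ : N₀ →ₗ[Λ] N, ψ ∘ₗ f = φ
  have hQ : ∃ k, Q k := by
    obtain ⟨n, f, hf⟩ := exists_leftApprox N X
    exact ⟨_, powMod n N, f, rfl, InAdd.pow n, hf⟩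
  obtain ⟨N₀, f, hk, hN₀, hf⟩ := Nat.find_spec hQ
  refine ⟨N₀, f, hN₀, hf, fun θ hθ => ?_⟩
  have : IsArtinian Λ N₀ := isArtinian_of_tower K inferInstance
  have : IsNoetherian Λ N₀ := isNoetherian_of_tower K inferInstance
  -- Fitting's lemma: the image of a high power `E` of `θ` is a direct summand. As `E` fixes `f`,
  -- this image carries an approximation, so minimal dimension forces it to be all of `N₀`. The
  -- exponent `k + 1` is positive, so that surjectivity passes from `E` to `θ`.
  obtain ⟨k, hk₁⟩ := Filter.eventually_atTop.1 (LinearMap.eventually_isCompl_ker_pow_range_pow θ)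
  have hc := hk₁ (k + 1) (Nat.le_succ k)
  set E := θ ^ (k + 1) with hE
  have hEf : ∀ x, E (f x) = f x := by
    have : ∀ j, ∀ x, (θ ^ j) (f x) = f x := fun j => by
      induction j with
      | zero => intro x; rfl
      | succ j ih => intro x; rw [pow_succ', Module.End.mul_apply, ih, ← LinearMap.comp_apply, hθ]
    exact this _
  let R : FDMod K Λ := image (X := N₀) (Y := N₀) E
  let pr : N₀ →ₗ[Λ] R := Submodule.projectionOnto _ _ hc.symm
  have hpr : ∀ y : R, pr y.1 = y := fun y => Submodule.projectionOnto_apply_left hc.symm y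
  have hR : InAdd Λ R N := (InAdd.of_retract (LinearMap.range E).subtype pr hpr).trans hN₀
  have hle : Module.finrank K N₀ ≤ Module.finrank K R := by
    rw [hk]
    refine Nat.find_min' hQ ⟨R, pr ∘ₗ f, rfl, hR, fun φ => ?_⟩
    obtain ⟨ψ, rfl⟩ := hf φ
    refine ⟨ψ ∘ₗ (LinearMap.range E).subtype, LinearMap.ext fun x => congrArg ψ ?_⟩
    have h1 := hpr ⟨f x, f x, hEf x⟩
    exact congrArg Subtype.val h1
  have htop : (LinearMap.range E).restrictScalars K = ⊤ :=
    Submodule.eq_top_of_finrank_eq (le_antisymm (Submodule.finrank_le _) hle)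
  have hs : Function.Surjective E := fun y => by
    have : y ∈ (LinearMap.range E).restrictScalars K := htop ▸ Submodule.mem_top
    exact this
  have hsθ : Function.Surjective θ := fun y => by
    obtain ⟨z, hz⟩ := hs y
    exact ⟨(θ ^ k) z, by rw [← hz, hE, pow_succ', Module.End.mul_apply]⟩
  exact ⟨IsNoetherian.injective_of_surjective_endomorphism θ hsθ, hsθ⟩

end Minimal

section Minimal

/-- Minimal right approximations exist. -/
theorem exists_minRightApprox (N X : FDMod K Λ) :
    ∃ (N₀ : FDMod K Λ) (f : N₀ →ₗ[Λ] X), IsMinRightApprox N f := by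
  classical
  let Q : ℕ → Prop := fun k => ∃ (N₀ : FDMod K Λ) (f : N₀ →ₗ[Λ] X), Module.finrank K N₀ = k ∧
    InAdd Λ N₀ N ∧ ∀ φ : N →ₗ[Λ] X, ∃ ψ : N →ₗ[Λ] N₀, f ∘ₗ ψ = φ
  have hQ : ∃ k, Q k := by
    obtain ⟨n, f, hf⟩ := exists_rightApprox N X
    exact ⟨_, powMod n N, f, rfl, InAdd.pow n, hf⟩
  obtain ⟨N₀, f, hk, hN₀, hf⟩ := Nat.find_spec hQ
  refine ⟨N₀, f, hN₀, hf, fun θ hθ => ?_⟩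
  have : IsArtinian Λ N₀ := isArtinian_of_tower K inferInstance
  have : IsNoetherian Λ N₀ := isNoetherian_of_tower K inferInstance
  obtain ⟨k, hk₁⟩ := Filter.eventually_atTop.1 (LinearMap.eventually_isCompl_ker_pow_range_pow θ)
  have hc := hk₁ (k + 1) (Nat.le_succ k)
  set E := θ ^ (k + 1) with hE
  -- Here `f E = f`, so the restriction of `f` to the summand `Im E` is still an approximation.
  have hEf : ∀ x, f (E x) = f x := by
    have : ∀ j, ∀ x, f ((θ ^ j) x) = f x := fun j => by
      induction j with
      | zero => intro x; rfl
      | succ j ih =>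
        intro x
        rw [pow_succ, Module.End.mul_apply, ih]
        exact LinearMap.congr_fun hθ x
    exact this _
  let R : FDMod K Λ := image (X := N₀) (Y := N₀) E
  let pr : N₀ →ₗ[Λ] R := Submodule.projectionOnto _ _ hc.symm
  have hpr : ∀ y : R, pr y.1 = y := fun y => Submodule.projectionOnto_apply_left hc.symm y
  have hR : InAdd Λ R N := (InAdd.of_retract (LinearMap.range E).subtype pr hpr).trans hN₀
  have hle : Module.finrank K N₀ ≤ Module.finrank K R := by
    rw [hk]
    refine Nat.find_min' hQ ⟨R, f ∘ₗ (LinearMap.range E).subtype, rfl, hR, fun φ => ?_⟩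
    obtain ⟨ψ, rfl⟩ := hf φ
    exact ⟨E.rangeRestrict ∘ₗ ψ, LinearMap.ext fun x => hEf (ψ x)⟩
  have htop : (LinearMap.range E).restrictScalars K = ⊤ :=
    Submodule.eq_top_of_finrank_eq (le_antisymm (Submodule.finrank_le _) hle)
  have hs : Function.Surjective E := fun y => by
    have : y ∈ (LinearMap.range E).restrictScalars K := htop ▸ Submodule.mem_top
    exact this
  have hsθ : Function.Surjective θ := fun y => by
    obtain ⟨z, hz⟩ := hs y
    exact ⟨(θ ^ k) z, by rw [← hz, hE, pow_succ', Module.End.mul_apply]⟩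
  exact ⟨IsNoetherian.injective_of_surjective_endomorphism θ hsθ, hsθ⟩

end Minimal

/-! ## Existence of the inverse Auslander–Reiten translate -/

section Injective

/-- Maps to `DΛ` are functionals, by evaluation at `1`, and functionals extend over a field. The
test modules are arbitrary `Λ`-modules, so their `K`-structure is obtained by restriction of
scalars. -/
theorem injective_dualReg (Λ : FDAlg K) : Module.Injective Λ (dualReg Λ) where
  out X Y _ _ _ _ f hf g := by
    let _ : Module K X := Module.restrictScalars K Λ X
    let _ : Module K Y := Module.restrictScalars K Λ Y
    have : IsScalarTower K Λ X := IsScalarTower.restrictScalars K Λ X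
    have : IsScalarTower K Λ Y := IsScalarTower.restrictScalars K Λ Y
    let ξ : Module.Dual K X :=
      { toFun := fun x => (show Module.Dual K Λ from g x) 1
        map_add' := fun x y => by rw [map_add]; rfl
        map_smul' := fun c x => by rw [LinearMap.map_smul_of_tower]; rfl }
    obtain ⟨η, hη⟩ := exists_dual_extend (f.restrictScalars K) hf ξ
    refine ⟨{ toFun := fun y => η ∘ₗ (LinearMap.toSpanSingleton Λ Y y).restrictScalars K
              map_add' := fun x y => LinearMap.ext fun a => ?_
              map_smul' := fun b x => LinearMap.ext fun a => ?_ }, fun x => LinearMap.ext fun a => ?_⟩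
    · show η (a • (x + y)) = η (a • x) + η (a • y)
      rw [smul_add, map_add]
    · show η (a • b • x) = η ((a * b) • x)
      rw [mul_smul]
    · show η (a • f x) = (show Module.Dual K Λ from g x) a
      rw [← map_smul]
      refine (hη _).trans ?_
      show (show Module.Dual K Λ from g (a • x)) 1 = _
      rw [map_smul]
      exact congrArg (show Module.Dual K Λ from g x) (one_mul a)

theorem injective_of_inAdd_dualReg {J : FDMod K Λ} (hJ : InAdd Λ J (dualReg Λ)) :
    Module.Injective Λ J where
  out X Y _ _ _ _ f hf g := by
    obtain ⟨n, a, b, h⟩ := hJ.exists_sum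
    choose e he using fun i => (injective_dualReg Λ).out f hf (b i ∘ₗ g)
    refine ⟨∑ i, a i ∘ₗ e i, fun x => ?_⟩
    rw [LinearMap.sum_apply]
    simp only [LinearMap.comp_apply, he, h]

/-- If `S` misses the image, then `X → J / S` is injective and `f` extends to `θ : J / S → J`. The
composite `J → J / S → J` fixes `f`, so it is bijective by minimality, and `S = 0`. -/
theorem IsMinLeftApprox.isInjEnvelope {X J : FDMod K Λ} {f : X →ₗ[Λ] J}
    (hf : IsMinLeftApprox (dualReg Λ) f) : IsInjEnvelope f := by
  have hJ := injective_of_inAdd_dualReg hf.1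
  have hinj : Function.Injective f := by
    obtain ⟨n, e, he, -⟩ := exists_embedding_dualReg X
    obtain ⟨ψ, rfl⟩ := (InAdd.pow n : InAdd Λ (powMod n (dualReg Λ)) _).extend f hf.2.1 e
    exact Function.Injective.of_comp he
  refine ⟨hJ, hinj, fun S hS => ?_⟩
  obtain ⟨θ, hθ⟩ := hJ.out (S.mkQ ∘ₗ f) ((injective_iff_map_eq_zero _).2 fun x hx => by
    have hx' : f x ∈ S := (Submodule.Quotient.mk_eq_zero S).1 hx
    have : f x ∈ S ⊓ LinearMap.range f := ⟨hx', x, rfl⟩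
    rw [hS, Submodule.mem_bot] at this
    exact hinj (this.trans (map_zero f).symm)) f
  have hb := hf.2.2 (θ ∘ₗ S.mkQ) (LinearMap.ext hθ)
  rw [eq_bot_iff]
  intro s hs
  refine hb.1 ?_
  have : S.mkQ s = 0 := (Submodule.Quotient.mk_eq_zero S).2 hs
  rw [LinearMap.comp_apply, this, map_zero, map_zero]

theorem exists_isTauInv (H : FDMod K Λ) : ∃ T : FDMod K Λ, IsTauInv H T := by
  obtain ⟨I₀, i, hi⟩ := exists_minLeftApprox (dualReg Λ) H
  obtain ⟨I₁, e, he⟩ := exists_minLeftApprox (dualReg Λ) (cokerMod i)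
  have he' := he.isInjEnvelope
  let q : I₀ →ₗ[Λ] cokerMod i := (LinearMap.range i).mkQ
  have hiq : Function.Exact i q := LinearMap.exact_iff.2 (Submodule.ker_mkQ _)
  have hr : LinearMap.range (imageIncl (e ∘ₗ q)) = LinearMap.range e := by
    refine (Submodule.range_subtype _).trans ?_
    exact LinearMap.range_comp_of_range_eq_top e (Submodule.range_mkQ _)
  refine ⟨cokerMod (nuInvMap (e ∘ₗ q)), I₀, I₁, i, e ∘ₗ q,
    (LinearMap.range (nuInvMap (e ∘ₗ q))).mkQ,
    ⟨hi.isInjEnvelope, fun x => ?_, he'.1, Subtype.val_injective, fun S hS => ?_⟩,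
    LinearMap.exact_iff.2 (Submodule.ker_mkQ _), Submodule.mkQ_surjective _⟩
  · rw [← hiq x]
    exact ⟨fun h => he'.2.1 (h.trans (map_zero e).symm), fun h => by
      rw [LinearMap.comp_apply, h, map_zero]⟩
  · rw [hr] at hS
    exact he'.2.2 S hS

end Injective

/-! ## Syzygies and cosyzygies up to summands -/

section Syzygies

variable {N C D N₀ N₁ R Z L : FDMod K Λ}

/-- A Schanuel argument. The decomposition `∑ cᵢ bᵢ = id` on `C` extends to comparison maps between
the approximations and descends to maps `Bᵢ`, `Aᵢ` between the cokernels. The defect `id - ∑ c₁ b₁`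
kills `a`, so it factors through `ρ : R → N₀`, and `id = ∑ Aᵢ Bᵢ + π ρ` on `R`. -/
theorem InAdd.cokernel (hCD : InAdd Λ C D) {a : C →ₗ[Λ] N₀} {π : N₀ →ₗ[Λ] R} {a' : D →ₗ[Λ] N₁}
    {π' : N₁ →ₗ[Λ] Z} (hN₀ : InAdd Λ N₀ N) (hN₁ : InAdd Λ N₁ N)
    (ha : ∀ φ : C →ₗ[Λ] N, ∃ ψ : N₀ →ₗ[Λ] N, ψ ∘ₗ a = φ)
    (ha' : ∀ φ : D →ₗ[Λ] N, ∃ ψ : N₁ →ₗ[Λ] N, ψ ∘ₗ a' = φ)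
    (he : Function.Exact a π) (hs : Function.Surjective π)
    (he' : Function.Exact a' π') (hs' : Function.Surjective π') : InAdd Λ R (Z × N) := by
  obtain ⟨n, c, b, hcb⟩ := hCD.exists_sum
  choose b₁ hb₁ using fun i => hN₁.extend a ha (a' ∘ₗ b i)
  choose c₁ hc₁ using fun i => hN₀.extend a' ha' (a ∘ₗ c i)
  choose B hB using fun i => exists_desc_of_exact hs he (π' ∘ₗ b₁ i) fun x => by
    have := LinearMap.congr_fun (hb₁ i) x
    simp only [LinearMap.comp_apply] at this ⊢
    rw [this, he'.apply_apply_eq_zero]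
  choose A hA using fun i => exists_desc_of_exact hs' he' (π ∘ₗ c₁ i) fun x => by
    have := LinearMap.congr_fun (hc₁ i) x
    simp only [LinearMap.comp_apply] at this ⊢
    rw [this, he.apply_apply_eq_zero]
  obtain ⟨ρ, hρ⟩ := exists_desc_of_exact hs he
    (LinearMap.id - ∑ i, c₁ i ∘ₗ b₁ i) fun x => by
      have h1 : ∀ i, c₁ i (b₁ i (a x)) = a (c i (b i x)) := fun i => by
        have h2 := LinearMap.congr_fun (hb₁ i) x
        have h3 := LinearMap.congr_fun (hc₁ i) (b i x)
        simp only [LinearMap.comp_apply] at h2 h3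
        rw [h2, h3]
      simp only [LinearMap.sub_apply, LinearMap.sum_apply, LinearMap.id_apply,
        LinearMap.comp_apply, h1]
      rw [← map_sum, hcb, sub_self]
  have h1 : InAdd Λ R (Z × N₀) := by
    refine InAdd.of_fintype (ι := Fin n ⊕ Unit)
      (Sum.elim (fun i => A i ∘ₗ LinearMap.fst Λ Z N₀) fun _ => π ∘ₗ LinearMap.snd Λ Z N₀)
      (Sum.elim (fun i => LinearMap.inl Λ Z N₀ ∘ₗ B i) fun _ => LinearMap.inr Λ Z N₀ ∘ₗ ρ)
      fun x => ?_
    obtain ⟨y, rfl⟩ := hs x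
    simp only [Fintype.sum_sum_type, Sum.elim_inl, Sum.elim_inr, LinearMap.comp_apply,
      LinearMap.fst_apply, LinearMap.inl_apply, LinearMap.snd_apply, LinearMap.inr_apply,
      hB, hA, hρ, LinearMap.sub_apply, LinearMap.sum_apply, LinearMap.id_apply, map_sub, map_sum]
    simp
  exact h1.trans (InAdd.prod InAdd.left_of_prod (hN₀.trans InAdd.right_of_prod))

theorem InAdd.kernel (hCD : InAdd Λ C D) {a : N₀ →ₗ[Λ] C} {ι : R →ₗ[Λ] N₀} {a' : N₁ →ₗ[Λ] D}
    {ι' : Z →ₗ[Λ] N₁} (hN₀ : InAdd Λ N₀ N) (hN₁ : InAdd Λ N₁ N)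
    (ha : ∀ φ : N →ₗ[Λ] C, ∃ ψ : N →ₗ[Λ] N₀, a ∘ₗ ψ = φ)
    (ha' : ∀ φ : N →ₗ[Λ] D, ∃ ψ : N →ₗ[Λ] N₁, a' ∘ₗ ψ = φ)
    (he : Function.Exact ι a) (hs : Function.Injective ι)
    (he' : Function.Exact ι' a') (hs' : Function.Injective ι') : InAdd Λ R (Z × N) := by
  obtain ⟨n, c, b, hcb⟩ := hCD.exists_sum
  choose b₁ hb₁ using fun i => hN₀.lift a' ha' (b i ∘ₗ a)
  choose c₁ hc₁ using fun i => hN₁.lift a ha (c i ∘ₗ a')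
  have hb₂ : ∀ i x, a' (b₁ i x) = b i (a x) := fun i => LinearMap.congr_fun (hb₁ i)
  have hc₂ : ∀ i x, a (c₁ i x) = c i (a' x) := fun i => LinearMap.congr_fun (hc₁ i)
  choose B hB using fun i => exists_lift_of_exact hs' he' (b₁ i ∘ₗ ι) fun x => by
    rw [LinearMap.comp_apply, hb₂, he.apply_apply_eq_zero, map_zero]
  choose A hA using fun i => exists_lift_of_exact hs he (c₁ i ∘ₗ ι') fun x => by
    rw [LinearMap.comp_apply, hc₂, he'.apply_apply_eq_zero, map_zero]
  obtain ⟨ρ, hρ⟩ := exists_lift_of_exact hs he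
    (LinearMap.id - ∑ i, c₁ i ∘ₗ b₁ i) fun x => by
      simp only [LinearMap.sub_apply, LinearMap.sum_apply, LinearMap.id_apply,
        LinearMap.comp_apply, map_sub, map_sum, hc₂, hb₂, hcb, sub_self]
  have h1 : InAdd Λ R (Z × N₀) := by
    refine InAdd.of_fintype (ι := Fin n ⊕ Unit)
      (Sum.elim (fun i => A i ∘ₗ LinearMap.fst Λ Z N₀) fun _ => ρ ∘ₗ LinearMap.snd Λ Z N₀)
      (Sum.elim (fun i => LinearMap.inl Λ Z N₀ ∘ₗ B i) fun _ => LinearMap.inr Λ Z N₀ ∘ₗ ι)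
      fun x => hs ?_
    simp only [Fintype.sum_sum_type, Sum.elim_inl, Sum.elim_inr, LinearMap.comp_apply,
      LinearMap.fst_apply, LinearMap.inl_apply, LinearMap.snd_apply, LinearMap.inr_apply,
      map_add, map_sum, hA, hB, hρ, LinearMap.sub_apply, LinearMap.sum_apply, LinearMap.id_apply,
      Finset.univ_unique, Finset.sum_singleton]
    simp
  exact h1.trans (InAdd.prod InAdd.left_of_prod (hN₀.trans InAdd.right_of_prod))

/-- The right end of a four-term exact sequence on which `Hom(-, N)` is exact. -/
theorem exists_cosyzygy {f : L →ₗ[Λ] N₀} {g : N₀ →ₗ[Λ] N₁} {h : N₁ →ₗ[Λ] R}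
    (hN₀ : InAdd Λ N₀ N) (hN₁ : InAdd Λ N₁ N) (hfg : Function.Exact f g)
    (hgh : Function.Exact g h) (hh : Function.Surjective h) (hN : HomToExact N f g h)
    (hNR : InAdd Λ N R) :
    ∃ Y Z : FDMod K Λ, IsCosyzygy N L Y ∧ IsCosyzygy N Y Z ∧ AddEqSum R N Z := by
  obtain ⟨-, -, hex, hsurj⟩ := hN
  obtain ⟨N₀', f', hf'⟩ := exists_minLeftApprox N L
  obtain ⟨N₁', f'', hf''⟩ := exists_minLeftApprox N (cokerMod f')
  let C := cokerMod f
  let q : N₀ →ₗ[Λ] C := (LinearMap.range f).mkQ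
  have hfq : Function.Exact f q := LinearMap.exact_iff.2 (Submodule.ker_mkQ _)
  have hq : Function.Surjective q := Submodule.mkQ_surjective _
  let q' : N₀' →ₗ[Λ] cokerMod f' := (LinearMap.range f').mkQ
  have hfq' : Function.Exact f' q' := LinearMap.exact_iff.2 (Submodule.ker_mkQ _)
  have hq' : Function.Surjective q' := Submodule.mkQ_surjective _
  let q'' : N₁' →ₗ[Λ] cokerMod f'' := (LinearMap.range f'').mkQ
  have hfq'' : Function.Exact f'' q'' := LinearMap.exact_iff.2 (Submodule.ker_mkQ _)
  have hq'' : Function.Surjective q'' := Submodule.mkQ_surjective _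
  obtain ⟨c, hc⟩ := exists_desc_of_exact hq hfq g hfg.apply_apply_eq_zero
  have hcN : ∀ φ : C →ₗ[Λ] N, ∃ ψ : N₁ →ₗ[Λ] N, ψ ∘ₗ c = φ := fun φ => by
    obtain ⟨ψ, hψ⟩ := (hex (φ ∘ₗ q)).1
      (LinearMap.ext fun x => by simp [hfq.apply_apply_eq_zero])
    refine ⟨ψ, LinearMap.ext fun x => ?_⟩
    obtain ⟨y, rfl⟩ := hq x
    rw [LinearMap.comp_apply, hc]
    exact LinearMap.congr_fun hψ y
  have hch : Function.Exact c h := fun x => by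
    rw [hgh x]
    constructor
    · rintro ⟨y, rfl⟩
      exact ⟨q y, hc y⟩
    · rintro ⟨y, rfl⟩
      obtain ⟨y, rfl⟩ := hq y
      exact ⟨y, (hc y).symm⟩
  have h1 : InAdd Λ C (cokerMod f' × N) :=
    InAdd.refl.cokernel hN₀ hf'.1 hsurj hf'.2.1 hfq hq hfq' hq'
  have h2 : InAdd Λ (cokerMod f') (C × N) :=
    InAdd.refl.cokernel hf'.1 hN₀ hf'.2.1 hsurj hfq' hq' hfq hq
  -- The first cokernels agree only up to summands of `N`. The extra `N` is approximated by its
  -- identity, which adds nothing to the second cokernel.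
  have aux : ∀ {C N₁ R : FDMod K Λ} {c : C →ₗ[Λ] N₁} {h : N₁ →ₗ[Λ] R} {X N' S : FDMod K Λ}
      {x : X →ₗ[Λ] N'} {s : N' →ₗ[Λ] S}, InAdd Λ X (C × N) →
      InAdd Λ N₁ N → InAdd Λ N' N → (∀ φ : C →ₗ[Λ] N, ∃ ψ : N₁ →ₗ[Λ] N, ψ ∘ₗ c = φ) →
      (∀ φ : X →ₗ[Λ] N, ∃ ψ : N' →ₗ[Λ] N, ψ ∘ₗ x = φ) → Function.Exact c h →
      Function.Surjective h → Function.Exact x s → Function.Surjective s →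
      InAdd Λ S (R × N) := by
    intro C N₁ R c h X N' S x s hX hN₁ hN' hc hx hch hh hxs hs
    refine InAdd.cokernel (D := prodMod C N) (N₁ := prodMod N₁ N) hX
      (a' := c.prodMap LinearMap.id) (π' := h ∘ₗ LinearMap.fst Λ N₁ N) hN'
      (InAdd.prod hN₁ InAdd.refl) hx (fun φ => ?_) hxs hs (fun y => ?_)
      (hh.comp Prod.fst_surjective)
    · obtain ⟨ψ, hψ⟩ := hc (φ ∘ₗ LinearMap.inl Λ C N)
      refine ⟨ψ.coprod (φ ∘ₗ LinearMap.inr Λ C N), LinearMap.ext fun y => ?_⟩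
      have := LinearMap.congr_fun hψ y.1
      simp only [LinearMap.comp_apply] at this
      rw [LinearMap.comp_apply]
      show ψ (c y.1) + φ (0, y.2) = φ y
      rw [this, LinearMap.inl_apply, ← map_add]
      simp
    · refine (hch y.1).trans ⟨?_, ?_⟩
      · rintro ⟨z, hz⟩
        exact ⟨(z, y.2), Prod.ext hz rfl⟩
      · rintro ⟨z, rfl⟩
        exact ⟨z.1, rfl⟩
  have h3 : InAdd Λ R (cokerMod f'' × N) :=
    aux h1 hf''.1 hN₁ hf''.2.1 hcN hfq'' hq'' hch hh
  have h4 : InAdd Λ (cokerMod f'') (R × N) :=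
    aux h2 hN₁ hf''.1 hcN hf''.2.1 hch hh hfq'' hq''
  refine ⟨cokerMod f', cokerMod f'', ⟨N₀', f', q', hf', hfq', hq'⟩,
    ⟨N₁', f'', q'', hf'', hfq'', hq''⟩, fun Y => ⟨fun hY => ?_, fun hY => ?_⟩⟩
  · exact (hY.trans h3).trans (InAdd.prod InAdd.right_of_prod InAdd.left_of_prod)
  · exact hY.trans (InAdd.prod hNR (h4.trans (InAdd.prod InAdd.refl hNR)))

/-- The left end of a four-term exact sequence on which `Hom(N, -)` is exact. -/
theorem exists_syzygy {f : L →ₗ[Λ] N₀} {g : N₀ →ₗ[Λ] N₁} {h : N₁ →ₗ[Λ] R}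
    (hN₀ : InAdd Λ N₀ N) (hN₁ : InAdd Λ N₁ N) (hf : Function.Injective f)
    (hfg : Function.Exact f g) (hgh : Function.Exact g h) (hN : HomFromExact N f g h)
    (hNL : InAdd Λ N L) :
    ∃ Y Z : FDMod K Λ, IsSyzygy N R Y ∧ IsSyzygy N Y Z ∧ AddEqSum L N Z := by
  obtain ⟨-, -, hex, hsurj⟩ := hN
  obtain ⟨N₁', f', hf'⟩ := exists_minRightApprox N R
  obtain ⟨N₀', f'', hf''⟩ := exists_minRightApprox N (kerMod f')
  let C := kerMod h
  let q : C →ₗ[Λ] N₁ := (LinearMap.ker h).subtype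
  have hfq : Function.Exact q h := LinearMap.exact_iff.2 (Submodule.range_subtype _).symm
  have hq : Function.Injective q := Subtype.val_injective
  let q' : kerMod f' →ₗ[Λ] N₁' := (LinearMap.ker f').subtype
  have hfq' : Function.Exact q' f' := LinearMap.exact_iff.2 (Submodule.range_subtype _).symm
  have hq' : Function.Injective q' := Subtype.val_injective
  let q'' : kerMod f'' →ₗ[Λ] N₀' := (LinearMap.ker f'').subtype
  have hfq'' : Function.Exact q'' f'' := LinearMap.exact_iff.2 (Submodule.range_subtype _).symm
  have hq'' : Function.Injective q'' := Subtype.val_injective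
  obtain ⟨c, hc⟩ := exists_lift_of_exact hq hfq g hgh.apply_apply_eq_zero
  have hcN : ∀ φ : N →ₗ[Λ] C, ∃ ψ : N →ₗ[Λ] N₀, c ∘ₗ ψ = φ := fun φ => by
    obtain ⟨ψ, hψ⟩ := (hex (q ∘ₗ φ)).1
      (LinearMap.ext fun x => hfq.apply_apply_eq_zero (φ x))
    exact ⟨ψ, LinearMap.ext fun x => hq ((hc _).trans (LinearMap.congr_fun hψ x))⟩
  have hch : Function.Exact f c := fun x => by
    rw [← hfg x, ← hc x]
    exact ⟨fun h => by rw [h, map_zero], fun h => hq (h.trans (map_zero q).symm)⟩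
  have h1 : InAdd Λ C (kerMod f' × N) :=
    InAdd.refl.kernel hN₁ hf'.1 hsurj hf'.2.1 hfq hq hfq' hq'
  have h2 : InAdd Λ (kerMod f') (C × N) :=
    InAdd.refl.kernel hf'.1 hN₁ hf'.2.1 hsurj hfq' hq' hfq hq
  have aux : ∀ {C N₁ R : FDMod K Λ} {c : N₁ →ₗ[Λ] C} {h : R →ₗ[Λ] N₁} {X N' S : FDMod K Λ}
      {x : N' →ₗ[Λ] X} {s : S →ₗ[Λ] N'}, InAdd Λ X (C × N) →
      InAdd Λ N₁ N → InAdd Λ N' N → (∀ φ : N →ₗ[Λ] C, ∃ ψ : N →ₗ[Λ] N₁, c ∘ₗ ψ = φ) →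
      (∀ φ : N →ₗ[Λ] X, ∃ ψ : N →ₗ[Λ] N', x ∘ₗ ψ = φ) → Function.Exact h c →
      Function.Injective h → Function.Exact s x → Function.Injective s →
      InAdd Λ S (R × N) := by
    intro C N₁ R c h X N' S x s hX hN₁ hN' hc hx hch hh hxs hs
    refine InAdd.kernel (D := prodMod C N) (N₁ := prodMod N₁ N) hX
      (a' := c.prodMap LinearMap.id) (ι' := LinearMap.inl Λ N₁ N ∘ₗ h) hN'
      (InAdd.prod hN₁ InAdd.refl) hx (fun φ => ?_) hxs hs (fun y => ?_)
      (LinearMap.inl_injective.comp hh)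
    · obtain ⟨ψ, hψ⟩ := hc (LinearMap.fst Λ C N ∘ₗ φ)
      refine ⟨ψ.prod (LinearMap.snd Λ C N ∘ₗ φ), LinearMap.ext fun y => Prod.ext ?_ rfl⟩
      exact LinearMap.congr_fun hψ y
    · constructor
      · intro hy
        obtain ⟨h1, h2⟩ := Prod.ext_iff.1 hy
        obtain ⟨z, hz⟩ := (hch y.1).1 h1
        exact ⟨z, Prod.ext hz h2.symm⟩
      · rintro ⟨z, rfl⟩
        exact Prod.ext (hch.apply_apply_eq_zero z) rfl
  have h3 : InAdd Λ L (kerMod f'' × N) :=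
    aux h1 hf''.1 hN₀ hf''.2.1 hcN hfq'' hq'' hch hf
  have h4 : InAdd Λ (kerMod f'') (L × N) :=
    aux h2 hN₀ hf''.1 hcN hf''.2.1 hch hf hfq'' hq''
  refine ⟨kerMod f', kerMod f'', ⟨N₁', q', f', hf', hfq', hq'⟩,
    ⟨N₀', q'', f'', hf'', hfq'', hq''⟩, fun Y => ⟨fun hY => ?_, fun hY => ?_⟩⟩
  · exact (hY.trans h3).trans (InAdd.prod InAdd.right_of_prod InAdd.left_of_prod)
  · exact hY.trans (InAdd.prod hNL (h4.trans (InAdd.prod InAdd.refl hNL)))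

end Syzygies

/-! ## The functors `(-, M)` and `D(M, -)` -/

section Functors

variable {M X Y Z : FDMod K Λ}

/-- The functor `(-, M)` on maps. -/
def homMap (M : FDMod K Λ) (f : X →ₗ[Λ] Y) : homMod Y M →ₗ[endAlg M] homMod X M where
  toFun y := (show Y →ₗ[Λ] M from y) ∘ₗ f
  map_add' _ _ := rfl
  map_smul' _ _ := rfl

/-- The functor `D(M, -)` on maps. -/
def dualHomMap (M : FDMod K Λ) (f : X →ₗ[Λ] Y) : dualHomMod M Y →ₗ[endAlg M] dualHomMod M X where
  toFun χ := (show Module.Dual K (M →ₗ[Λ] Y) from χ) ∘ₗ postHom M f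
  map_add' _ _ := rfl
  map_smul' _ _ := rfl

/-- An endomorphism of `M` as an element of the endomorphism algebra. -/
def toEnd (s : M →ₗ[Λ] M) : endAlg M := s

theorem homMod_map_comp {V : FDMod K (endAlg M)} (θ : homMod X M →ₗ[endAlg M] V)
    (s : M →ₗ[Λ] M) (y : X →ₗ[Λ] M) :
    θ (show homMod X M from s ∘ₗ y) = toEnd s • θ (show homMod X M from y) :=
  θ.map_smul (toEnd s) y

/-- The bilinear form on `(X, M) × (M, Y)` given by a map `(X, M) → D(M, Y)`. -/
def formOf (θ : homMod X M →ₗ[endAlg M] dualHomMod M Y) :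
    (X →ₗ[Λ] M) →ₗ[K] Module.Dual K (M →ₗ[Λ] Y) where
  toFun y := θ y
  map_add' := θ.map_add
  map_smul' c y := LinearMap.map_smul_of_tower θ c (show homMod X M from y)

theorem formOf_comp (θ : homMod X M →ₗ[endAlg M] dualHomMod M Y) (s : M →ₗ[Λ] M)
    (y : X →ₗ[Λ] M) (h : M →ₗ[Λ] Y) : formOf θ (s ∘ₗ y) h = formOf θ y (h ∘ₗ s) :=
  LinearMap.congr_fun (f := (show Module.Dual K (M →ₗ[Λ] Y) from θ (show homMod X M from s ∘ₗ y)))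
    (homMod_map_comp θ s y) h

/-- Evaluation `(X, M) → M` at an element of `X`. -/
def evMap (M : FDMod K Λ) (x : X) : homMod X M →ₗ[endAlg M] overEnd M where
  toFun y := (show X →ₗ[Λ] M from y) x
  map_add' _ _ := rfl
  map_smul' _ _ := rfl

/-- The map `M → D(M, X)` given by a functional on `X`. -/
def coevMap (M : FDMod K Λ) : Module.Dual K X →ₗ[K] (overEnd M →ₗ[endAlg M] dualHomMod M X) where
  toFun ζ :=
    { toFun := fun m => ζ ∘ₗ evalAt (show M from m) X
      map_add' := fun m m' => LinearMap.ext fun h =>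
        (congrArg ζ ((show M →ₗ[Λ] X from h).map_add m m')).trans (ζ.map_add _ _)
      map_smul' := fun _ _ => rfl }
  map_add' _ _ := rfl
  map_smul' _ _ := rfl

/-- Multiplication by an element of `Λ` as an `End(M)`-linear map. -/
def mulMap (M : FDMod K Λ) (r : Λ) : overEnd M →ₗ[endAlg M] overEnd M where
  toFun m := r • (show M from m)
  map_add' m m' := smul_add r (show M from m) m'
  map_smul' s m := ((show M →ₗ[Λ] M from s).map_smul r m).symm

/-- `X` is `M`-reflexive: evaluation `X → ((X, M), M)` is bijective. -/
def Reflexive (M X : FDMod K Λ) : Prop :=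
  (∀ x : X, (∀ y : X →ₗ[Λ] M, y x = 0) → x = 0) ∧
    ∀ φ : homMod X M →ₗ[endAlg M] overEnd M, ∃ x : X, φ = evMap M x

/-- `X` is `M`-coreflexive: coevaluation `DX → (M, D(M, X))` is bijective. -/
def Coreflexive (M X : FDMod K Λ) : Prop :=
  (∀ ζ : Module.Dual K X, (∀ (m : M) (h : M →ₗ[Λ] X), ζ (h m) = 0) → ζ = 0) ∧
    ∀ φ : overEnd M →ₗ[endAlg M] dualHomMod M X, ∃ ζ : Module.Dual K X, φ = coevMap M ζ

theorem InAdd.homMap (h : InAdd Λ X Y) (M : FDMod K Λ) :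
    InAdd (endAlg M) (homMod X M) (homMod Y M) := by
  obtain ⟨n, a, b, hab, -⟩ := h.exists_comp
  refine InAdd.of_sum (fun i => RelFB.homMap M (b i)) (fun i => RelFB.homMap M (a i)) fun y => ?_
  exact hab (show X →ₗ[Λ] M from y)

theorem InAdd.dualHomMap (h : InAdd Λ X Y) (M : FDMod K Λ) :
    InAdd (endAlg M) (dualHomMod M X) (dualHomMod M Y) := by
  obtain ⟨n, a, b, -, hab⟩ := h.exists_comp
  refine InAdd.of_sum (fun i => RelFB.dualHomMap M (b i)) (fun i => RelFB.dualHomMap M (a i))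
    fun χ => LinearMap.ext fun f => ?_
  have h1 : (show Module.Dual K (M →ₗ[Λ] X) from χ) f =
      ∑ i, (show Module.Dual K (M →ₗ[Λ] X) from χ) (a i ∘ₗ b i ∘ₗ f) := by
    rw [← map_sum, hab]
  refine Eq.trans ?_ h1.symm
  exact LinearMap.sum_apply (M₂ := K) _ _ f

/-- `(Λ, M) ≅ M`. -/
def homRegEquiv (M : FDMod K Λ) : homMod (regMod Λ) M ≃ₗ[endAlg M] overEnd M where
  toFun y := (show regMod Λ →ₗ[Λ] M from y) (regOne Λ)
  map_add' _ _ := rfl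
  map_smul' _ _ := rfl
  invFun m := regMap (show M from m)
  left_inv y := regMap_map_one (show regMod Λ →ₗ[Λ] M from y)
  right_inv m := regMap_one (show M from m)

/-- `D(M, DΛ) ≅ M`. -/
def dualHomRegEquiv (M : FDMod K Λ) : overEnd M ≃ₗ[endAlg M] dualHomMod M (dualReg Λ) :=
  LinearEquiv.ofBijective
    ({
      toFun := fun m =>
        ({ toFun := fun f => evalOne f (show M from m)
           map_add' := fun _ _ => rfl
           map_smul' := fun _ _ => rfl } : Module.Dual K (M →ₗ[Λ] dualReg Λ))
      map_add' := fun m m' => LinearMap.ext fun f => (evalOne (X := M) f).map_add _ _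
      map_smul' := fun _ _ => rfl } : overEnd M →ₗ[endAlg M] dualHomMod M (dualReg Λ))
    ⟨fun m m' h => eq_of_dual (K := K) (V := M) fun ζ => by
      have := LinearMap.congr_fun (f := (show Module.Dual K (M →ₗ[Λ] dualReg Λ) from _)) h
        (dualMap ζ)
      have h1 : ∀ x : M, evalOne (dualMap ζ) x = ζ x := fun x => by
        rw [evalOne_apply, dualMap_apply, one_smul]
      exact (h1 _).symm.trans (this.trans (h1 _)),
    fun χ => by
      let ξ : Module.Dual K (Module.Dual K M) :=
        (show Module.Dual K (M →ₗ[Λ] dualReg Λ) from χ) ∘ₗ dualMapₗ M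
      refine ⟨(Module.evalEquiv K M).symm ξ, LinearMap.ext fun f => ?_⟩
      refine (Module.apply_evalEquiv_symm_apply K M (evalOne f) ξ).trans ?_
      exact congrArg (show Module.Dual K (M →ₗ[Λ] dualReg Λ) from χ) (dualMap_evalOne f)⟩

/-- The regular `End(M)`-module is `(M, M)`, and `(-, M)` preserves additive closures. -/
theorem inAdd_regMod_endAlg (h : InAdd Λ M X) :
    InAdd (endAlg M) (regMod (endAlg M)) (homMod X M) :=
  InAdd.of_equiv (X := homMod M M)
    { toFun := fun y => y, map_add' := fun _ _ => rfl, map_smul' := fun _ _ => rfl,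
      invFun := fun y => y, left_inv := fun _ => rfl, right_inv := fun _ => rfl } (h.homMap M)

theorem inAdd_dualReg_endAlg (h : InAdd Λ M X) :
    InAdd (endAlg M) (dualReg (endAlg M)) (dualHomMod M X) :=
  InAdd.of_equiv (X := dualHomMod M M)
    { toFun := fun y => y, map_add' := fun _ _ => rfl, map_smul' := fun _ _ => rfl,
      invFun := fun y => y, left_inv := fun _ => rfl, right_inv := fun _ => rfl } (h.dualHomMap M)

theorem inAdd_overEnd_homMod (h : InAdd Λ (regMod Λ) X) :
    InAdd (endAlg M) (overEnd M) (homMod X M) :=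
  (h.homMap M).of_equiv (homRegEquiv M)

theorem inAdd_overEnd_dualHomMod (h : InAdd Λ (dualReg Λ) X) :
    InAdd (endAlg M) (overEnd M) (dualHomMod M X) :=
  (h.dualHomMap M).of_equiv (dualHomRegEquiv M).symm

/-- `(B, M)` corresponds to `D(M, B)` under the Nakayama functor if `B ∈ add(M)`. -/
theorem exists_nakData_homMod {B : FDMod K Λ} (hB : InAdd Λ B M) :
    ∃ D : NakData (homMod B M) (dualHomMod M B),
      ∀ (α : B →ₗ[Λ] M) (ψ : Module.Dual K (endAlg M)),
        D.toHom α ψ = (show Module.Dual K (M →ₗ[Λ] M) from ψ) ∘ₗ postHom M α := by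
  obtain ⟨n, a, b, h₁, h₂⟩ := hB.exists_comp
  let Φ : homMod B M →ₗ[endAlg M] nuInv (dualHomMod M B) :=
    { toFun := fun α =>
        ({ toFun := fun ψ => (show Module.Dual K (M →ₗ[Λ] M) from ψ) ∘ₗ
             postHom M (show B →ₗ[Λ] M from α)
           map_add' := fun _ _ => rfl
           map_smul' := fun _ _ => rfl } : dualReg (endAlg M) →ₗ[endAlg M] dualHomMod M B)
      map_add' := fun α α' => LinearMap.ext fun ψ => LinearMap.ext fun f =>
        (show Module.Dual K (M →ₗ[Λ] M) from ψ).map_add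
          (postHom M (show B →ₗ[Λ] M from α) f) (postHom M (show B →ₗ[Λ] M from α') f)
      map_smul' := fun _ _ => rfl }
  refine ⟨{ n := n, p := b, Φ := Φ
            c := fun i =>
              { toFun := fun α => (show B →ₗ[Λ] M from α) ∘ₗ a i
                map_add' := fun _ _ => rfl
                map_smul' := fun _ _ => rfl }
            b := fun i =>
              { toFun := fun χ => (show Module.Dual K (M →ₗ[Λ] B) from χ) ∘ₗ postHom M (a i)
                map_add' := fun _ _ => rfl
                map_smul' := fun _ _ => rfl }
            sum_Φ := fun χ => LinearMap.ext fun f => ?_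
            sum_c := fun α => h₁ (show B →ₗ[Λ] M from α)
            b_Φ := fun _ _ _ => rfl }, fun _ _ => rfl⟩
  refine (LinearMap.sum_apply (M₂ := K) _ _ f).trans ?_
  exact (map_sum (show Module.Dual K (M →ₗ[Λ] B) from χ) (fun i => a i ∘ₗ b i ∘ₗ f)
    Finset.univ).symm.trans (congrArg (show Module.Dual K (M →ₗ[Λ] B) from χ) (h₂ f))

end Functors

/-! ### Reflexivity, and transfer of `ARSeq` and `Star` to the endomorphism algebra. -/

section Sequences

variable {M X A B H : FDMod K Λ}

/-- Modules in `add(M)` are separated by maps to `M`. -/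
theorem InAdd.eq_zero (hX : InAdd Λ X M) {x : X} (h : ∀ y : X →ₗ[Λ] M, y x = 0) : x = 0 := by
  obtain ⟨n, a, b, hab⟩ := hX.exists_sum
  rw [← hab x]
  exact Finset.sum_eq_zero fun i _ => by rw [h, map_zero]

/-- Modules in `add(M)` are reflexive. -/
theorem InAdd.reflexive (hX : InAdd Λ X M) : Reflexive M X := by
  refine ⟨fun x => hX.eq_zero, fun φ => ?_⟩
  obtain ⟨n, a, b, h₁, h₂⟩ := hX.exists_comp
  let z : Fin n → M := fun i => φ (show homMod X M from b i)
  refine ⟨∑ i, a i (z i), LinearMap.ext fun y => ?_⟩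
  have h3 : φ y = ∑ i, φ (show homMod X M from ((show X →ₗ[Λ] M from y) ∘ₗ a i) ∘ₗ b i) :=
    (congrArg φ (h₁ (show X →ₗ[Λ] M from y)).symm).trans (map_sum φ _ _)
  rw [h3]
  refine Eq.trans (Finset.sum_congr rfl fun i _ => homMod_map_comp φ _ _) ?_
  exact (map_sum (show X →ₗ[Λ] M from y) (fun i => a i (z i)) Finset.univ).symm

/-- A module with a suitable copresentation in `add(M)` is reflexive. -/
theorem reflexive_of_copresentation (hA : InAdd Λ A M) (hB : InAdd Λ B M) {f : X →ₗ[Λ] A}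
    {g : A →ₗ[Λ] B} (hf : Function.Injective f) (hfg : Function.Exact f g)
    (hfM : ∀ φ : X →ₗ[Λ] M, ∃ ψ : A →ₗ[Λ] M, ψ ∘ₗ f = φ) : Reflexive M X := by
  refine ⟨fun x hx => hf ?_, fun φ => ?_⟩
  · rw [map_zero]
    exact hA.eq_zero fun y => hx (y ∘ₗ f)
  -- Pulled back to `(A, M)`, the map `φ` is evaluation at some `a`. Maps to `M` separate the points
  -- of `B`, which gives `g a = 0`, so `a` comes from `X`.
  · obtain ⟨a, ha⟩ := hA.reflexive.2 (φ ∘ₗ homMap M f)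
    have ha' : ∀ y : A →ₗ[Λ] M, φ (show homMod X M from y ∘ₗ f) = y a := LinearMap.congr_fun ha
    obtain ⟨x, rfl⟩ := (hfg a).1 (hB.eq_zero fun y => by
      have h1 := ha' (y ∘ₗ g)
      have h2 : (y ∘ₗ g) ∘ₗ f = 0 := LinearMap.ext fun x => by simp [hfg.apply_apply_eq_zero]
      rw [h2] at h1
      exact h1.symm.trans (map_zero φ))
    refine ⟨x, LinearMap.ext fun y => ?_⟩
    obtain ⟨y', hy'⟩ := hfM y
    have h1 := ha' y'
    rw [hy'] at h1
    exact h1.trans (LinearMap.congr_fun hy' x)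

/-- The bilinear form on `M × (M, Y)` given by a map `M → D(M, Y)`. -/
def coevForm (φ : overEnd M →ₗ[endAlg M] dualHomMod M X) :
    M →ₗ[K] Module.Dual K (M →ₗ[Λ] X) where
  toFun m := φ m
  map_add' := φ.map_add
  map_smul' c m := LinearMap.map_smul_of_tower φ c (show overEnd M from m)

theorem coevForm_comp (φ : overEnd M →ₗ[endAlg M] dualHomMod M X) (s : M →ₗ[Λ] M) (m : M)
    (h : M →ₗ[Λ] X) : coevForm φ (s m) h = coevForm φ m (h ∘ₗ s) :=
  LinearMap.congr_fun (f := (show Module.Dual K (M →ₗ[Λ] X) from φ (show overEnd M from s m)))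
    (φ.map_smul (toEnd s) (show overEnd M from m)) h

/-- A module with a suitable presentation in `add(M)` is coreflexive. -/
theorem coreflexive_of_presentation (hA : InAdd Λ A M) (hB : InAdd Λ B M) {μ : A →ₗ[Λ] B}
    {p : B →ₗ[Λ] H} (hp : Function.Surjective p) (hμp : Function.Exact μ p)
    (hpM : ∀ φ : M →ₗ[Λ] H, ∃ ψ : M →ₗ[Λ] B, p ∘ₗ ψ = φ) : Coreflexive M H := by
  obtain ⟨n, a, b, h₁, h₂⟩ := hB.exists_comp
  obtain ⟨l, c, e, h₃⟩ := hA.exists_sum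
  refine ⟨fun ζ hζ => LinearMap.ext fun x => ?_, fun φ => ?_⟩
  · obtain ⟨y, rfl⟩ := hp x
    have h5 : ∑ i, a i (b i y) = y := by
      have := LinearMap.congr_fun (h₂ LinearMap.id) y
      rw [LinearMap.sum_apply] at this
      exact this
    rw [← h5, map_sum, map_sum]
    exact Finset.sum_eq_zero fun i _ => hζ (b i y) (p ∘ₗ a i)
  -- A dual basis of `B` turns `φ` into a functional on `B` that does not depend on the basis, by
  -- `hζ₀`. It vanishes on the image of `A ∈ add(M)`, so it descends to `H`.
  · let ζ₀ : Module.Dual K B :=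
      ∑ i, (coevForm φ).flip (p ∘ₗ a i) ∘ₗ (b i).restrictScalars K
    have hζ₀ : ∀ (k : M →ₗ[Λ] B) (m : M), ζ₀ (k m) = coevForm φ m (p ∘ₗ k) := fun k m => by
      have h5 : ζ₀ (k m) = ∑ i, coevForm φ ((b i ∘ₗ k) m) (p ∘ₗ a i) := by
        simp only [ζ₀, LinearMap.sum_apply]
        rfl
      simp only [h5, coevForm_comp]
      rw [← map_sum]
      congr 1
      simp only [LinearMap.comp_assoc]
      rw [← comp_sum', h₂]
    obtain ⟨ζ, hζ⟩ := exists_dual_desc (p.restrictScalars K) hp ζ₀ fun y hy => by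
      obtain ⟨x, rfl⟩ := (hμp y).1 hy
      rw [← h₃ x, map_sum, map_sum]
      refine Finset.sum_eq_zero fun i _ => (hζ₀ (μ ∘ₗ c i) (e i x)).trans ?_
      have h6 : p ∘ₗ μ ∘ₗ c i = 0 := LinearMap.ext fun z => hμp.apply_apply_eq_zero _
      rw [h6, map_zero]
    refine ⟨ζ, LinearMap.ext fun m => LinearMap.ext fun h => ?_⟩
    obtain ⟨k, rfl⟩ := hpM h
    exact ((hζ (k m)).trans (hζ₀ k m)).symm

/-- Four-term exact sequences `0 → X → A → B → H → 0` with `A, B ∈ add(M)` on which `(M, -)` and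
`(-, M)` are exact, with a lifting condition for maps `X → H`. -/
structure BiexactSeq (M : FDMod K Λ) {X A B H : FDMod K Λ} (j : X →ₗ[Λ] A) (μ : A →ₗ[Λ] B)
    (p : B →ₗ[Λ] H) : Prop where
  injective : Function.Injective j
  exact_left : Function.Exact j μ
  exact_right : Function.Exact μ p
  surjective : Function.Surjective p
  mem_left : InAdd Λ A M
  mem_right : InAdd Λ B M
  to_right : ∀ φ : M →ₗ[Λ] H, ∃ ψ : M →ₗ[Λ] B, p ∘ₗ ψ = φ
  to_left : ∀ φ : M →ₗ[Λ] B, p ∘ₗ φ = 0 → ∃ ψ : M →ₗ[Λ] A, μ ∘ₗ ψ = φ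
  from_left : ∀ φ : X →ₗ[Λ] M, ∃ ψ : A →ₗ[Λ] M, ψ ∘ₗ j = φ
  from_right : ∀ φ : A →ₗ[Λ] M, φ ∘ₗ j = 0 → ∃ ψ : B →ₗ[Λ] M, ψ ∘ₗ μ = φ
  lift : ∀ κ : X →ₗ[Λ] H, ∃ ν : A →ₗ[Λ] B, p ∘ₗ ν ∘ₗ j = κ
  lift_zero : ∀ ν : A →ₗ[Λ] B, p ∘ₗ ν ∘ₗ j = 0 →
    ∃ (ν₁ : B →ₗ[Λ] B) (ν₂ : A →ₗ[Λ] A), ν = ν₁ ∘ₗ μ + μ ∘ₗ ν₂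

namespace BiexactSeq

variable {j : X →ₗ[Λ] A} {μ : A →ₗ[Λ] B} {p : B →ₗ[Λ] H}

theorem reflexive (h : BiexactSeq M j μ p) : Reflexive M X :=
  reflexive_of_copresentation h.mem_left h.mem_right h.injective h.exact_left h.from_left

theorem coreflexive (h : BiexactSeq M j μ p) : Coreflexive M H :=
  coreflexive_of_presentation h.mem_left h.mem_right h.surjective h.exact_right h.to_right

/-- Applying `(-, M)` gives `(B, M) → (A, M) → (X, M) → 0`, and `D(M, -)` gives `0 → D(M, H) → D(M,
B) → D(M, A)`. For `A` and `B` in `add(M)` the two functors differ by the Nakayama functor, so this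
is a matching pair of presentation and copresentation. -/
theorem arSeq (h : BiexactSeq M j μ p) : ARSeq (homMod X M) (dualHomMod M H) := by
  obtain ⟨D₀, h₀⟩ := exists_nakData_homMod h.mem_right
  obtain ⟨D₁, h₁⟩ := exists_nakData_homMod h.mem_left
  refine ARSeq.of_copresentation D₀ D₁ (homMap M μ) (homMap M j) (dualHomMap M p)
    (dualHomMap M μ) (fun α ψ => ?_) (fun y => ?_) (fun y => h.from_left y) (fun χ χ' hχ => ?_)
    (fun χ => ?_)
  · refine (h₁ ((show B →ₗ[Λ] M from α) ∘ₗ μ) ψ).trans ?_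
    exact (congrArg (dualHomMap M μ) (h₀ α ψ)).symm
  · refine ⟨fun hy => h.from_right y hy, ?_⟩
    rintro ⟨z, rfl⟩
    refine LinearMap.ext fun x => ?_
    exact (congrArg (show B →ₗ[Λ] M from z) (h.exact_left.apply_apply_eq_zero x)).trans
      (map_zero _)
  · refine LinearMap.ext fun f => ?_
    obtain ⟨f, rfl⟩ := h.to_right f
    exact LinearMap.congr_fun (f := (show Module.Dual K (M →ₗ[Λ] B) from dualHomMap M p χ)) hχ f
  · constructor
    · intro hχ
      obtain ⟨η, hη⟩ := exists_dual_desc (postHom M p) h.to_right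
        (show Module.Dual K (M →ₗ[Λ] B) from χ) fun f hf => by
          obtain ⟨g, rfl⟩ := h.to_left f hf
          exact LinearMap.congr_fun
            (f := (show Module.Dual K (M →ₗ[Λ] A) from dualHomMap M μ χ)) hχ g
      exact ⟨η, LinearMap.ext hη⟩
    · rintro ⟨η, rfl⟩
      refine LinearMap.ext fun g => ?_
      have : p ∘ₗ μ ∘ₗ g = 0 := LinearMap.ext fun x => h.exact_right.apply_apply_eq_zero _
      exact (congrArg (show Module.Dual K (M →ₗ[Λ] H) from η) this).trans (map_zero _)

/-- Through `T`, maps `(X, M) → D(M, H)` become functionals on `(A, B)` vanishing on all `ν₁ μ + μ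
ν₂`. The fields `lift` and `lift_zero` identify the corresponding quotient of `(A, B)` with `(X,
H)`. On the other side, reflexivity of `X` and coreflexivity of `H` turn a balanced form into a
`Λ`-linear map `X → H`. -/
theorem star (h : BiexactSeq M j μ p) :
    Star (overEnd M) (homMod X M) (dualHomMod M H) := by
  obtain ⟨n, a, b, h₁, h₂⟩ := h.mem_right.exists_comp
  obtain ⟨l, c, e, h₃, h₄⟩ := h.mem_left.exists_comp
  -- The functional `T θ` is characterized by `hT₂`: it sends a composite `A → M → B` to the value
  -- of `θ` at its two factors, restricted along `j` and composed with `p`.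
  let T : (homMod X M →ₗ[endAlg M] dualHomMod M H) →ₗ[K] Module.Dual K (A →ₗ[Λ] B) :=
    LinearMap.mk₂ K (fun θ ν => ∑ i, formOf θ (b i ∘ₗ ν ∘ₗ j) (p ∘ₗ a i))
      (fun θ θ' ν => Finset.sum_add_distrib)
      (fun k θ ν => (Finset.smul_sum (r := k)
        (f := fun i => formOf θ (b i ∘ₗ ν ∘ₗ j) (p ∘ₗ a i))).symm)
      (fun θ ν ν' => by
        simp only [LinearMap.add_comp, LinearMap.comp_add, map_add, LinearMap.add_apply]
        exact Finset.sum_add_distrib)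
      (fun k θ ν => by
        rw [Finset.smul_sum]
        refine Finset.sum_congr rfl fun i _ => ?_
        have : b i ∘ₗ (k • ν) ∘ₗ j = k • (b i ∘ₗ ν ∘ₗ j) :=
          LinearMap.ext fun x => LinearMap.map_smul_of_tower (b i) k _
        rw [this, map_smul, LinearMap.smul_apply])
  have hT : ∀ θ ν, T θ ν = ∑ i, formOf θ (b i ∘ₗ ν ∘ₗ j) (p ∘ₗ a i) := fun _ _ => rfl
  have hT₂ : ∀ θ (y : A →ₗ[Λ] M) (k : M →ₗ[Λ] B),
      T θ (k ∘ₗ y) = formOf θ (y ∘ₗ j) (p ∘ₗ k) := fun θ y k => by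
    rw [hT]
    have h5 : ∀ i, formOf θ (b i ∘ₗ (k ∘ₗ y) ∘ₗ j) (p ∘ₗ a i) =
        formOf θ (y ∘ₗ j) (p ∘ₗ a i ∘ₗ b i ∘ₗ k) := fun i => formOf_comp θ (b i ∘ₗ k) (y ∘ₗ j) _
    rw [Finset.sum_congr rfl fun i _ => h5 i, ← map_sum, ← comp_sum', h₂]
  have hT₃ : ∀ (ζ : Module.Dual K H) (x : X) (ν : A →ₗ[Λ] B),
      T (coevMap M ζ ∘ₗ evMap M x) ν = ζ (p (ν (j x))) := fun ζ x ν => by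
    rw [hT]
    have h5 : ∀ i, formOf (coevMap M ζ ∘ₗ evMap M x) (b i ∘ₗ ν ∘ₗ j) (p ∘ₗ a i) =
        ζ ((p ∘ₗ a i ∘ₗ b i ∘ₗ ν) (j x)) := fun i => rfl
    rw [Finset.sum_congr rfl fun i _ => h5 i, ← map_sum, ← LinearMap.sum_apply, ← comp_sum', h₂]
    rfl
  refine ⟨fun ξ hξ => ?_, fun β hβ => ?_⟩
  · have hinj : Function.Injective T := (injective_iff_map_eq_zero T).2 fun θ hθ =>
      LinearMap.ext fun y => LinearMap.ext fun k => by
        obtain ⟨y', hy⟩ := h.from_left y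
        obtain ⟨k', hk⟩ := h.to_right k
        have h5 := hT₂ θ y' k'
        rw [hθ, hy, hk] at h5
        exact h5.symm
    -- As `T` is injective, `ξ` is evaluation of `T` at some `ν : A → B`.
    obtain ⟨η, hη⟩ := exists_dual_extend T hinj ξ
    set ν := (Module.evalEquiv K (A →ₗ[Λ] B)).symm η with hν
    have hξν : ∀ θ, ξ θ = T θ ν := fun θ => by
      rw [← hη]
      exact (Module.apply_evalEquiv_symm_apply K (A →ₗ[Λ] B) (T θ) η).symm
    -- Testing `ξ` on composites `(X, M) → M → D(M, H)` of an evaluation and a coevaluation computes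
    -- `ζ (p ν j x)`, so the hypothesis on `ξ` says `p ν j = 0`.
    obtain ⟨ν₁, ν₂, hν₁₂⟩ := h.lift_zero ν <| LinearMap.ext fun x => eq_zero_of_dual fun ζ => by
      have h5 := hξ (evMap M x) (coevMap M ζ)
      rw [hξν, hT₃] at h5
      exact h5
    ext θ
    rw [hξν, hν₁₂, map_add, LinearMap.zero_apply, hT]
    have h5 : ∀ i, b i ∘ₗ (ν₁ ∘ₗ μ) ∘ₗ j = 0 := fun i => LinearMap.ext fun x => by
      simp [h.exact_left.apply_apply_eq_zero]
    simp only [h5, map_zero, LinearMap.zero_apply, Finset.sum_const_zero, zero_add]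
    have h6 : μ ∘ₗ ν₂ = ∑ i, (μ ∘ₗ c i) ∘ₗ e i ∘ₗ ν₂ := by
      simp only [← LinearMap.comp_assoc _ _ (μ ∘ₗ c _)]
      rw [← sum_comp', h₃]
    rw [h6, map_sum]
    refine Finset.sum_eq_zero fun i _ => ?_
    have h7 : p ∘ₗ μ ∘ₗ c i = 0 := LinearMap.ext fun x => h.exact_right.apply_apply_eq_zero _
    rw [hT₂, h7, map_zero]
  -- Restricting `β` to evaluations and coevaluations gives a pairing of `X` with `DH`, hence a map
  -- `X → H`. Balancedness against multiplication by elements of `Λ` makes it `Λ`-linear.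
  · let κ₀ : X → H := fun x =>
      (Module.evalEquiv K H).symm (β (evMap M x) ∘ₗ coevMap M)
    have hκ₀ : ∀ x (ζ : Module.Dual K H), ζ (κ₀ x) = β (evMap M x) (coevMap M ζ) := fun x ζ =>
      Module.apply_evalEquiv_symm_apply K H ζ _
    let κ : X →ₗ[Λ] H :=
      { toFun := κ₀
        map_add' := fun x x' => eq_of_dual (K := K) (v := κ₀ (x + x')) (w := κ₀ x + κ₀ x') fun ζ => by
          have h5 : evMap M (x + x') = evMap M x + evMap M x' :=
            LinearMap.ext fun y => (show X →ₗ[Λ] M from y).map_add x x'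
          rw [map_add, hκ₀, hκ₀, hκ₀, h5, map_add, LinearMap.add_apply]
        map_smul' := fun r x => eq_of_dual (K := K) (v := κ₀ (r • x)) (w := r • κ₀ x) fun ζ => by
          have h5 : evMap M (r • x) = mulMap M r ∘ₗ evMap M x :=
            LinearMap.ext fun y => (show X →ₗ[Λ] M from y).map_smul r x
          have h6 : coevMap M ζ ∘ₗ mulMap M r = coevMap M (ζ ∘ₗ DistribSMul.toLinearMap K H r) :=
            LinearMap.ext fun m => LinearMap.ext fun f =>
              congrArg ζ ((show M →ₗ[Λ] H from f).map_smul r m)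
          rw [hκ₀, h5, hβ, h6, ← hκ₀]
          rfl }
    obtain ⟨ν, hν⟩ := h.lift κ
    refine ⟨T.flip ν, fun φ k => ?_⟩
    obtain ⟨x, rfl⟩ := h.reflexive.2 φ
    obtain ⟨ζ, rfl⟩ := h.coreflexive.2 k
    rw [LinearMap.flip_apply, hT₃, ← hκ₀]
    exact congrArg ζ (LinearMap.congr_fun hν x).symm

/-- The main transfer statement: `M`, as a module over its endomorphism algebra, is `1`-faithful for
the relative structures given by `(X, M)` and `D(M, H)`, which coincide. -/
theorem oneFaithful (h : BiexactSeq M j μ p) (hX : InAdd Λ M X) (hH : InAdd Λ M H) :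
    OneFaithful (upperF (dualHomMod M H)) (overEnd M) := fun P hP => by
  rw [← h.arSeq.lowerF_eq] at hP
  exact (h.star.of_inAdd (hP.inAdd (inAdd_regMod_endAlg hX))).cogen₁ (inAdd_dualReg_endAlg hH)

end BiexactSeq

end Sequences

/-! ### Construction of biexact sequences. -/

section Sequences

variable {M N X Y A B C G H T L R : FDMod K Λ}

theorem InAdd.extend_zero (hN : InAdd Λ N M) (j : X →ₗ[Λ] A) (μ : A →ₗ[Λ] B)
    (h : ∀ φ : A →ₗ[Λ] M, φ ∘ₗ j = 0 → ∃ ψ : B →ₗ[Λ] M, ψ ∘ₗ μ = φ) (φ : A →ₗ[Λ] N)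
    (hφ : φ ∘ₗ j = 0) : ∃ ψ : B →ₗ[Λ] N, ψ ∘ₗ μ = φ := by
  obtain ⟨n, a, b, -, hab⟩ := hN.exists_comp
  choose e he using fun i => h (b i ∘ₗ φ) (by rw [LinearMap.comp_assoc, hφ, LinearMap.comp_zero])
  refine ⟨∑ i, a i ∘ₗ e i, ?_⟩
  conv_rhs => rw [← hab φ]
  rw [sum_comp']
  simp only [LinearMap.comp_assoc, he]

theorem InAdd.lift_zero (hN : InAdd Λ N M) (μ : A →ₗ[Λ] B) (p : B →ₗ[Λ] H)
    (h : ∀ φ : M →ₗ[Λ] B, p ∘ₗ φ = 0 → ∃ ψ : M →ₗ[Λ] A, μ ∘ₗ ψ = φ) (φ : N →ₗ[Λ] B)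
    (hφ : p ∘ₗ φ = 0) : ∃ ψ : N →ₗ[Λ] A, μ ∘ₗ ψ = φ := by
  obtain ⟨n, a, b, hab, -⟩ := hN.exists_comp
  choose e he using fun i => h (φ ∘ₗ a i) (by rw [← LinearMap.comp_assoc, hφ, LinearMap.zero_comp])
  refine ⟨∑ i, e i ∘ₗ b i, ?_⟩
  conv_rhs => rw [← hab φ]
  rw [comp_sum']
  simp only [← LinearMap.comp_assoc, he]

variable {j : X →ₗ[Λ] A} {μ : A →ₗ[Λ] B} {p : B →ₗ[Λ] H}

/-- Biexact sequences from exactness of `(X, -)`. -/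
theorem BiexactSeq.of_homFrom (hj : Function.Injective j) (hjμ : Function.Exact j μ)
    (hμp : Function.Exact μ p) (hp : Function.Surjective p) (hA : InAdd Λ A M) (hB : InAdd Λ B M)
    (h₁ : ∀ φ : M →ₗ[Λ] H, ∃ ψ : M →ₗ[Λ] B, p ∘ₗ ψ = φ)
    (h₂ : ∀ φ : M →ₗ[Λ] B, p ∘ₗ φ = 0 → ∃ ψ : M →ₗ[Λ] A, μ ∘ₗ ψ = φ)
    (h₃ : ∀ φ : X →ₗ[Λ] M, ∃ ψ : A →ₗ[Λ] M, ψ ∘ₗ j = φ)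
    (h₄ : ∀ φ : A →ₗ[Λ] M, φ ∘ₗ j = 0 → ∃ ψ : B →ₗ[Λ] M, ψ ∘ₗ μ = φ)
    (h₅ : ∀ φ : X →ₗ[Λ] H, ∃ ψ : X →ₗ[Λ] B, p ∘ₗ ψ = φ)
    (h₆ : ∀ φ : X →ₗ[Λ] B, p ∘ₗ φ = 0 → ∃ ψ : X →ₗ[Λ] A, μ ∘ₗ ψ = φ) :
    BiexactSeq M j μ p where
  injective := hj
  exact_left := hjμ
  exact_right := hμp
  surjective := hp
  mem_left := hA
  mem_right := hB
  to_right := h₁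
  to_left := h₂
  from_left := h₃
  from_right := h₄
  lift κ := by
    obtain ⟨ψ, rfl⟩ := h₅ κ
    obtain ⟨ν, rfl⟩ := hB.extend j h₃ ψ
    exact ⟨ν, rfl⟩
  lift_zero ν hν := by
    -- The map `ν j` lifts through `μ` to `X → A`, which extends to `ν₂` on `A`. The remainder `ν -
    -- μ ν₂` kills `j` and so factors through `μ`.
    obtain ⟨ψ, hψ⟩ := h₆ _ hν
    obtain ⟨ν₂, rfl⟩ := hA.extend j h₃ ψ
    obtain ⟨ν₁, hν₁⟩ := hB.extend_zero j μ h₄ (ν - μ ∘ₗ ν₂)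
      (by rw [LinearMap.sub_comp, LinearMap.comp_assoc, hψ, sub_self])
    exact ⟨ν₁, ν₂, by rw [hν₁, sub_add_cancel]⟩

/-- Biexact sequences from exactness of `(-, H)`. -/
theorem BiexactSeq.of_homTo (hj : Function.Injective j) (hjμ : Function.Exact j μ)
    (hμp : Function.Exact μ p) (hp : Function.Surjective p) (hA : InAdd Λ A M) (hB : InAdd Λ B M)
    (h₁ : ∀ φ : M →ₗ[Λ] H, ∃ ψ : M →ₗ[Λ] B, p ∘ₗ ψ = φ)
    (h₂ : ∀ φ : M →ₗ[Λ] B, p ∘ₗ φ = 0 → ∃ ψ : M →ₗ[Λ] A, μ ∘ₗ ψ = φ)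
    (h₃ : ∀ φ : X →ₗ[Λ] M, ∃ ψ : A →ₗ[Λ] M, ψ ∘ₗ j = φ)
    (h₄ : ∀ φ : A →ₗ[Λ] M, φ ∘ₗ j = 0 → ∃ ψ : B →ₗ[Λ] M, ψ ∘ₗ μ = φ)
    (h₅ : ∀ φ : X →ₗ[Λ] H, ∃ ψ : A →ₗ[Λ] H, ψ ∘ₗ j = φ)
    (h₆ : ∀ φ : A →ₗ[Λ] H, φ ∘ₗ j = 0 → ∃ ψ : B →ₗ[Λ] H, ψ ∘ₗ μ = φ) :
    BiexactSeq M j μ p where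
  injective := hj
  exact_left := hjμ
  exact_right := hμp
  surjective := hp
  mem_left := hA
  mem_right := hB
  to_right := h₁
  to_left := h₂
  from_left := h₃
  from_right := h₄
  lift κ := by
    obtain ⟨ψ, rfl⟩ := h₅ κ
    obtain ⟨ν, rfl⟩ := hA.lift p h₁ ψ
    exact ⟨ν, rfl⟩
  lift_zero ν hν := by
    obtain ⟨ψ, hψ⟩ := h₆ (p ∘ₗ ν) hν
    obtain ⟨ν₁, rfl⟩ := hB.lift p h₁ ψ
    obtain ⟨ν₂, hν₂⟩ := hA.lift_zero μ p h₂ (ν - ν₁ ∘ₗ μ)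
      (by rw [LinearMap.comp_sub, ← hψ, LinearMap.comp_assoc, sub_self])
    exact ⟨ν₁, ν₂, by rw [hν₂, add_sub_cancel]⟩

/-- Lifting along `g` is lifting along the cokernel of its kernel. -/
theorem exists_lift_image {f : X →ₗ[Λ] A} {g : A →ₗ[Λ] B} {π : A →ₗ[Λ] C}
    (hfg : Function.Exact f g) (hfπ : Function.Exact f π) (hπ : Function.Surjective π)
    (hY : ∀ φ : Y →ₗ[Λ] C, ∃ ψ : Y →ₗ[Λ] A, π ∘ₗ ψ = φ) (φ : Y →ₗ[Λ] B)
    (hφ : ∀ y, φ y ∈ LinearMap.range g) : ∃ ψ : Y →ₗ[Λ] A, g ∘ₗ ψ = φ := by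
  obtain ⟨v, hv⟩ := exists_desc_of_exact hπ hfπ g hfg.apply_apply_eq_zero
  have hvi : Function.Injective v := (injective_iff_map_eq_zero v).2 fun c hc => by
    obtain ⟨a, rfl⟩ := hπ c
    rw [hv, hfg a] at hc
    exact (hfπ a).2 hc
  let q : B →ₗ[Λ] cokerMod v := (LinearMap.range v).mkQ
  have hvq : Function.Exact v q := LinearMap.exact_iff.2 (Submodule.ker_mkQ _)
  obtain ⟨w, hw⟩ := exists_lift_of_exact hvi hvq φ fun y => by
    obtain ⟨a, ha⟩ := hφ y
    rw [hvq, ← ha, ← hv]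
    exact ⟨π a, rfl⟩
  obtain ⟨ψ, rfl⟩ := hY w
  exact ⟨ψ, LinearMap.ext fun y => (hv (ψ y)).symm.trans (hw y)⟩

/-- The biexact sequence of a tuple in the relative generator correspondence. -/
theorem exists_biexactSeq_of_lowerF (hM : InAdd Λ M G) (h : OneFaithful (lowerF G) M) :
    ∃ (A B H : FDMod K Λ) (j : G →ₗ[Λ] A) (μ : A →ₗ[Λ] B) (p : B →ₗ[Λ] H),
      BiexactSeq M j μ p ∧ InAdd Λ M H := by
  obtain ⟨M₀, M₁, f, g, hM₀, hM₁, hf, hfg, ⟨C, π, ⟨-, hfπ, hπ⟩, hCG⟩,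
    ⟨C', π', ⟨-, hgπ', hπ'⟩, hCG'⟩, hex, hsurj⟩ := h G InAdd.refl.relProjective
  have hex' : Function.Exact g π' := fun x => by
    rw [hgπ' x]
    exact ⟨fun ⟨y, hy⟩ => hy ▸ y.2, fun ⟨y, hy⟩ => ⟨⟨g y, y, rfl⟩, hy⟩⟩
  -- The last two terms are enlarged by the identity of `M`; this preserves exactness and ensures `M
  -- ∈ add(H)` for the right end `H = C' ⊕ M`.
  have hlift : ∀ {Y : FDMod K Λ}, InAdd Λ Y G → ∀ φ : Y →ₗ[Λ] prodMod C' M,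
      ∃ ψ : Y →ₗ[Λ] prodMod M₁ M, π'.prodMap LinearMap.id ∘ₗ ψ = φ := fun hY φ => by
    obtain ⟨ψ, hψ⟩ := hY.lift π' hCG' (LinearMap.fst Λ C' M ∘ₗ φ)
    exact ⟨ψ.prod (LinearMap.snd Λ C' M ∘ₗ φ),
      LinearMap.ext fun y => Prod.ext (LinearMap.congr_fun hψ y) rfl⟩
  have hlift₀ : ∀ {Y : FDMod K Λ}, InAdd Λ Y G → ∀ φ : Y →ₗ[Λ] prodMod M₁ M,
      π'.prodMap LinearMap.id ∘ₗ φ = 0 → ∃ ψ : Y →ₗ[Λ] M₀,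
        (LinearMap.inl Λ M₁ M ∘ₗ g) ∘ₗ ψ = φ := fun hY φ hφ => by
    have hφ' : ∀ y, π' (φ y).1 = 0 ∧ (φ y).2 = 0 := fun y =>
      Prod.ext_iff.1 (LinearMap.congr_fun hφ y)
    obtain ⟨ψ, hψ⟩ := exists_lift_image hfg hfπ hπ (hY.lift π hCG) (LinearMap.fst Λ M₁ M ∘ₗ φ)
      fun y => (hex' _).1 (hφ' y).1
    exact ⟨ψ, LinearMap.ext fun y => Prod.ext (LinearMap.congr_fun hψ y) (hφ' y).2.symm⟩
  refine ⟨M₀, prodMod M₁ M, prodMod C' M, f, LinearMap.inl Λ M₁ M ∘ₗ g,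
    π'.prodMap LinearMap.id, BiexactSeq.of_homFrom hf (fun x => ?_) (fun x => ⟨fun hx => ?_, ?_⟩)
      (Prod.map_surjective.2 ⟨hπ', Function.surjective_id⟩) hM₀ (hM₁.prod InAdd.refl) (hlift hM)
      (hlift₀ hM) hsurj (fun φ hφ => ?_) (hlift InAdd.refl) (hlift₀ InAdd.refl),
    InAdd.right_of_prod⟩
  · rw [← hfg x]
    exact ⟨fun h => (Prod.ext_iff.1 h).1, fun h => Prod.ext h rfl⟩
  · obtain ⟨h1, h2⟩ := Prod.ext_iff.1 hx
    obtain ⟨y, hy⟩ := (hex' x.1).1 h1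
    exact ⟨y, Prod.ext hy h2.symm⟩
  · rintro ⟨y, rfl⟩
    exact Prod.ext (hex'.apply_apply_eq_zero y) rfl
  · obtain ⟨ψ, rfl⟩ := (hex φ).1 hφ
    exact ⟨ψ ∘ₗ LinearMap.fst Λ M₁ M, rfl⟩

/-- The biexact sequence of a tuple in the relative cogenerator correspondence. -/
theorem exists_biexactSeq_of_star (hGH : ARSeq G H) (hG : InAdd Λ (regMod Λ) G)
    (hM : InAdd Λ M H) (h : Star M G H) :
    ∃ (X A B : FDMod K Λ) (j : X →ₗ[Λ] A) (μ : A →ₗ[Λ] B) (p : B →ₗ[Λ] H),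
      BiexactSeq M j μ p ∧ InAdd Λ M X := by
  obtain ⟨A, B, μ, p, hA, hB, hμp, hp, h₁, h₂, h₃, h₄⟩ := h.exists_presentation hG
  -- The extra summand `M` is mapped to zero, so it becomes a summand of the kernel, and `M ∈
  -- add(X)`.
  let μ' : prodMod A M →ₗ[Λ] B := μ ∘ₗ LinearMap.fst Λ A M
  have hμ'p : Function.Exact μ' p := fun y => by
    rw [hμp y]
    exact ⟨fun ⟨x, hx⟩ => ⟨(x, 0), hx⟩, fun ⟨x, hx⟩ => ⟨x.1, hx⟩⟩
  let j : kerMod μ' →ₗ[Λ] prodMod A M := (LinearMap.ker μ').subtype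
  have hj : Function.Injective j := Subtype.val_injective
  have hjμ : Function.Exact j μ' := LinearMap.exact_iff.2 (Submodule.range_subtype _).symm
  let ι : kerMod p →ₗ[Λ] B := (LinearMap.ker p).subtype
  have hι : Function.Injective ι := Subtype.val_injective
  have hιp : Function.Exact ι p := LinearMap.exact_iff.2 (Submodule.range_subtype _).symm
  obtain ⟨c, hc⟩ := exists_lift_of_exact hι hιp μ' hμ'p.apply_apply_eq_zero
  have hcs : Function.Surjective c := fun y => by
    obtain ⟨x, hx⟩ := (hμ'p (ι y)).1 (hιp.apply_apply_eq_zero y)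
    exact ⟨x, hι ((hc x).trans hx)⟩
  have hjc : Function.Exact j c := fun x => by
    rw [← hjμ x, ← hc x]
    exact ⟨fun h => by rw [h, map_zero], fun h => hι (h.trans (map_zero ι).symm)⟩
  -- `Star` supplies exactness of `(G, -)` on the two short exact halves; `F_G = F^H` converts it to
  -- exactness of `(-, H)`.
  have h₅ := (hGH.upperF_of_lowerF (f := j) (g := c) ⟨⟨hj, hjc, hcs⟩, fun φ => by
    obtain ⟨ψ, hψ⟩ := h₄ (ι ∘ₗ φ) (LinearMap.ext fun x => hιp.apply_apply_eq_zero _)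
    exact ⟨LinearMap.inl Λ A M ∘ₗ ψ, LinearMap.ext fun x => hι <|
      (hc _).trans (LinearMap.congr_fun hψ x)⟩⟩).2
  have h₆ := (hGH.upperF_of_lowerF (f := ι) (g := p) ⟨⟨hι, hιp, hp⟩, h₃⟩).2
  have h₇ : ∀ φ : prodMod A M →ₗ[Λ] H, φ ∘ₗ j = 0 → ∃ ψ : B →ₗ[Λ] H, ψ ∘ₗ μ' = φ :=
    fun φ hφ => by
      obtain ⟨v, hv⟩ := exists_desc_of_exact hcs hjc φ (LinearMap.congr_fun hφ)
      obtain ⟨ψ, rfl⟩ := h₆ v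
      refine ⟨ψ, LinearMap.ext fun x => ?_⟩
      rw [← hv, LinearMap.comp_apply, ← hc]
      rfl
  refine ⟨kerMod μ', prodMod A M, B, j, μ', p, BiexactSeq.of_homTo hj hjμ hμ'p hp
    (hA.prod InAdd.refl) hB h₁ (fun φ hφ => ?_) (hM.extend j h₅)
    (hM.extend_zero j μ' h₇) h₅ h₇, ?_⟩
  · obtain ⟨ψ, rfl⟩ := h₂ φ hφ
    exact ⟨LinearMap.inl Λ A M ∘ₗ ψ, rfl⟩
  · refine InAdd.of_retract ((LinearMap.inr Λ A M).codRestrict (LinearMap.ker μ') fun m => ?_)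
      (LinearMap.snd Λ A M ∘ₗ j) fun m => rfl
    exact map_zero μ

theorem AddEqSum.inAdd_left (h : AddEqSum X A B) : InAdd Λ A X :=
  (h A).2 InAdd.left_of_prod

/-- Strong dualizing sequences are biexact. -/
theorem IsDualizingSeq.biexactSeq {N₀ N₁ : FDMod K Λ} {f : L →ₗ[Λ] N₀} {g : N₀ →ₗ[Λ] N₁}
    {h : N₁ →ₗ[Λ] R} (hs : IsDualizingSeq N f g h) (hL : HomFromExact L f g h) :
    BiexactSeq N f g h :=
  .of_homFrom hs.injective hs.exact_left hs.exact_right hs.surjective hs.mem_left hs.mem_right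
    hs.hom_from.2.2.2 (fun φ hφ => (hs.hom_from.2.2.1 φ).1 hφ) hs.hom_to.2.2.2
    (fun φ hφ => (hs.hom_to.2.2.1 φ).1 hφ) hL.2.2.2 (fun φ hφ => (hL.2.2.1 φ).1 hφ)

theorem IsDualizingSeq.inAdd_left {N₀ N₁ : FDMod K Λ} {f : L →ₗ[Λ] N₀} {g : N₀ →ₗ[Λ] N₁}
    {h : N₁ →ₗ[Λ] R} (hs : IsDualizingSeq N f g h) : InAdd Λ N L := by
  obtain ⟨Y, Z, -, -, h⟩ := hs.left_end
  exact h.inAdd_left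

theorem IsDualizingSeq.inAdd_right {N₀ N₁ : FDMod K Λ} {f : L →ₗ[Λ] N₀} {g : N₀ →ₗ[Λ] N₁}
    {h : N₁ →ₗ[Λ] R} (hs : IsDualizingSeq N f g h) : InAdd Λ N R := by
  obtain ⟨Y, Z, -, -, h⟩ := hs.right_end
  exact h.inAdd_left

/-- Generators with the same relative exact structure have the same additive closure. -/
theorem inAdd_of_lowerF_eq {G G' : FDMod K Λ} (h : lowerF G = lowerF G')
    (hG : InAdd Λ (regMod Λ) G') : InAdd Λ G G' := by
  have := InAdd.relProjective (InAdd.refl : InAdd Λ G G)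
  rw [h] at this
  exact this.inAdd hG

/-- `G` is `F_G`-projective, so it lies in `cogen¹(M)`; read relative to `F^H`, this is `Star`. -/
theorem OneFaithful.star {F : SESClass K Λ} (h : OneFaithful F M) (hG : F = lowerF G)
    (hH : F = upperF H) : Star M G H := by
  have hP : RelProjective F G := by
    rw [hG]
    exact InAdd.refl.relProjective
  have := h G hP
  rw [hH] at this
  exact this.star

end Sequences

/-! ## Strong dualizing sequences from the Auslander–Reiten sequence -/

section DualizingOfARSeq

variable {M N L R X Y A B C D G H : FDMod K Λ}

theorem homFromExact_of_lift {f : A →ₗ[Λ] B} {g : B →ₗ[Λ] C} {h : C →ₗ[Λ] D}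
    (hf : Function.Injective f) (hfg : Function.Exact f g) (hgh : Function.Exact g h)
    (h₁ : ∀ φ : X →ₗ[Λ] C, h ∘ₗ φ = 0 → ∃ ψ : X →ₗ[Λ] B, g ∘ₗ ψ = φ)
    (h₂ : ∀ φ : X →ₗ[Λ] D, ∃ ψ : X →ₗ[Λ] C, h ∘ₗ ψ = φ) : HomFromExact X f g h := by
  refine ⟨fun φ ψ hφ => LinearMap.ext fun x => hf (LinearMap.congr_fun hφ x),
    fun φ => ⟨fun hφ => ?_, ?_⟩, fun φ => ⟨h₁ φ, ?_⟩, h₂⟩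
  · obtain ⟨ψ, hψ⟩ := exists_lift_of_exact hf hfg φ (LinearMap.congr_fun hφ)
    exact ⟨ψ, LinearMap.ext hψ⟩
  · rintro ⟨ψ, rfl⟩
    exact LinearMap.ext fun x => hfg.apply_apply_eq_zero _
  · rintro ⟨ψ, rfl⟩
    exact LinearMap.ext fun x => hgh.apply_apply_eq_zero _

theorem homToExact_of_extend {f : A →ₗ[Λ] B} {g : B →ₗ[Λ] C} {h : C →ₗ[Λ] D}
    (hh : Function.Surjective h) (hfg : Function.Exact f g) (hgh : Function.Exact g h)
    (h₁ : ∀ φ : B →ₗ[Λ] X, φ ∘ₗ f = 0 → ∃ ψ : C →ₗ[Λ] X, ψ ∘ₗ g = φ)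
    (h₂ : ∀ φ : A →ₗ[Λ] X, ∃ ψ : B →ₗ[Λ] X, ψ ∘ₗ f = φ) : HomToExact X f g h := by
  refine ⟨fun φ ψ hφ => LinearMap.ext fun x => ?_,
    fun φ => ⟨fun hφ => ?_, ?_⟩, fun φ => ⟨h₁ φ, ?_⟩, h₂⟩
  · obtain ⟨y, rfl⟩ := hh x
    exact LinearMap.congr_fun hφ y
  · obtain ⟨ψ, hψ⟩ := exists_desc_of_exact hh hgh φ (LinearMap.congr_fun hφ)
    exact ⟨ψ, LinearMap.ext hψ⟩
  · rintro ⟨ψ, rfl⟩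
    exact LinearMap.ext fun x => (congrArg ψ (hgh.apply_apply_eq_zero x)).trans (map_zero ψ)
  · rintro ⟨ψ, rfl⟩
    exact LinearMap.ext fun x => (congrArg ψ (hfg.apply_apply_eq_zero x)).trans (map_zero ψ)

theorem HomFromExact.of_inAdd {f : A →ₗ[Λ] B} {g : B →ₗ[Λ] C} {h : C →ₗ[Λ] D}
    (hf : Function.Injective f) (hfg : Function.Exact f g) (hgh : Function.Exact g h)
    (hL : HomFromExact Y f g h) (hX : InAdd Λ X Y) : HomFromExact X f g h :=
  homFromExact_of_lift hf hfg hgh (hX.lift_zero g h fun φ hφ => (hL.2.2.1 φ).1 hφ)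
    (hX.lift h hL.2.2.2)

theorem Reflexive.of_inAdd (hY : Reflexive M Y) (hX : InAdd Λ X Y) : Reflexive M X := by
  obtain ⟨n, a, b, h₁, h₂⟩ := hX.exists_comp
  refine ⟨fun x hx => hX.eq_zero fun y => hY.1 _ fun z => hx (z ∘ₗ y), fun φ => ?_⟩
  choose y hy using fun i => hY.2 (φ ∘ₗ homMap M (b i))
  have hy' : ∀ i (z : Y →ₗ[Λ] M), φ (show homMod X M from z ∘ₗ b i) = z (y i) :=
    fun i => LinearMap.congr_fun (hy i)
  refine ⟨∑ i, a i (y i), LinearMap.ext fun z => ?_⟩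
  have h3 : φ z = ∑ i, φ (show homMod X M from ((show X →ₗ[Λ] M from z) ∘ₗ a i) ∘ₗ b i) :=
    (congrArg φ (h₁ (show X →ₗ[Λ] M from z)).symm).trans (map_sum φ _ _)
  rw [h3]
  refine Eq.trans (Finset.sum_congr rfl fun i _ => hy' i _) ?_
  exact (map_sum (show X →ₗ[Λ] M from z) (fun i => a i (y i)) Finset.univ).symm

/-- Maps `(X, M) → (P, M)` come from maps `P → X` if `X` is reflexive. -/
theorem Reflexive.exists_homMap {P : FDMod K Λ} (hX : Reflexive M X)
    (φ : homMod X M →ₗ[endAlg M] homMod P M) : ∃ u : P →ₗ[Λ] X, homMap M u = φ := by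
  choose u hu using fun p : P => hX.2 (evMap M p ∘ₗ φ)
  have hu' : ∀ (p : P) (y : X →ₗ[Λ] M),
      (show P →ₗ[Λ] M from φ (show homMod X M from y)) p = y (u p) :=
    fun p => LinearMap.congr_fun (hu p)
  refine ⟨{ toFun := u, map_add' := fun p q => sub_eq_zero.1 (hX.1 _ fun y => ?_),
            map_smul' := fun r p => sub_eq_zero.1 (hX.1 _ fun y => ?_) },
    LinearMap.ext fun y => LinearMap.ext fun p => (hu' p _).symm⟩
  · rw [map_sub, map_add, ← hu', ← hu', ← hu', map_add, sub_self]
  · rw [map_sub, RingHom.id_apply, map_smul, ← hu', ← hu', map_smul, sub_self]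

/-- The map `(P, M) → D(M, H)` given by a functional on `(P, H)`. -/
def homToDual (M : FDMod K Λ) {P H : FDMod K Λ} (τ : Module.Dual K (P →ₗ[Λ] H)) :
    homMod P M →ₗ[endAlg M] dualHomMod M H where
  toFun u := τ ∘ₗ preHom (show P →ₗ[Λ] M from u) H
  map_add' u v := LinearMap.ext fun k =>
    (congrArg τ (LinearMap.comp_add (f := (show P →ₗ[Λ] M from u))
      (g := (show P →ₗ[Λ] M from v)) (h := k))).trans (map_add τ _ _)
  map_smul' _ _ := rfl

/-- The strong dualizing sequence given by the Auslander–Reiten sequence. -/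
theorem ARSeq.areStrongDualizingEnds (hAR : ARSeq G H) (hG : InAdd Λ (regMod Λ) G)
    (hH : InAdd Λ (dualReg Λ) H) (hr : Reflexive M G) (hs : Star M G H) :
    AreStrongDualizingEnds (overEnd M) (homMod G M) (dualHomMod M H) := by
  obtain ⟨P₀, P₁, d, π, τ, hP₀, hP₁, hd, hπ, h₁, h₂⟩ := hAR
  have hf : Function.Injective (homMap M π) := fun y z hyz => LinearMap.ext fun x => by
    obtain ⟨p, rfl⟩ := hπ x
    exact LinearMap.congr_fun (f := (show P₁ →ₗ[Λ] M from homMap M π y)) hyz p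
  have hfg : Function.Exact (homMap M π) (homMap M d) := fun y => by
    refine ⟨fun hy => ?_, ?_⟩
    · obtain ⟨v, hv⟩ := exists_desc_of_exact hπ hd (show P₁ →ₗ[Λ] M from y)
        (LinearMap.congr_fun (f := (show P₀ →ₗ[Λ] M from homMap M d y)) hy)
      exact ⟨v, LinearMap.ext hv⟩
    · rintro ⟨v, rfl⟩
      exact LinearMap.ext fun x => (congrArg (show G →ₗ[Λ] M from v)
        (hd.apply_apply_eq_zero x)).trans (map_zero _)
  have hgh : Function.Exact (homMap M d) (homToDual M τ) := fun u => by
    refine Iff.trans ⟨fun hu => ?_, fun hu => LinearMap.ext hu⟩ (h₁ M (show P₀ →ₗ[Λ] M from u))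
    exact LinearMap.congr_fun (f := (show Module.Dual K (M →ₗ[Λ] H) from homToDual M τ u)) hu
  have hh : Function.Surjective (homToDual M τ) := fun ξ => by
    obtain ⟨u, hu⟩ := h₂ M (show Module.Dual K (M →ₗ[Λ] H) from ξ)
    exact ⟨u, LinearMap.ext fun k => (hu k).symm⟩
  -- By reflexivity, maps `(G, M) → (Pᵢ, M)` come from maps `Pᵢ → G`, and `Star` turns maps `(G, M)
  -- → D(M, H)` into functionals on `(G, H)`. The claim thus becomes the exact sequence of `ARSeq`
  -- evaluated at `X = G`.
  have hL : HomFromExact (homMod G M) (homMap M π) (homMap M d) (homToDual M τ) := by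
    refine homFromExact_of_lift hf hfg hgh (fun φ hφ => ?_) fun φ => ?_
    · obtain ⟨u, rfl⟩ := hr.exists_homMap φ
      have h0 : τ ∘ₗ preHom u H = 0 := hs.1 _ fun y k =>
        LinearMap.congr_fun (f := (show Module.Dual K (M →ₗ[Λ] H) from
          homToDual M τ (homMap M u y))) (LinearMap.congr_fun hφ y) k
      obtain ⟨r, rfl⟩ := (h₁ G u).1 (LinearMap.congr_fun h0)
      exact ⟨homMap M r, rfl⟩
    · obtain ⟨ξ, hξ⟩ := hs.2 (formOf φ) (formOf_comp φ)
      obtain ⟨u, hu⟩ := h₂ G ξ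
      exact ⟨homMap M u, LinearMap.ext fun y => LinearMap.ext fun k =>
        ((hξ y k).trans (hu _)).symm⟩
  have hNL : InAdd (endAlg M) (overEnd M) (homMod G M) := inAdd_overEnd_homMod hG
  have hNR : InAdd (endAlg M) (overEnd M) (dualHomMod M H) := inAdd_overEnd_dualHomMod hH
  have hN₀ : InAdd (endAlg M) (homMod P₁ M) (overEnd M) :=
    (hP₁.homMap M).trans (.of_linearEquiv (homRegEquiv M))
  have hN₁ : InAdd (endAlg M) (homMod P₀ M) (overEnd M) :=
    (hP₀.homMap M).trans (.of_linearEquiv (homRegEquiv M))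
  have hfrom := hL.of_inAdd hf hfg hgh hNL
  -- By reflexivity of `G` and `P₁`, homming into `M` recovers the presentation of `G` as
  -- evaluations.
  have hto : HomToExact (overEnd M) (homMap M π) (homMap M d) (homToDual M τ) := by
    refine homToExact_of_extend hh hfg hgh (fun φ hφ => ?_) fun φ => ?_
    · obtain ⟨p, rfl⟩ := (hr.of_inAdd (hP₁.trans hG)).2 φ
      obtain ⟨q, rfl⟩ := (hd p).1 (hr.1 _ (LinearMap.congr_fun hφ))
      exact ⟨evMap M q, rfl⟩
    · obtain ⟨x, rfl⟩ := hr.2 φ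
      obtain ⟨p, rfl⟩ := hπ x
      exact ⟨evMap M p, rfl⟩
  exact ⟨_, _, homMap M π, homMap M d, homToDual M τ,
    { injective := hf
      exact_left := hfg
      exact_right := hgh
      surjective := hh
      mem_left := hN₀
      mem_right := hN₁
      hom_to := hto
      hom_from := hfrom
      right_end := exists_cosyzygy hN₀ hN₁ hfg hgh hh hto hNR
      left_end := exists_syzygy hN₀ hN₁ hf hfg hgh hfrom hNL }, hL⟩

end DualizingOfARSeq

end RelFB

end

noncomputable section

namespace RelFB

variable {K : Type u} [Field K]

/-! ## Additive closures under Morita equivalences -/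

theorem InAdd.of_semilinear {R S X M X' M' : Type u} [Ring R] [Ring S]
    [AddCommGroup X] [Module R X] [AddCommGroup M] [Module R M] [AddCommGroup X'] [Module S X']
    [AddCommGroup M'] [Module S M'] (σ : R ≃+* S) (e : X ≃+ X')
    (he : ∀ r x, e (r • x) = σ r • e x) (e' : M ≃+ M') (he' : ∀ r x, e' (r • x) = σ r • e' x)
    (h : InAdd R X M) : InAdd S X' M' := by
  obtain ⟨n, a, b, hab⟩ := h.exists_sum
  have hs : ∀ s x, e.symm (s • x) = σ.symm s • e.symm x := fun s x =>
    e.injective (by simp [he])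
  have hs' : ∀ s x, e'.symm (s • x) = σ.symm s • e'.symm x := fun s x =>
    e'.injective (by simp [he'])
  refine InAdd.of_sum
    (fun i => { toFun := fun m => e (a i (e'.symm m)), map_add' := fun m m' => by simp,
                map_smul' := fun s m => by simp [he, hs'] })
    (fun i => { toFun := fun x => e' (b i (e.symm x)), map_add' := fun m m' => by simp,
                map_smul' := fun s m => by simp [he', hs] }) fun x => ?_
  have := congrArg e (hab (e.symm x))
  simpa using this

variable {Λ Λ' Λ'' : FDAlg K}

/-- The additive closures of `A` and `B` correspond under a Morita equivalence. -/
def Corr (e : MoritaEquivalence K Λ Λ') (A : FDMod K Λ) (B : FDMod K Λ') : Prop :=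
  ∀ X : ModuleCat.{u} Λ, InAdd Λ X A ↔ InAdd Λ' (e.eqv.functor.obj X) B

theorem Corr.refl (A : FDMod K Λ) : Corr (MoritaEquivalence.refl K Λ) A A := fun _ => Iff.rfl

theorem Corr.trans {e : MoritaEquivalence K Λ Λ'} {e' : MoritaEquivalence K Λ' Λ''}
    {A : FDMod K Λ} {B : FDMod K Λ'} {C : FDMod K Λ''} (h : Corr e A B) (h' : Corr e' B C) :
    Corr (e.trans K e') A C := fun X => (h X).trans (h' _)

theorem Corr.congr {e : MoritaEquivalence K Λ Λ'} {A A' : FDMod K Λ} {B B' : FDMod K Λ'}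
    (h : Corr e A B) (h₁ : InAdd Λ A A') (h₂ : InAdd Λ A' A) (h₃ : InAdd Λ' B B')
    (h₄ : InAdd Λ' B' B) : Corr e A' B' := fun X =>
  ⟨fun hX => ((h X).1 (hX.trans h₂)).trans h₃, fun hX => ((h X).2 (hX.trans h₄)).trans h₁⟩

theorem InAdd.map_functor {R S : Type u} [Ring R] [Ring S] (F : ModuleCat.{u} R ⥤ ModuleCat.{u} S)
    [F.Additive] {X Y : ModuleCat.{u} R} (h : InAdd R X Y) : InAdd S (F.obj X) (F.obj Y) := by
  obtain ⟨n, a, b, hab⟩ := h.exists_sum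
  refine InAdd.of_sum (fun i => (F.map (ModuleCat.ofHom (a i))).hom)
    (fun i => (F.map (ModuleCat.ofHom (b i))).hom) fun x => ?_
  have h1 : ∑ i, ModuleCat.ofHom (b i) ≫ ModuleCat.ofHom (a i) = 𝟙 X := by
    ext x
    simpa [LinearMap.sum_apply] using hab x
  have h2 := congrArg F.map h1
  simp only [Functor.map_sum, Functor.map_comp] at h2
  have h3 := LinearMap.congr_fun (congrArg ModuleCat.Hom.hom h2) x
  simpa [LinearMap.sum_apply] using h3

theorem Corr.of_inAdd (e : MoritaEquivalence K Λ Λ') {A : FDMod K Λ} {B : FDMod K Λ'}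
    (h₁ : InAdd Λ' (e.eqv.functor.obj (ModuleCat.of Λ A)) B)
    (h₂ : InAdd Λ' B (e.eqv.functor.obj (ModuleCat.of Λ A))) : Corr e A B := fun X => by
  refine ⟨fun h => (InAdd.map_functor e.eqv.functor (Y := ModuleCat.of Λ A) h).trans h₁,
    fun h => ?_⟩
  have h3 := InAdd.map_functor e.symm.eqv.functor (Y := e.eqv.functor.obj (ModuleCat.of Λ A))
    (h.trans h₂)
  let c := (e.eqv.unitIso.app (ModuleCat.of Λ A)).symm.toLinearEquiv
  exact (h3.trans (.of_linearEquiv c)).of_equiv (e.eqv.unitIso.app X).symm.toLinearEquiv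

theorem Corr.inAdd_left {e : MoritaEquivalence K Λ Λ'} {A : FDMod K Λ} {B : FDMod K Λ'}
    (h : Corr e A B) : InAdd Λ' (e.eqv.functor.obj (ModuleCat.of Λ A)) B :=
  (h (ModuleCat.of Λ A)).1 .refl

theorem Corr.inAdd_right {e : MoritaEquivalence K Λ Λ'} {A : FDMod K Λ} {B : FDMod K Λ'}
    (h : Corr e A B) : InAdd Λ' B (e.eqv.functor.obj (ModuleCat.of Λ A)) := by
  let c := (e.eqv.counitIso.app (ModuleCat.of Λ' B)).toLinearEquiv
  have h1 : InAdd Λ (e.eqv.inverse.obj (ModuleCat.of Λ' B)) A := (h _).2 (.of_linearEquiv c)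
  exact (InAdd.map_functor e.eqv.functor (Y := ModuleCat.of Λ A) h1).of_equiv c

theorem Corr.of_algEquiv (σ : Λ ≃ₐ[K] Λ') {A : FDMod K Λ} {B : FDMod K Λ'} (e : A ≃+ B)
    (he : ∀ (r : Λ) (x : A), e (r • x) = σ r • e x) :
    Corr (MoritaEquivalence.ofAlgEquiv σ) A B := fun X => by
  have hX : ∀ (r : Λ) (x : X), r • x = σ.symm (σ r) • x := fun r x => by
    rw [σ.symm_apply_apply]
  let F := (MoritaEquivalence.ofAlgEquiv σ).eqv.functor
  refine ⟨fun h => InAdd.of_semilinear (X' := F.obj X) σ.toRingEquiv (AddEquiv.refl X) hX e he h,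
    fun h => InAdd.of_semilinear (X := F.obj X) σ.symm.toRingEquiv (AddEquiv.refl X)
      (fun r x => rfl) e.symm (fun r x => e.injective ?_) h⟩
  have h1 := he (σ.symm r) (e.symm x)
  rw [σ.apply_symm_apply, e.apply_symm_apply] at h1
  exact (e.apply_symm_apply _).trans h1.symm

end RelFB

end

noncomputable section

namespace RelFB

variable {K : Type u} [Field K] {Λ : FDAlg K}

/-! ## The endomorphism algebras of modules with the same additive closure -/

section Transfer

open scoped ModuleCat.Algebra

variable (U V : FDMod K Λ)

/-- The module `((V, U), X)` over the endomorphism algebra of `V`. -/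
def transferObj (X : ModuleCat.{u} (endAlg U)) : ModuleCat.{u} (endAlg V) :=
  letI : Module (endAlg V) (homMod V U →ₗ[endAlg U] X) :=
    { smul := fun t f => f ∘ₗ homMap U (show V →ₗ[Λ] V from t)
      one_smul := fun _ => rfl
      mul_smul := fun _ _ _ => rfl
      smul_zero := fun _ => rfl
      smul_add := fun _ _ _ => rfl
      add_smul := fun s t f => LinearMap.ext fun w =>
        (congrArg f (LinearMap.comp_add (f := (show V →ₗ[Λ] V from s))
          (g := (show V →ₗ[Λ] V from t)) (h := (show V →ₗ[Λ] U from w)))).trans (map_add f _ _)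
      zero_smul := fun f => LinearMap.ext fun w =>
        (congrArg f (LinearMap.comp_zero (show V →ₗ[Λ] U from w))).trans (map_zero f) }
  ModuleCat.of (endAlg V) (homMod V U →ₗ[endAlg U] X)

/-- The functor `((V, U), -)` from modules over the endomorphism algebra of `U` to modules over the
endomorphism algebra of `V`. -/
def transfer : ModuleCat.{u} (endAlg U) ⥤ ModuleCat.{u} (endAlg V) where
  obj := transferObj U V
  map {X Y} φ := ModuleCat.ofHom (X := transferObj U V X) (Y := transferObj U V Y)
    { toFun := fun f => φ.hom ∘ₗ (show homMod V U →ₗ[endAlg U] X from f)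
      map_add' := fun f g => LinearMap.comp_add (f := (show homMod V U →ₗ[endAlg U] X from f))
        (g := (show homMod V U →ₗ[endAlg U] X from g)) (h := φ.hom)
      map_smul' := fun _ _ => rfl }

variable {U V}

theorem hom_map_comp {Y : Type u} [AddCommGroup Y] [Module (endAlg U) Y]
    (f : homMod V U →ₗ[endAlg U] Y) (s : U →ₗ[Λ] U) (w : V →ₗ[Λ] U) :
    f (show homMod V U from s ∘ₗ w) = toEnd s • f (show homMod V U from w) :=
  f.map_smul (toEnd s) w

/-- The natural map from `X` to `((U, V), ((V, U), X))`. -/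
def transferUnit (X : ModuleCat.{u} (endAlg U)) :
    X →ₗ[endAlg U] transferObj V U (transferObj U V X) where
  toFun x :=
    ({ toFun := fun q =>
        ({ toFun := fun w => toEnd ((show V →ₗ[Λ] U from w) ∘ₗ (show U →ₗ[Λ] V from q)) • x
           map_add' := fun w w' => add_smul
             (toEnd ((show V →ₗ[Λ] U from w) ∘ₗ (show U →ₗ[Λ] V from q)))
             (toEnd ((show V →ₗ[Λ] U from w') ∘ₗ (show U →ₗ[Λ] V from q))) x
           map_smul' := fun s w => mul_smul s (toEnd ((show V →ₗ[Λ] U from w) ∘ₗ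
             (show U →ₗ[Λ] V from q))) x } : homMod V U →ₗ[endAlg U] X)
       map_add' := fun q q' => LinearMap.ext fun w =>
        (congrArg (fun s => toEnd s • x) (LinearMap.comp_add (f := (show U →ₗ[Λ] V from q))
          (g := (show U →ₗ[Λ] V from q')) (h := (show V →ₗ[Λ] U from w)))).trans
          (add_smul (toEnd ((show V →ₗ[Λ] U from w) ∘ₗ (show U →ₗ[Λ] V from q))) _ x)
       map_smul' := fun _ _ => rfl } : homMod U V →ₗ[endAlg V] transferObj U V X)
  map_add' x x' := LinearMap.ext fun q => LinearMap.ext fun w => smul_add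
    (toEnd ((show V →ₗ[Λ] U from w) ∘ₗ (show U →ₗ[Λ] V from q))) x x'
  map_smul' s x := LinearMap.ext fun q => LinearMap.ext fun w => (mul_smul
    (toEnd ((show V →ₗ[Λ] U from w) ∘ₗ (show U →ₗ[Λ] V from q))) s x).symm

/-- With `∑ aᵢ bᵢ = id` on `U`, factored through `V`, the inverse is `g ↦ ∑ g(bᵢ)(aᵢ)`. -/
theorem transferUnit_bijective (h : InAdd Λ U V) (X : ModuleCat.{u} (endAlg U)) :
    Function.Bijective (transferUnit (V := V) X) := by
  obtain ⟨n, a, b, -, hab⟩ := h.exists_comp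
  have hab' : ∀ x : X, ∑ i, toEnd (a i ∘ₗ b i) • x = x := fun x => by
    rw [← Finset.sum_smul]
    exact (congrArg (fun s => toEnd s • x) (hab LinearMap.id)).trans (one_smul _ x)
  refine ⟨(injective_iff_map_eq_zero _).2 fun x hx => ?_, fun g => ?_⟩
  · rw [← hab' x]
    exact Finset.sum_eq_zero fun i _ =>
      LinearMap.congr_fun (f := (show homMod V U →ₗ[endAlg U] X from
        (show homMod U V →ₗ[endAlg V] transferObj U V X from transferUnit X x) (b i)))
        (LinearMap.congr_fun (f := (show homMod U V →ₗ[endAlg V] transferObj U V X from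
          transferUnit X x)) hx (b i)) (a i)
  · let g' : (U →ₗ[Λ] V) → (homMod V U →ₗ[endAlg U] X) := fun q =>
      (show homMod U V →ₗ[endAlg V] transferObj U V X from g) q
    have hg' : ∀ (t : V →ₗ[Λ] V) (q : U →ₗ[Λ] V) (w : V →ₗ[Λ] U),
        g' (t ∘ₗ q) w = g' q (show homMod V U from w ∘ₗ t) := fun t q w =>
      LinearMap.congr_fun (f := (show homMod V U →ₗ[endAlg U] X from g' (t ∘ₗ q)))
        (hom_map_comp (show homMod U V →ₗ[endAlg V] transferObj U V X from g) t q) w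
    refine ⟨∑ i, g' (b i) (a i), LinearMap.ext fun q => LinearMap.ext fun w => ?_⟩
    have h1 : ∀ i, toEnd ((show V →ₗ[Λ] U from w) ∘ₗ (show U →ₗ[Λ] V from q)) • g' (b i) (a i) =
        g' ((show U →ₗ[Λ] V from q) ∘ₗ a i ∘ₗ b i) w := fun i => by
      rw [← hom_map_comp]
      exact (hg' ((show U →ₗ[Λ] V from q) ∘ₗ a i) (b i) (show V →ₗ[Λ] U from w)).symm
    refine Eq.trans (Finset.smul_sum.trans (Finset.sum_congr rfl fun i _ => h1 i)) ?_
    have h2 := comp_sum' (fun i => a i ∘ₗ b i) (show U →ₗ[Λ] V from q)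
    have h3 : (show U →ₗ[Λ] V from q) ∘ₗ ∑ i, a i ∘ₗ b i = (show U →ₗ[Λ] V from q) :=
      congrArg ((show U →ₗ[Λ] V from q) ∘ₗ ·) (hab LinearMap.id)
    have h4 : ∑ i, g' ((show U →ₗ[Λ] V from q) ∘ₗ a i ∘ₗ b i) = g' q :=
      (map_sum (show homMod U V →ₗ[endAlg V] transferObj U V X from g) _ _).symm.trans
        (congrArg g' (h2.symm.trans h3))
    exact (LinearMap.sum_apply _ _ _).symm.trans (LinearMap.congr_fun h4 w)

/-- The unit of the equivalence between modules over the endomorphism algebras. -/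
def transferUnitIso (h : InAdd Λ U V) :
    𝟭 (ModuleCat.{u} (endAlg U)) ≅ transfer U V ⋙ transfer V U :=
  NatIso.ofComponents
    (fun X => (LinearEquiv.ofBijective (transferUnit (V := V) X)
      (transferUnit_bijective h X)).toModuleIso)
    (fun φ => ModuleCat.hom_ext <| LinearMap.ext fun x => LinearMap.ext fun q =>
      LinearMap.ext fun w => (φ.hom.map_smul (toEnd ((show V →ₗ[Λ] U from w) ∘ₗ
        (show U →ₗ[Λ] V from q))) x).symm)

variable (U V) in
theorem transfer_linear : (transfer U V).Linear K where
  map_smul {X Y} φ r := ModuleCat.hom_ext <| LinearMap.ext fun f => LinearMap.ext fun w => by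
    let f' : homMod V U →ₗ[endAlg U] Y :=
      φ.hom ∘ₗ (show homMod V U →ₗ[endAlg U] X from f)
    have h1 : homMap U (show V →ₗ[Λ] V from algebraMap K (endAlg V) r) w =
        algebraMap K (endAlg U) r • w :=
      LinearMap.ext fun v => (LinearMap.map_smul_of_tower (show V →ₗ[Λ] U from w) r v)
    exact ((congrArg f' h1).trans (f'.map_smul _ _)).symm

/-- The endomorphism algebras of two modules with the same additive closure are Morita
equivalent. -/
def transferEquiv (h₁ : InAdd Λ U V) (h₂ : InAdd Λ V U) :
    MoritaEquivalence K (endAlg U) (endAlg V) where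
  eqv := CategoryTheory.Equivalence.mk (transfer U V) (transfer V U) (transferUnitIso h₁)
    (transferUnitIso h₂).symm
  linear := transfer_linear U V

/-- Composition gives `(G, V) ≅ ((V, U), (G, U))`; a dual basis of `V` in `add(U)` provides the
inverse. -/
theorem corr_transfer_homMod (h₁ : InAdd Λ U V) (h₂ : InAdd Λ V U) (G : FDMod K Λ) :
    Corr (transferEquiv h₁ h₂) (homMod G U) (homMod G V) := by
  obtain ⟨n, d, c, -, hdc⟩ := h₂.exists_comp
  let Φ : homMod G V →ₗ[endAlg V] transferObj U V (ModuleCat.of (endAlg U) (homMod G U)) :=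
    { toFun := fun y =>
        ({ toFun := fun w => (show V →ₗ[Λ] U from w) ∘ₗ (show G →ₗ[Λ] V from y)
           map_add' := fun _ _ => rfl
           map_smul' := fun _ _ => rfl } : homMod V U →ₗ[endAlg U] homMod G U)
      map_add' := fun y y' => LinearMap.ext fun w => LinearMap.comp_add
        (f := (show G →ₗ[Λ] V from y)) (g := (show G →ₗ[Λ] V from y'))
        (h := (show V →ₗ[Λ] U from w))
      map_smul' := fun _ _ => rfl }
  have hΦ : Function.Bijective Φ := by
    refine ⟨(injective_iff_map_eq_zero _).2 fun y hy => ?_, fun g => ?_⟩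
    · have h3 : ∀ i, c i ∘ₗ (show G →ₗ[Λ] V from y) = 0 := fun i =>
        LinearMap.congr_fun (f := (show homMod V U →ₗ[endAlg U] homMod G U from Φ y)) hy (c i)
      have h4 := hdc (show G →ₗ[Λ] V from y)
      simp only [h3, LinearMap.comp_zero, Finset.sum_const_zero] at h4
      exact h4.symm
    · let g' : homMod V U →ₗ[endAlg U] homMod G U := g
      let z : Fin n → (G →ₗ[Λ] V) := fun i => d i ∘ₗ (show G →ₗ[Λ] U from g' (c i))
      refine ⟨(show G →ₗ[Λ] V from ∑ i, z i), LinearMap.ext fun w => ?_⟩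
      refine Eq.trans (b := ∑ i, g' (show homMod V U from
        (show V →ₗ[Λ] U from w) ∘ₗ d i ∘ₗ c i)) ?_ ?_
      · refine (comp_sum' z (show V →ₗ[Λ] U from w)).trans (Finset.sum_congr rfl fun i _ => ?_)
        exact (hom_map_comp g' ((show V →ₗ[Λ] U from w) ∘ₗ d i) (c i)).symm
      · refine (map_sum g' _ _).symm.trans (congrArg g' ?_)
        exact (comp_sum' (fun i => d i ∘ₗ c i) (show V →ₗ[Λ] U from w)).symm.trans
          (congrArg ((show V →ₗ[Λ] U from w) ∘ₗ ·) (hdc LinearMap.id))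
  let e := LinearEquiv.ofBijective Φ hΦ
  exact Corr.of_inAdd _ (.of_linearEquiv e.symm) (.of_linearEquiv e)

theorem corr_transfer_dualHomMod (h₁ : InAdd Λ U V) (h₂ : InAdd Λ V U) (H : FDMod K Λ) :
    Corr (transferEquiv h₁ h₂) (dualHomMod U H) (dualHomMod V H) := by
  obtain ⟨n, d, c, hdc, hdc'⟩ := h₂.exists_comp
  let Φ : dualHomMod V H →ₗ[endAlg V]
      transferObj U V (ModuleCat.of (endAlg U) (dualHomMod U H)) :=
    { toFun := fun χ => homToDual U (show Module.Dual K (V →ₗ[Λ] H) from χ)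
      map_add' := fun _ _ => rfl
      map_smul' := fun _ _ => rfl }
  have hΦ : Function.Bijective Φ := by
    refine ⟨(injective_iff_map_eq_zero _).2 fun χ hχ => LinearMap.ext fun k => ?_, fun g => ?_⟩
    · refine ((congrArg (show Module.Dual K (V →ₗ[Λ] H) from χ) (hdc k).symm).trans
        (map_sum _ _ _)).trans (Finset.sum_eq_zero fun i _ => ?_)
      exact LinearMap.congr_fun (f := (show Module.Dual K (U →ₗ[Λ] H) from
        (show homMod V U →ₗ[endAlg U] dualHomMod U H from Φ χ) (c i)))
        (LinearMap.congr_fun (f := (show homMod V U →ₗ[endAlg U] dualHomMod U H from Φ χ))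
          hχ (c i)) (k ∘ₗ d i)
    · let β := formOf (show homMod V U →ₗ[endAlg U] dualHomMod U H from g)
      have hβ := formOf_comp (show homMod V U →ₗ[endAlg U] dualHomMod U H from g)
      refine ⟨(show Module.Dual K (V →ₗ[Λ] H) from ∑ i, β (c i) ∘ₗ preHom (d i) H),
        LinearMap.ext fun w => LinearMap.ext fun h => ?_⟩
      refine (LinearMap.sum_apply (M₂ := K) _ _ _).trans ?_
      refine (Finset.sum_congr rfl fun i _ => (hβ ((show V →ₗ[Λ] U from w) ∘ₗ d i) (c i) h).symm).trans
        ?_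
      have h3 : ∑ i, β (((show V →ₗ[Λ] U from w) ∘ₗ d i) ∘ₗ c i) = β w :=
        (map_sum β _ _).symm.trans (congrArg β (hdc (show V →ₗ[Λ] U from w)))
      exact (LinearMap.sum_apply _ _ _).symm.trans (LinearMap.congr_fun h3 h)
  let e := LinearEquiv.ofBijective Φ hΦ
  exact Corr.of_inAdd _ (.of_linearEquiv e.symm) (.of_linearEquiv e)

end Transfer

end RelFB

end

noncomputable section

namespace RelFB

variable {K : Type u} [Field K] {Λ Λ' : FDAlg K}

/-! ## Morita equivalences preserve the constructions -/

section WellDefined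

open scoped ModuleCat.Algebra

/-- Being a generator is categorical. Let `I` be the trace of `P` in `Λ`. Each element of the image
of `Λ` under the functor is hit by a map from `Λ'`, that is, by the transpose of a map `P → Λ`,
which dies in `Λ / I`. So the functor kills `Λ → Λ / I`, faithfulness gives `1 ∈ I`, and the
resulting finite sum splits `Λ` off a power of `P`. -/
theorem inAdd_regMod_inverse (e : MoritaEquivalence K Λ Λ') :
    InAdd Λ (regMod Λ) (e.eqv.inverse.obj (ModuleCat.of Λ' Λ')) := by
  let F := e.eqv.functor
  let P : ModuleCat.{u} Λ := e.eqv.inverse.obj (ModuleCat.of Λ' Λ')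
  let I : Submodule Λ Λ := ⨆ f : P →ₗ[Λ] Λ, LinearMap.range f
  let q : ModuleCat.of Λ Λ ⟶ ModuleCat.of Λ (Λ ⧸ I) := ModuleCat.ofHom I.mkQ
  have hFq : F.map q = 0 := by
    refine ModuleCat.hom_ext <| LinearMap.ext fun y => ?_
    let g : ModuleCat.of Λ' Λ' ⟶ F.obj (ModuleCat.of Λ Λ) :=
      ModuleCat.ofHom (LinearMap.toSpanSingleton Λ' _ y)
    let f := (e.eqv.symm.toAdjunction.homEquiv (ModuleCat.of Λ' Λ') (ModuleCat.of Λ Λ)).symm g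
    have hf : f ≫ q = 0 := ModuleCat.hom_ext <| LinearMap.ext fun x =>
      (Submodule.Quotient.mk_eq_zero I).2
        (le_iSup (fun f : P →ₗ[Λ] Λ => LinearMap.range f) f.hom ⟨x, rfl⟩)
    have hg : g = e.eqv.symm.toAdjunction.unit.app _ ≫ F.map f := by
      refine Eq.trans (Equiv.apply_symm_apply
        (e.eqv.symm.toAdjunction.homEquiv (ModuleCat.of Λ' Λ') (ModuleCat.of Λ Λ)) g).symm ?_
      exact e.eqv.symm.toAdjunction.homEquiv_unit _ _ _
    have h1 : g ≫ F.map q = 0 := by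
      rw [hg, Category.assoc, ← F.map_comp, hf, F.map_zero, Limits.comp_zero]
    have h2 := LinearMap.congr_fun (congrArg ModuleCat.Hom.hom h1) (1 : Λ')
    have h3 : g.hom (1 : Λ') = y := one_smul Λ' y
    exact (congrArg (F.map q).hom h3).symm.trans h2
  have hq : q = 0 := F.map_injective (hFq.trans (F.map_zero _ _).symm)
  have h1 : (1 : Λ) ∈ I := (Submodule.Quotient.mk_eq_zero I).1
    (LinearMap.congr_fun (congrArg ModuleCat.Hom.hom hq) (1 : Λ))
  obtain ⟨c, hc, hc1⟩ := (Submodule.mem_iSup_iff_exists_finsupp _ _).1 h1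
  choose x hx using hc
  refine InAdd.of_fintype (ι := c.support) (fun i => i.1)
    (fun i => LinearMap.toSpanSingleton Λ P (x i.1)) fun r => ?_
  have h2 : ∀ i : c.support, i.1 (LinearMap.toSpanSingleton Λ P (x i.1) r) =
      (show Λ from r) • c i.1 := fun i =>
    (i.1.map_smul (show Λ from r) (x i.1)).trans (congrArg ((show Λ from r) • ·) (hx i.1))
  refine (Finset.sum_congr rfl fun i _ => h2 i).trans ?_
  rw [← Finset.smul_sum, Finset.sum_coe_sort c.support fun i => c i]
  exact (congrArg ((show Λ from r) • ·) hc1).trans (mul_one (show Λ from r))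

theorem corr_regMod (e : MoritaEquivalence K Λ Λ') : Corr e (regMod Λ) (regMod Λ') := by
  refine Corr.of_inAdd e ?_ (inAdd_regMod_inverse e.symm)
  exact (InAdd.map_functor e.eqv.functor (X := ModuleCat.of Λ Λ) (inAdd_regMod_inverse e)).trans
    (.of_linearEquiv (e.eqv.counitIso.app (ModuleCat.of Λ' Λ')).toLinearEquiv)

/-- The image of a finite-dimensional module under a Morita equivalence. -/
def objFD (e : MoritaEquivalence K Λ Λ') (X : FDMod K Λ) : FDMod K Λ' where
  carrier := e.eqv.functor.obj (ModuleCat.of Λ X)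
  finite := by
    -- `X` is a quotient of `Λⁿ`; the equivalence preserves epimorphisms and sends `Λⁿ` into
    -- `add(Λ')`.
    have : Module.Finite Λ X := Module.Finite.of_restrictScalars_finite K Λ X
    obtain ⟨n, f, hf⟩ := Module.Finite.exists_fin' Λ X
    have h : InAdd Λ' (e.eqv.functor.obj (ModuleCat.of Λ (Fin n → Λ))) (regMod Λ') :=
      (InAdd.map_functor e.eqv.functor (Y := ModuleCat.of Λ Λ) (InAdd.pow n)).trans
        (corr_regMod e).inAdd_left
    have := h.finiteDimensional
    have : Epi (ModuleCat.ofHom f) := (ModuleCat.epi_iff_surjective _).2 hf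
    have hs := (ModuleCat.epi_iff_surjective (e.eqv.functor.map (ModuleCat.ofHom f))).1 inferInstance
    exact Module.Finite.of_surjective
      ((e.eqv.functor.map (ModuleCat.ofHom f)).hom.restrictScalars K) hs

/-- A Morita equivalence on maps. -/
def mapHom (e : MoritaEquivalence K Λ Λ') (X Y : FDMod K Λ) :
    (X →ₗ[Λ] Y) ≃ₗ[K] (objFD e X →ₗ[Λ'] objFD e Y) :=
  LinearEquiv.ofBijective
    ({
      toFun := fun f => (e.eqv.functor.map (ModuleCat.ofHom f)).hom
      map_add' := fun f g =>
        congrArg ModuleCat.Hom.hom (e.eqv.functor.map_add (f := ModuleCat.ofHom f)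
          (g := ModuleCat.ofHom g))
      map_smul' := fun r f => by
        refine congrArg ModuleCat.Hom.hom (Eq.trans (congrArg e.eqv.functor.map ?_)
          (Functor.map_smul e.eqv.functor r (ModuleCat.ofHom f)))
        refine ModuleCat.hom_ext <| LinearMap.ext fun x => ?_
        exact (algebraMap_smul Λ r (f x)).symm } : (X →ₗ[Λ] Y) →ₗ[K] (objFD e X →ₗ[Λ'] objFD e Y))
    ⟨fun _ _ h => congrArg ModuleCat.Hom.hom (e.eqv.functor.map_injective (ModuleCat.hom_ext h)),
      fun g => ⟨(e.eqv.functor.preimage (ModuleCat.ofHom g)).hom,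
        congrArg ModuleCat.Hom.hom (e.eqv.functor.map_preimage (ModuleCat.ofHom g))⟩⟩

theorem mapHom_comp (e : MoritaEquivalence K Λ Λ') {X Y Z : FDMod K Λ} (f : X →ₗ[Λ] Y)
    (g : Y →ₗ[Λ] Z) : mapHom e X Z (g ∘ₗ f) = mapHom e Y Z g ∘ₗ mapHom e X Y f :=
  congrArg ModuleCat.Hom.hom (e.eqv.functor.map_comp (ModuleCat.ofHom f) (ModuleCat.ofHom g))

/-- A Morita equivalence induces isomorphisms of endomorphism algebras. -/
def mapEnd (e : MoritaEquivalence K Λ Λ') (M : FDMod K Λ) :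
    endAlg M ≃ₐ[K] endAlg (objFD e M) :=
  AlgEquiv.ofLinearEquiv
    (show endAlg M ≃ₗ[K] endAlg (objFD e M) from mapHom e M M)
    (congrArg ModuleCat.Hom.hom (e.eqv.functor.map_id (ModuleCat.of Λ M)))
    fun f g => mapHom_comp e (show M →ₗ[Λ] M from g) (show M →ₗ[Λ] M from f)

theorem corr_mapEnd_homMod (e : MoritaEquivalence K Λ Λ') (M G : FDMod K Λ) :
    Corr (MoritaEquivalence.ofAlgEquiv (mapEnd e M)) (homMod G M)
      (homMod (objFD e G) (objFD e M)) :=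
  Corr.of_algEquiv (A := homMod G M) (B := homMod (objFD e G) (objFD e M)) (mapEnd e M)
    (mapHom e G M).toAddEquiv fun s y =>
      mapHom_comp e (show G →ₗ[Λ] M from y) (show M →ₗ[Λ] M from s)

theorem corr_mapEnd_dualHomMod (e : MoritaEquivalence K Λ Λ') (M H : FDMod K Λ) :
    Corr (MoritaEquivalence.ofAlgEquiv (mapEnd e M)) (dualHomMod M H)
      (dualHomMod (objFD e M) (objFD e H)) :=
  Corr.of_algEquiv (A := dualHomMod M H) (B := dualHomMod (objFD e M) (objFD e H)) (mapEnd e M)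
    (mapHom e M H).symm.dualMap.toAddEquiv fun s χ => LinearMap.ext fun h => by
      refine congrArg (show Module.Dual K (M →ₗ[Λ] H) from χ) ((mapHom e M H).injective ?_)
      refine (mapHom_comp e (show M →ₗ[Λ] M from s) _).trans ?_
      refine Eq.trans ?_ (LinearEquiv.apply_symm_apply _ _).symm
      exact congrArg (· ∘ₗ mapHom e M M s) (LinearEquiv.apply_symm_apply _ h)

/-- A Morita equivalence under which `M` and `M'` correspond induces a Morita equivalence of the
endomorphism algebras, compatible with the functors `(-, M)` and `D(M, -)`. -/
theorem exists_moritaEquivalence_endAlg (e : MoritaEquivalence K Λ Λ') {M : FDMod K Λ}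
    {M' : FDMod K Λ'} (hM : Corr e M M') :
    ∃ E : MoritaEquivalence K (endAlg M) (endAlg M'), Corr E (overEnd M) (overEnd M') ∧
      (∀ G G', Corr e G G' → Corr E (homMod G M) (homMod G' M')) ∧
      ∀ H H', Corr e H H' → Corr E (dualHomMod M H) (dualHomMod M' H') := by
  have h₁ : InAdd Λ' (objFD e M) M' := hM.inAdd_left
  have h₂ : InAdd Λ' M' (objFD e M) := hM.inAdd_right
  let E := (MoritaEquivalence.ofAlgEquiv (mapEnd e M)).trans K (transferEquiv h₁ h₂)
  have hE : ∀ G G', Corr e G G' → Corr E (homMod G M) (homMod G' M') := fun G G' hG =>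
    ((corr_mapEnd_homMod e M G).trans (corr_transfer_homMod h₁ h₂ (objFD e G))).congr .refl .refl
      (InAdd.homMap (X := objFD e G) hG.inAdd_left M')
      (InAdd.homMap (Y := objFD e G) hG.inAdd_right M')
  refine ⟨E, ?_, hE, fun H H' hH => ?_⟩
  -- Since `M ≅ (Λ, M)`, this is the case `G = Λ` of `hE`.
  · exact (hE _ _ (corr_regMod e)).congr (.of_linearEquiv (homRegEquiv M))
      (.of_linearEquiv (homRegEquiv M).symm) (.of_linearEquiv (homRegEquiv M'))
      (.of_linearEquiv (homRegEquiv M').symm)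
  · exact ((corr_mapEnd_dualHomMod e M H).trans
      (corr_transfer_dualHomMod h₁ h₂ (objFD e H))).congr .refl .refl
      (InAdd.dualHomMap (X := objFD e H) hH.inAdd_left M')
      (InAdd.dualHomMap (Y := objFD e H) hH.inAdd_right M')

end WellDefined

end RelFB

end

noncomputable section

namespace RelFB

variable {K : Type u} [Field K] {Λ Λ' : FDAlg K}

/-! ## Double endomorphism algebras -/

section Double

variable {M G H X : FDMod K Λ}

theorem Cogen₁.reflexive {F : SESClass K Λ} (h : Cogen₁ F M X) : Reflexive M X := by
  obtain ⟨M₀, M₁, f, g, hM₀, hM₁, hf, hfg, -, -, -, hsurj⟩ := h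
  exact reflexive_of_copresentation hM₀ hM₁ hf hfg hsurj

/-- If `Λ` is reflexive, then it is the endomorphism algebra of `M` over its endomorphism
algebra. -/
def Reflexive.algEquiv (h : Reflexive M (regMod Λ)) : Λ ≃ₐ[K] endAlg (overEnd M) :=
  AlgEquiv.ofBijective
    ({
      toFun := fun r => mulMap M r
      map_one' := LinearMap.ext fun m => one_smul Λ (show M from m)
      map_mul' := fun r s => LinearMap.ext fun m => mul_smul r s (show M from m)
      map_zero' := LinearMap.ext fun m => zero_smul Λ (show M from m)
      map_add' := fun r s => LinearMap.ext fun m => add_smul r s (show M from m)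
      commutes' := fun c => LinearMap.ext fun m => algebraMap_smul Λ c (show M from m) } :
      Λ →ₐ[K] endAlg (overEnd M))
    ⟨(injective_iff_map_eq_zero _).2 fun r hr => h.1 (show regMod Λ from r) fun y => by
        have h1 : (show Λ from r) • y (regOne Λ) = 0 :=
          LinearMap.congr_fun (f := mulMap M r) hr (y (regOne Λ))
        rw [← y.map_smul] at h1
        exact (congrArg y (regMod_eq_smul_one (show regMod Λ from r))).trans h1,
      fun φ => by
        let φ' : overEnd M →ₗ[endAlg M] overEnd M := φ
        obtain ⟨r, hr⟩ := h.2 (φ' ∘ₗ (homRegEquiv M).toLinearMap)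
        refine ⟨(show Λ from r), LinearMap.ext fun m => ?_⟩
        have h1 := LinearMap.congr_fun hr (show homMod (regMod Λ) M from regMap (show M from m))
        have h2 : φ' m = (show Λ from r) • (show M from m) :=
          (congrArg φ' (regMap_one (show M from m)).symm).trans h1
        exact h2.symm⟩

theorem Reflexive.corr (h : Reflexive M (regMod Λ)) (hG : Reflexive M G) :
    Corr (MoritaEquivalence.ofAlgEquiv h.algEquiv) G (homMod (homMod G M) (overEnd M)) :=
  Corr.of_algEquiv (A := G) (B := homMod (homMod G M) (overEnd M)) h.algEquiv
    (AddEquiv.ofBijective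
      ({
        toFun := fun x => evMap M x
        map_zero' := LinearMap.ext fun y => (show G →ₗ[Λ] M from y).map_zero
        map_add' := fun x x' => LinearMap.ext fun y => (show G →ₗ[Λ] M from y).map_add x x' } :
        G →+ (homMod G M →ₗ[endAlg M] overEnd M))
      ⟨(injective_iff_map_eq_zero _).2 fun x hx => hG.1 x
        (LinearMap.congr_fun (f := evMap M x) hx),
        fun φ => (hG.2 φ).imp fun _ hx => hx.symm⟩)
    fun r x => LinearMap.ext fun y => (show G →ₗ[Λ] M from y).map_smul r x

/-- `DH ≅ (M, D(M, H))` for coreflexive `H`. -/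
def Coreflexive.linearEquiv (hH : Coreflexive M H) :
    Module.Dual K H ≃ₗ[K] (overEnd M →ₗ[endAlg M] dualHomMod M H) :=
  LinearEquiv.ofBijective (coevMap M)
    ⟨(injective_iff_map_eq_zero _).2 fun ζ hζ => hH.1 ζ fun m h =>
        LinearMap.congr_fun (f := (show Module.Dual K (M →ₗ[Λ] H) from
          coevMap M ζ (show overEnd M from m))) (LinearMap.congr_fun hζ m) h,
      fun φ => (hH.2 φ).imp fun _ hζ => hζ.symm⟩

/-- Dualizing `DH ≅ (M, D(M, H))` identifies `H ≅ DDH` with `D(M, D(M, H))`, compatibly with `Λ ≅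
End_Γ(M)` for `Γ = End(M)`. -/
theorem Coreflexive.corr (h : Reflexive M (regMod Λ)) (hH : Coreflexive M H) :
    Corr (MoritaEquivalence.ofAlgEquiv h.algEquiv) H
      (dualHomMod (overEnd M) (dualHomMod M H)) :=
  Corr.of_algEquiv (A := H) (B := dualHomMod (overEnd M) (dualHomMod M H)) h.algEquiv
    ((Module.evalEquiv K H).trans hH.linearEquiv.symm.dualMap).toAddEquiv
    fun r x => LinearMap.ext fun φ => by
      obtain ⟨ζ, rfl⟩ := hH.linearEquiv.surjective φ
      have h1 : ∀ (ζ : Module.Dual K H) (x : H),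
          (Module.evalEquiv K H).trans hH.linearEquiv.symm.dualMap x (hH.linearEquiv ζ) = ζ x :=
        fun ζ x => LinearMap.congr_fun (hH.linearEquiv.symm_apply_apply ζ) x
      have h2 : hH.linearEquiv ζ ∘ₗ mulMap M r =
          hH.linearEquiv (ζ ∘ₗ DistribSMul.toLinearMap K H r) :=
        LinearMap.ext fun m => LinearMap.ext fun f =>
          congrArg ζ ((show M →ₗ[Λ] H from f).map_smul r m)
      refine (h1 ζ (r • x)).trans (Eq.symm ?_)
      exact (congrArg ((Module.evalEquiv K H).trans hH.linearEquiv.symm.dualMap x) h2).trans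
        (h1 _ x)

theorem Reflexive.corr_self (h : Reflexive M (regMod Λ)) :
    Corr (MoritaEquivalence.ofAlgEquiv h.algEquiv) M (overEnd (overEnd M)) :=
  Corr.of_algEquiv (A := M) (B := overEnd (overEnd M)) h.algEquiv (AddEquiv.refl M)
    fun _ _ => rfl

end Double

/-! ## The assignments on classes of tuples -/

theorem cls₃_eq (e : MoritaEquivalence K Λ Λ') {M G : FDMod K Λ} {M' G' : FDMod K Λ'}
    (hM : Corr e M M') (hG : Corr e G G') : cls₃ Λ M G = cls₃ Λ' M' G' := by
  refine Quotient.sound ⟨e, fun i => ?_⟩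
  fin_cases i
  exacts [hM, hG]

theorem cls₄_eq (e : MoritaEquivalence K Λ Λ') {M G H : FDMod K Λ} {M' G' H' : FDMod K Λ'}
    (hM : Corr e M M') (hG : Corr e G G') (hH : Corr e H H') :
    cls₄ Λ M G H = cls₄ Λ' M' G' H' := by
  refine Quotient.sound ⟨e, fun i => ?_⟩
  fin_cases i
  exacts [hM, hG, hH]

/-- The assignment `[Λ, M, G] ↦ [End(M), M, (G, M)]`. -/
def relGenMap (K : Type u) [Field K] : TupleClass K 2 → TupleClass K 2 :=
  Quotient.lift (fun t => cls₃ (endAlg (t.mod 0)) (overEnd (t.mod 0)) (homMod (t.mod 1) (t.mod 0)))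
    fun s t ⟨e, he⟩ => by
      obtain ⟨E, h₁, h₂, -⟩ := exists_moritaEquivalence_endAlg e (he 0)
      exact cls₃_eq E h₁ (h₂ _ _ (he 1))

/-- The assignment `[Λ, M, H] ↦ [End(M), M, D(M, H)]`. -/
def relCogenMap (K : Type u) [Field K] : TupleClass K 2 → TupleClass K 2 :=
  Quotient.lift
    (fun t => cls₃ (endAlg (t.mod 0)) (overEnd (t.mod 0)) (dualHomMod (t.mod 0) (t.mod 1)))
    fun s t ⟨e, he⟩ => by
      obtain ⟨E, h₁, -, h₂⟩ := exists_moritaEquivalence_endAlg e (he 0)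
      exact cls₃_eq E h₁ (h₂ _ _ (he 1))

/-- The assignment `[Λ, M, G, H] ↦ [End(M), M, (G, M), D(M, H)]`. -/
def relGenCogenMap (K : Type u) [Field K] : TupleClass K 3 → TupleClass K 3 :=
  Quotient.lift
    (fun t => cls₄ (endAlg (t.mod 0)) (overEnd (t.mod 0)) (homMod (t.mod 1) (t.mod 0))
      (dualHomMod (t.mod 0) (t.mod 2)))
    fun s t ⟨e, he⟩ => by
      obtain ⟨E, h₁, h₂, h₃⟩ := exists_moritaEquivalence_endAlg e (he 0)
      exact cls₄_eq E h₁ (h₂ _ _ (he 1)) (h₃ _ _ (he 2))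

theorem relGenMap_cls₃ (M G : FDMod K Λ) :
    relGenMap K (cls₃ Λ M G) = cls₃ (endAlg M) (overEnd M) (homMod G M) := rfl

theorem relCogenMap_cls₃ (M H : FDMod K Λ) :
    relCogenMap K (cls₃ Λ M H) = cls₃ (endAlg M) (overEnd M) (dualHomMod M H) := rfl

theorem relGenCogenMap_cls₄ (M G H : FDMod K Λ) : relGenCogenMap K (cls₄ Λ M G H) =
    cls₄ (endAlg M) (overEnd M) (homMod G M) (dualHomMod M H) := rfl

theorem relGenMap_relGenMap {M G : FDMod K Λ} (h : Reflexive M (regMod Λ))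
    (hG : Reflexive M G) : relGenMap K (relGenMap K (cls₃ Λ M G)) = cls₃ Λ M G :=
  (cls₃_eq _ h.corr_self (h.corr hG)).symm

theorem relCogenMap_relCogenMap {M H : FDMod K Λ} (h : Reflexive M (regMod Λ))
    (hH : Coreflexive M H) : relCogenMap K (relCogenMap K (cls₃ Λ M H)) = cls₃ Λ M H :=
  (cls₃_eq _ h.corr_self (hH.corr h)).symm

theorem relGenCogenMap_relGenCogenMap {M G H : FDMod K Λ} (h : Reflexive M (regMod Λ))
    (hG : Reflexive M G) (hH : Coreflexive M H) :
    relGenCogenMap K (relGenCogenMap K (cls₄ Λ M G H)) = cls₄ Λ M G H :=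
  (cls₄_eq _ h.corr_self (h.corr hG) (hH.corr h)).symm

/-! ## The correspondences -/

theorem relGenMap_mapsTo : Set.MapsTo (relGenMap K) (relGenTriples K) (relGenTriples K) := by
  rintro _ ⟨Λ, M, G, rfl, hG, hF⟩
  have hM : InAdd Λ M G := InAdd.right_of_prod.trans hG
  have hΛ : InAdd Λ (regMod Λ) G := InAdd.left_of_prod.trans hG
  obtain ⟨A, B, H, j, μ, p, h, hH⟩ := exists_biexactSeq_of_lowerF hM hF
  refine ⟨endAlg M, overEnd M, homMod G M, rfl,
    (inAdd_regMod_endAlg hM).prod (inAdd_overEnd_homMod hΛ), ?_⟩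
  rw [h.arSeq.lowerF_eq]
  exact h.oneFaithful hM hH

theorem relGenMap_involutive (c : TupleClass K 2) (hc : c ∈ relGenTriples K) :
    relGenMap K (relGenMap K c) = c := by
  obtain ⟨Λ, M, G, rfl, hG, hF⟩ := hc
  have hr : Reflexive M G := (hF G InAdd.refl.relProjective).reflexive
  exact relGenMap_relGenMap (hr.of_inAdd (InAdd.left_of_prod.trans hG)) hr

theorem relProjective_regMod_upperF (H : FDMod K Λ) : RelProjective (upperF H) (regMod Λ) :=
  fun _ _ _ _ _ hfg φ => (InAdd.refl.exists_lift hfg.1.2.2 φ).imp fun _ h => LinearMap.ext h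

/-- The auxiliary generator `Λ ⊕ τ⁻H` defines the same relative structure as `H`, so faithfulness
yields `Star` for the pair. -/
theorem exists_biexactSeq_of_upperF {M H : FDMod K Λ} (hM : InAdd Λ M H)
    (hF : OneFaithful (upperF H) M) :
    ∃ (X A B : FDMod K Λ) (j : X →ₗ[Λ] A) (μ : A →ₗ[Λ] B) (p : B →ₗ[Λ] H),
      BiexactSeq M j μ p ∧ InAdd Λ M X := by
  obtain ⟨T, hT⟩ := exists_isTauInv H
  have hAR := hT.arSeq.prod_regMod
  exact exists_biexactSeq_of_star hAR InAdd.left_of_prod hM (hF.star hAR.lowerF_eq.symm rfl)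

theorem relCogenMap_mapsTo :
    Set.MapsTo (relCogenMap K) (relCogenTriples K) (relCogenTriples K) := by
  rintro _ ⟨Λ, M, H, rfl, hH, hF⟩
  have hM : InAdd Λ M H := InAdd.right_of_prod.trans hH
  obtain ⟨X, A, B, j, μ, p, h, hX⟩ := exists_biexactSeq_of_upperF hM hF
  exact ⟨endAlg M, overEnd M, dualHomMod M H, rfl, (inAdd_dualReg_endAlg hM).prod
    (inAdd_overEnd_dualHomMod (InAdd.left_of_prod.trans hH)), h.oneFaithful hX hM⟩

theorem relCogenMap_involutive (c : TupleClass K 2) (hc : c ∈ relCogenTriples K) :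
    relCogenMap K (relCogenMap K c) = c := by
  obtain ⟨Λ, M, H, rfl, hH, hF⟩ := hc
  obtain ⟨X, A, B, j, μ, p, h, -⟩ :=
    exists_biexactSeq_of_upperF (InAdd.right_of_prod.trans hH) hF
  exact relCogenMap_relCogenMap (hF _ (relProjective_regMod_upperF H)).reflexive h.coreflexive

/-- The relations between the modules of a tuple in the domain of the relative Morita–Tachikawa
correspondence. -/
theorem arSeq_and_star {M G H T : FDMod K Λ} (hT : IsTauInv H T) (e : G ≃ₗ[Λ] (regMod Λ × T))
    (hF : OneFaithful (lowerF G) M) : ARSeq G H ∧ Star M G H := by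
  have hAR : ARSeq G H := hT.arSeq.prod_regMod.of_equiv e.symm
  exact ⟨hAR, hF.star rfl hAR.lowerF_eq⟩

theorem relGenCogenMap_mapsTo :
    Set.MapsTo (relGenCogenMap K) (relGenCogenTuples K) (strongDualizingTuples K) := by
  rintro _ ⟨Λ, M, G, H, rfl, hG, hH, ⟨T, hT, ⟨e⟩⟩, hMG, hMH, hF⟩
  obtain ⟨hAR, hs⟩ := arSeq_and_star hT e hF
  exact ⟨endAlg M, overEnd M, homMod G M, dualHomMod M H, rfl,
    hAR.areStrongDualizingEnds hG hH (hF G InAdd.refl.relProjective).reflexive hs,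
    inAdd_regMod_endAlg hMG, inAdd_dualReg_endAlg hMH⟩

theorem relGenCogenMap_mapsTo' :
    Set.MapsTo (relGenCogenMap K) (strongDualizingTuples K) (relGenCogenTuples K) := by
  rintro _ ⟨Γ, N, L, R, rfl, ⟨N₀, N₁, f, g, h, hs, hL⟩, hΓ, hDΓ⟩
  have hb := hs.biexactSeq hL
  obtain ⟨T, hT⟩ := exists_isTauInv (dualHomMod N R)
  have hAR := hT.arSeq.prod_regMod
  have hreg := inAdd_regMod_endAlg hs.inAdd_left
  -- Both generators define the structure `F^H` for `H = D(N, R)`, so they have the same additive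
  -- closure. The class depends only on that closure, which permits replacing `(L, N)` by `End(N) ⊕
  -- τ⁻H`.
  have h₁ : InAdd (endAlg N) (homMod L N) (prodMod (regMod (endAlg N)) T) :=
    inAdd_of_lowerF_eq (hb.arSeq.lowerF_eq.trans hAR.lowerF_eq.symm) InAdd.left_of_prod
  have h₂ : InAdd (endAlg N) (prodMod (regMod (endAlg N)) T) (homMod L N) :=
    inAdd_of_lowerF_eq (hAR.lowerF_eq.trans hb.arSeq.lowerF_eq.symm) hreg
  refine ⟨endAlg N, overEnd N, prodMod (regMod (endAlg N)) T, dualHomMod N R,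
    cls₄_eq (MoritaEquivalence.refl K _) (Corr.refl _) ((Corr.refl _).congr .refl .refl h₁ h₂)
      (Corr.refl _), InAdd.left_of_prod, inAdd_dualReg_endAlg hs.inAdd_right,
    ⟨T, hT, ⟨LinearEquiv.refl _ _⟩⟩, (inAdd_overEnd_homMod hΓ).trans h₁,
    inAdd_overEnd_dualHomMod hDΓ, ?_⟩
  rw [hAR.lowerF_eq]
  exact hb.oneFaithful hs.inAdd_left hs.inAdd_right

/-- The assignment is its own inverse: it exchanges the two sets, and on both of them the modules
are reflexive or coreflexive as the double endomorphism argument requires. -/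
theorem relGenCogenMap_bijOn :
    Set.BijOn (relGenCogenMap K) (relGenCogenTuples K) (strongDualizingTuples K) := by
  refine Set.InvOn.bijOn (f' := relGenCogenMap K) ⟨?_, ?_⟩ relGenCogenMap_mapsTo
    relGenCogenMap_mapsTo'
  · rintro _ ⟨Λ, M, G, H, rfl, hG, hH, ⟨T, hT, ⟨e⟩⟩, hMG, hMH, hF⟩
    obtain ⟨hAR, hs⟩ := arSeq_and_star hT e hF
    have hr : Reflexive M G := (hF G InAdd.refl.relProjective).reflexive
    obtain ⟨X, A, B, j, μ, p, h, -⟩ := exists_biexactSeq_of_star hAR hG hMH hs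
    exact relGenCogenMap_relGenCogenMap (hr.of_inAdd hG) hr h.coreflexive
  · rintro _ ⟨Γ, N, L, R, rfl, ⟨N₀, N₁, f, g, h, hs, hL⟩, hΓ, hDΓ⟩
    have hb := hs.biexactSeq hL
    exact relGenCogenMap_relGenCogenMap (hb.reflexive.of_inAdd hΓ) hb.reflexive hb.coreflexive

end RelFB

end

theorem mainTheorem4 (K : Type u) [Field K] :
    (∃ f : RelFB.TupleClass K 2 → RelFB.TupleClass K 2,
      (∀ (Λ : RelFB.FDAlg K) (M G : RelFB.FDMod K Λ),
        f (RelFB.cls₃ Λ M G) =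
          RelFB.cls₃ (RelFB.endAlg M) (RelFB.overEnd M) (RelFB.homMod G M)) ∧
      Set.MapsTo f (RelFB.relGenTriples K) (RelFB.relGenTriples K) ∧
      ∀ c ∈ RelFB.relGenTriples K, f (f c) = c) ∧
    (∃ f : RelFB.TupleClass K 2 → RelFB.TupleClass K 2,
      (∀ (Λ : RelFB.FDAlg K) (M H : RelFB.FDMod K Λ),
        f (RelFB.cls₃ Λ M H) =
          RelFB.cls₃ (RelFB.endAlg M) (RelFB.overEnd M) (RelFB.dualHomMod M H)) ∧
      Set.MapsTo f (RelFB.relCogenTriples K) (RelFB.relCogenTriples K) ∧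
      ∀ c ∈ RelFB.relCogenTriples K, f (f c) = c) ∧
    (∃ f : RelFB.TupleClass K 3 → RelFB.TupleClass K 3,
      (∀ (Λ : RelFB.FDAlg K) (M G H : RelFB.FDMod K Λ),
        f (RelFB.cls₄ Λ M G H) =
          RelFB.cls₄ (RelFB.endAlg M) (RelFB.overEnd M)
            (RelFB.homMod G M) (RelFB.dualHomMod M H)) ∧
      Set.BijOn f (RelFB.relGenCogenTuples K) (RelFB.strongDualizingTuples K)) := by
  exact ⟨⟨RelFB.relGenMap K, fun _ => RelFB.relGenMap_cls₃, RelFB.relGenMap_mapsTo,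
      RelFB.relGenMap_involutive⟩,
    ⟨RelFB.relCogenMap K, fun _ => RelFB.relCogenMap_cls₃, RelFB.relCogenMap_mapsTo,
      RelFB.relCogenMap_involutive⟩,
    RelFB.relGenCogenMap K, fun _ => RelFB.relGenCogenMap_cls₄, RelFB.relGenCogenMap_bijOn⟩
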